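/- **Theorem.** There is a deterministic fully dynamic interval coloring algorithm with the following properties. It starts with no intervals and receives an arbitrary online sequence of updates; each update either inserts a closed interval $[l,r]\subset\mathbb{R}$ with $l\le r$ (repetitions are allowed) or deletes an interval that is currently present, named by the index of the update that inserted it. It runs on a unit-cost random access machine which copies and compares real endpoints, and copies, compares, increments and decrements natural numbers and uses them as array indices. 1. After every update, the colors stored by the algorithm (the color of each present interval is stored explicitly, as a pair of natural numbers) form a proper coloring of the interval graph of the intervals currently present, i.e. intersecting intervals have different colors, and at most $3\omega-2$ colors are used, where $\omega$ is the clique number of that graph just after the update (no colors if no interval is present). 2. Let $n$ be the total number of intervals inserted so far (including the current update and including intervals deleted since), let $\Delta$ be the maximum degree of the interval graph formed by all of these intervals, and let $\omega$ be the clique number of the interval graph of the intervals present just after the update. Then, in the worst case, each insertion takes $O(1+\log n+\Delta\log\omega)$ steps and each deletion takes $O(1+\log n+\Delta^2\log n)$ steps, with an absolute constant. In particular, insertions take $O(\log n+\Delta\log\omega)$ steps whenever $n\ge 2$, and deletions take $O(\Delta^2\log n)$ steps whenever $\Delta\ge 1$. -/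

import Mathlib

noncomputable section

namespace DynInterval

/-! ### The machine: a unit-cost random access machine

Words are natural numbers and can only be copied, incremented, decremented, compared and used as
array indices, so a word never exceeds the largest input index or program constant by more than
the number of steps made. Keys are real numbers and can only be copied and compared.
A program is a finite term and thus names finitely many registers and arrays. -/

/-- `reg`: word registers, `mem a`: the `a`-th array of words, `kreg`: key registers,
`kmem a`: the `a`-th array of keys. -/
structure State where
  reg : ℕ → ℕ
  mem : ℕ → ℕ → ℕ
  kreg : ℕ → ℝ
  kmem : ℕ → ℕ → ℝ

/-- The initial state: everything is zero. -/
def State.init : State where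
  reg := fun _ => 0
  mem := fun _ _ => 0
  kreg := fun _ => 0
  kmem := fun _ _ => 0

inductive Instr where
  | nop : Instr
  /-- `reg x := c` -/
  | const (x c : ℕ) : Instr
  /-- `reg x := reg y` -/
  | copy (x y : ℕ) : Instr
  /-- `reg x := reg x + 1` -/
  | inc (x : ℕ) : Instr
  /-- `reg x := reg x - 1`, where `0 - 1 = 0` -/
  | dec (x : ℕ) : Instr
  /-- `reg x := mem a [reg y]` -/
  | load (x a y : ℕ) : Instr
  /-- `mem a [reg y] := reg x` -/
  | store (a y x : ℕ) : Instr
  /-- `kreg p := kreg q` -/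
  | kcopy (p q : ℕ) : Instr
  /-- `kreg p := kmem a [reg y]` -/
  | kload (p a y : ℕ) : Instr
  /-- `kmem a [reg y] := kreg p` -/
  | kstore (a y p : ℕ) : Instr

def Instr.apply : Instr → State → State
  | .nop, s => s
  | .const x c, s => { s with reg := Function.update s.reg x c }
  | .copy x y, s => { s with reg := Function.update s.reg x (s.reg y) }
  | .inc x, s => { s with reg := Function.update s.reg x (s.reg x + 1) }
  | .dec x, s => { s with reg := Function.update s.reg x (s.reg x - 1) }
  | .load x a y, s => { s with reg := Function.update s.reg x (s.mem a (s.reg y)) }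
  | .store a y x, s =>
      { s with mem := Function.update s.mem a (Function.update (s.mem a) (s.reg y) (s.reg x)) }
  | .kcopy p q, s => { s with kreg := Function.update s.kreg p (s.kreg q) }
  | .kload p a y, s => { s with kreg := Function.update s.kreg p (s.kmem a (s.reg y)) }
  | .kstore a y p, s =>
      { s with kmem := Function.update s.kmem a (Function.update (s.kmem a) (s.reg y) (s.kreg p)) }

inductive Test where
  /-- `reg x = reg y` -/
  | eq (x y : ℕ) : Test
  /-- `reg x < reg y` -/
  | lt (x y : ℕ) : Test
  /-- `kreg p ≤ kreg q` -/
  | kle (p q : ℕ) : Test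

def Test.Holds : Test → State → Prop
  | .eq x y, s => s.reg x = s.reg y
  | .lt x y, s => s.reg x < s.reg y
  | .kle p q, s => s.kreg p ≤ s.kreg q

/-- Programs. -/
inductive Prog where
  | instr (i : Instr) : Prog
  | seq (c d : Prog) : Prog
  | ite (t : Test) (c d : Prog) : Prog
  | loop (t : Test) (c : Prog) : Prog

/-- `Exec c s s' T`: started in `s`, the program `c` halts in `s'` after `T` steps, where each
instruction and each evaluation of a test is one step. -/
inductive Exec : Prog → State → State → ℕ → Prop
  | instr (i : Instr) (s : State) : Exec (.instr i) s (i.apply s) 1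
  | seq {c d : Prog} {s s' s'' : State} {m n : ℕ} :
      Exec c s s' m → Exec d s' s'' n → Exec (.seq c d) s s'' (m + n)
  | ite_true {t : Test} {c d : Prog} {s s' : State} {m : ℕ} :
      t.Holds s → Exec c s s' m → Exec (.ite t c d) s s' (m + 1)
  | ite_false {t : Test} {c d : Prog} {s s' : State} {m : ℕ} :
      ¬ t.Holds s → Exec d s s' m → Exec (.ite t c d) s s' (m + 1)
  | loop_true {t : Test} {c : Prog} {s s' s'' : State} {m n : ℕ} :
      t.Holds s → Exec c s s' m → Exec (.loop t c) s' s'' n → Exec (.loop t c) s s'' (m + n + 1)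
  | loop_false {t : Test} {c : Prog} {s : State} :
      ¬ t.Holds s → Exec (.loop t c) s s 1

/-- The machine is deterministic, so that the existence of a halting execution with given
properties is a statement about the only execution. -/
theorem Exec.deterministic {c : Prog} {s s₁ s₂ : State} {m n : ℕ}
    (h₁ : Exec c s s₁ m) (h₂ : Exec c s s₂ n) : s₁ = s₂ ∧ m = n := by
  induction h₁ generalizing s₂ n with
  | instr i s => cases h₂; exact ⟨rfl, rfl⟩
  | seq _ _ ih₁ ih₂ =>
    cases h₂ with
    | seq a b =>
      obtain ⟨rfl, rfl⟩ := ih₁ a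
      obtain ⟨rfl, rfl⟩ := ih₂ b
      exact ⟨rfl, rfl⟩
  | ite_true ht _ ih =>
    cases h₂ with
    | ite_true _ a => obtain ⟨rfl, rfl⟩ := ih a; exact ⟨rfl, rfl⟩
    | ite_false hf _ => exact absurd ht hf
  | ite_false ht _ ih =>
    cases h₂ with
    | ite_true hf _ => exact absurd hf ht
    | ite_false _ a => obtain ⟨rfl, rfl⟩ := ih a; exact ⟨rfl, rfl⟩
  | loop_true ht _ _ ih₁ ih₂ =>
    cases h₂ with
    | loop_true _ a b =>
      obtain ⟨rfl, rfl⟩ := ih₁ a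
      obtain ⟨rfl, rfl⟩ := ih₂ b
      exact ⟨rfl, rfl⟩
    | loop_false hf => exact absurd ht hf
  | loop_false ht =>
    cases h₂ with
    | loop_true hf _ _ => exact absurd hf ht
    | loop_false _ => exact ⟨rfl, rfl⟩

/-! ### Interval graphs and update sequences -/

/-- The interval graph of a family of closed intervals `[l, r]`, `l ≤ r`, of the real line
(repetitions allowed). -/
def intervalGraph {ι : Type*} (I : ι → NonemptyInterval ℝ) : SimpleGraph ι where
  Adj i j := i ≠ j ∧ ((I i : Set ℝ) ∩ (I j : Set ℝ)).Nonempty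
  symm := ⟨fun _ _ h => ⟨h.1.symm, by rw [Set.inter_comm]; exact h.2⟩⟩
  loopless := ⟨fun _ h => h.1 rfl⟩

/-- An update inserts an interval, or deletes the interval that was inserted by the update
with index `i`. -/
inductive Update where
  | insert (I : NonemptyInterval ℝ) : Update
  | delete (i : ℕ) : Update

/-- What has happened so far: `time` is the number of updates made, `inserted` is the set of the
indices of the insertions, `live` the set of those whose interval has not been deleted, and
`interval i` is the interval inserted by update `i` (a dummy value if `i ∉ inserted`). -/
structure History where
  time : ℕ
  interval : ℕ → NonemptyInterval ℝ
  inserted : Finset ℕ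
  live : Finset ℕ

def History.empty : History where
  time := 0
  interval := fun _ => NonemptyInterval.pure 0
  inserted := ∅
  live := ∅

/-- Only an interval that is present can be deleted. -/
def History.Legal (H : History) : Update → Prop
  | .insert _ => True
  | .delete i => i ∈ H.live

def History.step (H : History) : Update → History
  | .insert I =>
      { time := H.time + 1
        interval := Function.update H.interval H.time I
        inserted := insert H.time H.inserted
        live := insert H.time H.live }
  | .delete i => { H with time := H.time + 1, live := H.live.erase i }

/-- The interval graph of the intervals that are present. -/
def History.liveGraph (H : History) : SimpleGraph H.live :=
  intervalGraph fun i => H.interval i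

/-- The interval graph of all intervals inserted so far. -/
def History.insertedGraph (H : History) : SimpleGraph H.inserted :=
  intervalGraph fun i => H.interval i

/-- `ω`: the size of a largest clique among the intervals that are present. -/
def History.omega (H : History) : ℕ := H.liveGraph.cliqueNum

/-- `n`: the total number of intervals inserted so far. -/
def History.n (H : History) : ℕ := H.inserted.card

open Classical in
/-- `Δ`: the maximum degree of the interval graph of all intervals inserted so far. -/
def History.delta (H : History) : ℕ := H.insertedGraph.maxDegree

/-! ### Fully dynamic algorithms -/

/-- A fully dynamic algorithm: a program for insertions and a program for deletions. The whole
state of the machine is kept between updates. -/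
structure Algorithm where
  ins : Prog
  del : Prog

def Algorithm.code (A : Algorithm) : Update → Prog
  | .insert _ => A.ins
  | .delete _ => A.del

/-- The input of the update with index `time`. For the insertion of `[l, r]` the word register `0`
receives the index of the update (the name of the new interval) and the key registers `0` and `1`
receive `l` and `r`; for a deletion the word register `0` receives the name of the interval to be
deleted. -/
def State.input (s : State) (time : ℕ) : Update → State
  | .insert I =>
      { s with
        reg := Function.update s.reg 0 time
        kreg := Function.update (Function.update s.kreg 0 I.fst) 1 I.snd }
  | .delete i => { s with reg := Function.update s.reg 0 i }

/-- The color of the interval with name `i`, a pair (level, offset) of words that is read off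
at position `i` of the word arrays `0` and `1`. -/
def State.color (s : State) (i : ℕ) : ℕ × ℕ := (s.mem 0 i, s.mem 1 i)

/-- `A.Handles H s u s' T`: from the state `s` after the history `H`, the algorithm handles the
update `u` in `T` steps and ends in the state `s'`. -/
def Algorithm.Handles (A : Algorithm) (H : History) (s : State) (u : Update) (s' : State)
    (T : ℕ) : Prop :=
  Exec (A.code u) (s.input H.time u) s' T

/-- `A.Reaches H s`: the algorithm, started in the initial state, has handled some sequence of
legal updates with history `H` and is now in the state `s`. -/
inductive Algorithm.Reaches (A : Algorithm) : History → State → Prop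
  | init : A.Reaches History.empty State.init
  | step {H : History} {s s' : State} {u : Update} {T : ℕ} :
      A.Reaches H s → H.Legal u → A.Handles H s u s' T → A.Reaches (H.step u) s'

/-- After the history `H`, the colors held in the state `s` form a proper coloring of the
intervals that are present, with at most `3ω - 2` colors (no color if no interval is present). -/
def ProperlyColored (H : History) (s : State) : Prop :=
  (∀ i j : H.live, H.liveGraph.Adj i j → s.color i ≠ s.color j) ∧
    (H.live.image s.color).card ≤ 3 * H.omega - 2

end DynInterval

end

/-! ### Programs: step-counting triples, loop potentials and frame conditions. -/

noncomputable section

namespace DynInterval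

/-! ### Reasoning about programs -/

/-! Every present interval carries a level and an offset in {0, 1, 2}; together they are its color.
The invariant (`AllGood`) is that each interval w contains a point p at which all levels below that
of w occur, and at which w is the only interval of its own level. At such a point at least level + 1
present intervals meet, so levels stay below ω (`Good.exists_card`). If level 0 uses only offset 0,
the colors number at most 1 + 3(ω - 1) = 3ω - 2.

To color a new interval z, give it the highest level b such that all levels below b occur at some
point of z. Then z is good. An old interval u stays good, because if z had the level of u and
covered the witness of u, all levels up to b would occur at that point of z, against maximality
(`good_insert`). For the offset, take a neighbour of z on level b. Its witness lies outside z, since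
otherwise z could go higher. It also misses the point q of z at which the levels below b occur, so
it lies entirely to the left or entirely to the right of q. Two such neighbours on one side would
both reach beyond z, and one of them would cover the witness of the other. Hence there are at most
two (`not_three_neighbours`), some offset is free, and on level 0 there are none
(`not_meets_of_level_zero`).

When v is deleted, only neighbours of v can stop being good (`Good.erase`). They are tested one
after the other, and each one that fails is taken out of the coloring. The crucial fact is
`Good.erase_of_not_good`: taking out an interval that is not good destroys no good one. Indeed, if
it were the only interval of some level at the witness of w, that very point would witness its own
goodness. One pass over the neighbours therefore leaves only good intervals, and those taken out are
colored again like new ones.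

For the running time, the endpoints of all intervals ever inserted are kept in an AVL tree and in a
linked list, in an order that puts left endpoints before equal right endpoints. Closed intervals
thereby become half-open intervals of positions with the same intersections (`Store.lpos_lt_rpos`).
A tree node also stores the present interval of its subtree that reaches farthest right. This finds
in O(log n) steps the leftmost present interval t that reaches the left endpoint of z
(`runs_findFirst`). Between the left endpoint of t and the right endpoint of z lie only endpoints of
intervals that meet t or z, at most 4Δ + 4 of them (`Store.card_between_le`). A sweep over them
counts the active intervals by level. It determines the highest level of z, the raises being paid
for by a potential because a level never exceeds the number of active intervals
(`Scene.runs_level`), or it tests whether z is good (`Scene.runs_good`). A second walk resets the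
counters and reads off the offsets in use (`Scene.runs_cleanup`).

Coloring or testing one interval thus costs O(log n + Δ), and a deletion treats at most Δ
neighbours. An inserted interval without present neighbours is recognized by the tree search and
colored without a sweep. In the other case ω ≥ 2, so the term Δ is absorbed by Δ log ω. -/

open Classical in
/-- The effect of a program without loops. -/
def Prog.run : Prog → State → State
  | .instr i, s => i.apply s
  | .seq c d, s => d.run (c.run s)
  | .ite t c d, s => if t.Holds s then c.run s else d.run s
  | .loop _ _, s => s

theorem run_seq (c d : Prog) (s : State) : (Prog.seq c d).run s = d.run (c.run s) := rfl

theorem run_instr (i : Instr) (s : State) : (Prog.instr i).run s = i.apply s := rfl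

theorem run_ite_pos {t : Test} {s : State} (h : t.Holds s) (c d : Prog) :
    (Prog.ite t c d).run s = c.run s := by simp [Prog.run, h]

theorem run_ite_neg {t : Test} {s : State} (h : ¬ t.Holds s) (c d : Prog) :
    (Prog.ite t c d).run s = d.run s := by simp [Prog.run, h]

/-- A bound for the number of steps of a program without loops. -/
def Prog.cost : Prog → ℕ
  | .instr _ => 1
  | .seq c d => c.cost + d.cost
  | .ite _ c d => max c.cost d.cost + 1
  | .loop _ _ => 0

def Prog.loopFree : Prog → Bool
  | .instr _ => true
  | .seq c d => c.loopFree && d.loopFree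
  | .ite _ c d => c.loopFree && d.loopFree
  | .loop _ _ => false

theorem Prog.exec_run (c : Prog) (h : c.loopFree = true) (s : State) :
    ∃ t, t ≤ c.cost ∧ Exec c s (c.run s) t := by
  induction c generalizing s with
  | instr i => exact ⟨1, le_rfl, .instr i s⟩
  | seq c d ihc ihd =>
    simp only [Prog.loopFree, Bool.and_eq_true] at h
    obtain ⟨t, ht, hc⟩ := ihc h.1 s
    obtain ⟨u, hu, hd⟩ := ihd h.2 (c.run s)
    exact ⟨t + u, by simp only [Prog.cost]; omega, .seq hc hd⟩
  | ite b c d ihc ihd =>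
    simp only [Prog.loopFree, Bool.and_eq_true] at h
    by_cases hb : b.Holds s
    · obtain ⟨t, ht, hc⟩ := ihc h.1 s
      refine ⟨t + 1, by simp only [Prog.cost]; omega, ?_⟩
      simp only [Prog.run, if_pos hb]
      exact .ite_true hb hc
    · obtain ⟨t, ht, hc⟩ := ihd h.2 s
      refine ⟨t + 1, by simp only [Prog.cost]; omega, ?_⟩
      simp only [Prog.run, if_neg hb]
      exact .ite_false hb hc
  | loop b c _ => simp [Prog.loopFree] at h

/-- The program `c` halts from `s`, in a state and after a number of steps with the property `Q`. -/
def Runs (c : Prog) (s : State) (Q : State → ℕ → Prop) : Prop :=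
  ∃ s' t, Exec c s s' t ∧ Q s' t

theorem Runs.mono {c : Prog} {s : State} {Q Q' : State → ℕ → Prop} (h : Runs c s Q)
    (hQ : ∀ s' t, Q s' t → Q' s' t) : Runs c s Q' := by
  obtain ⟨s', t, h, h'⟩ := h
  exact ⟨s', t, h, hQ _ _ h'⟩

theorem Runs.seq {c d : Prog} {s : State} {Q : State → ℕ → Prop}
    (h : Runs c s fun s' t => Runs d s' fun s'' t' => Q s'' (t + t')) : Runs (.seq c d) s Q := by
  obtain ⟨s', t, h, s'', t', h', hQ⟩ := h
  exact ⟨s'', t + t', .seq h h', hQ⟩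

theorem Runs.block {c : Prog} {s : State} {Q : State → ℕ → Prop} (hc : c.loopFree = true)
    (h : ∀ t, t ≤ c.cost → Q (c.run s) t) : Runs c s Q := by
  obtain ⟨t, ht, he⟩ := c.exec_run hc s
  exact ⟨_, t, he, h t ht⟩

theorem Runs.ite {b : Test} {c d : Prog} {s : State} {Q : State → ℕ → Prop}
    (h₁ : b.Holds s → Runs c s fun s' t => Q s' (t + 1))
    (h₂ : ¬ b.Holds s → Runs d s fun s' t => Q s' (t + 1)) : Runs (.ite b c d) s Q := by
  by_cases hb : b.Holds s
  · obtain ⟨s', t, h, h'⟩ := h₁ hb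
    exact ⟨s', t + 1, .ite_true hb h, h'⟩
  · obtain ⟨s', t, h, hQ⟩ := h₂ hb
    exact ⟨s', t + 1, .ite_false hb h, hQ⟩

/-- Loops: `I v s` says that the invariant holds in the state `s` with potential `v`. -/
theorem Runs.loop_potential {b : Test} {c : Prog} (I : ℕ → State → Prop)
    (hI : ∀ v s, I v s → b.Holds s →
      Runs c s fun s' m => ∃ v', I v' s' ∧ m + 1 + v' ≤ v)
    {v : ℕ} {s : State} (hs : I v s) :
    Runs (.loop b c) s fun s' m => (∃ v', I v' s' ∧ m + v' ≤ v + 1) ∧ ¬ b.Holds s' := by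
  induction v using Nat.strong_induction_on generalizing s with
  | _ v ih =>
    by_cases hb : b.Holds s
    · obtain ⟨s', m, he, v', hv', hle⟩ := hI v s hs hb
      obtain ⟨s'', m', he', ⟨v'', h, hm'⟩, hn⟩ := ih v' (by omega) hv'
      exact ⟨s'', m + m' + 1, .loop_true hb he he', ⟨v'', h, by omega⟩, hn⟩
    · exact ⟨s, 1, .loop_false hb, ⟨v, hs, by omega⟩, hb⟩

theorem Runs.loop {b : Test} {c : Prog} (I : ℕ → State → Prop)
    (hI : ∀ v s, I v s → b.Holds s →
      Runs c s fun s' m => ∃ v', I v' s' ∧ m + 1 + v' ≤ v)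
    {v : ℕ} {s : State} (hs : I v s) :
    Runs (.loop b c) s fun s' m => m ≤ v + 1 ∧ (∃ v', I v' s') ∧ ¬ b.Holds s' :=
  (Runs.loop_potential I hI hs).mono fun _ _ ⟨⟨w, h, hm⟩, hn⟩ => ⟨by omega, ⟨w, h⟩, hn⟩

/-! What a program does not write stays the same. -/

/-- The registers that a program writes. -/
def Prog.regs : Prog → List ℕ
  | .instr (.const x _) | .instr (.copy x _) | .instr (.inc x) | .instr (.dec x)
  | .instr (.load x _ _) => [x]
  | .instr _ => []
  | .seq c d | .ite _ c d => c.regs ++ d.regs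
  | .loop _ c => c.regs

/-- The arrays of words that a program writes. -/
def Prog.arrs : Prog → List ℕ
  | .instr (.store a _ _) => [a]
  | .instr _ => []
  | .seq c d | .ite _ c d => c.arrs ++ d.arrs
  | .loop _ c => c.arrs

/-- The arrays of keys that a program writes. -/
def Prog.karrs : Prog → List ℕ
  | .instr (.kstore a _ _) => [a]
  | .instr _ => []
  | .seq c d | .ite _ c d => c.karrs ++ d.karrs
  | .loop _ c => c.karrs

/-- `s'` differs from `s` at most in what the program `c` writes. -/
structure Framed (c : Prog) (s s' : State) : Prop where
  reg : ∀ x, x ∉ c.regs → s'.reg x = s.reg x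
  mem : ∀ a, a ∉ c.arrs → s'.mem a = s.mem a
  kmem : ∀ a, a ∉ c.karrs → s'.kmem a = s.kmem a

theorem Exec.framed {c : Prog} {s s' : State} {t : ℕ} (h : Exec c s s' t) : Framed c s s' := by
  induction h with
  | instr i s =>
    constructor <;> cases i <;> simp +contextual [Prog.regs, Prog.arrs, Prog.karrs, Instr.apply]
  | seq _ _ h₁ h₂ =>
    constructor <;> intro x hx <;>
      simp only [Prog.regs, Prog.arrs, Prog.karrs, List.mem_append, not_or] at hx
    · rw [h₂.reg x hx.2, h₁.reg x hx.1]
    · rw [h₂.mem x hx.2, h₁.mem x hx.1]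
    · rw [h₂.kmem x hx.2, h₁.kmem x hx.1]
  | ite_true _ _ h =>
    constructor <;> intro x hx <;>
      simp only [Prog.regs, Prog.arrs, Prog.karrs, List.mem_append, not_or] at hx
    exacts [h.reg x hx.1, h.mem x hx.1, h.kmem x hx.1]
  | ite_false _ _ h =>
    constructor <;> intro x hx <;>
      simp only [Prog.regs, Prog.arrs, Prog.karrs, List.mem_append, not_or] at hx
    exacts [h.reg x hx.2, h.mem x hx.2, h.kmem x hx.2]
  | loop_true _ _ _ h₁ h₂ =>
    constructor <;> intro x hx
    · rw [h₂.reg x hx, h₁.reg x hx]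
    · rw [h₂.mem x hx, h₁.mem x hx]
    · rw [h₂.kmem x hx, h₁.kmem x hx]
  | loop_false _ => exact ⟨fun _ _ => rfl, fun _ _ => rfl, fun _ _ => rfl⟩

/-- Adds the frame to any specification, so that specifications need to mention only what a program
changes; whether a register or an array is written is then decided syntactically. -/
theorem Runs.framed {c : Prog} {s : State} {Q : State → ℕ → Prop} (h : Runs c s Q) :
    Runs c s fun s' t => Q s' t ∧ Framed c s s' := by
  obtain ⟨s', t, h, hQ⟩ := h
  exact ⟨s', t, h, hQ, h.framed⟩

theorem Prog.framed_run {c : Prog} (hc : c.loopFree = true) (s : State) : Framed c s (c.run s) := by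
  obtain ⟨t, -, h⟩ := c.exec_run hc s
  exact h.framed

theorem Framed.reg_lt {c : Prog} {s s' : State} (h : Framed c s s') {k : ℕ}
    (hc : c.regs.all (k ≤ ·) = true) : ∀ x < k, s'.reg x = s.reg x := fun x hx => by
  refine h.reg x fun hx' => ?_
  have := List.all_eq_true.1 hc x hx'
  simp at this
  omega

theorem Framed.kmem_eq {c : Prog} {s s' : State} (h : Framed c s s') (hc : c.karrs = []) :
    s'.kmem = s.kmem := funext fun a => h.kmem a (by simp [hc])

theorem Framed.mem_eq {c : Prog} {s s' : State} (h : Framed c s s') (hc : c.arrs = []) :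
    s'.mem = s.mem := funext fun a => h.mem a (by simp [hc])

infixr:60 ";;" => Prog.seq

abbrev nop : Prog := .instr .nop
abbrev const (x c : ℕ) : Prog := .instr (.const x c)
abbrev copy (x y : ℕ) : Prog := .instr (.copy x y)
abbrev inc (x : ℕ) : Prog := .instr (.inc x)
abbrev dec (x : ℕ) : Prog := .instr (.dec x)
abbrev load (x a y : ℕ) : Prog := .instr (.load x a y)
abbrev store (a y x : ℕ) : Prog := .instr (.store a y x)
abbrev kload (p a y : ℕ) : Prog := .instr (.kload p a y)
abbrev kstore (a y p : ℕ) : Prog := .instr (.kstore a y p)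

/-- The state with register `x` set to `k`. -/
def State.set (s : State) (x k : ℕ) : State := { s with reg := Function.update s.reg x k }

@[simp] theorem State.set_mem (s : State) (x k : ℕ) : (s.set x k).mem = s.mem := rfl
@[simp] theorem State.set_kmem (s : State) (x k : ℕ) : (s.set x k).kmem = s.kmem := rfl
theorem State.set_reg (s : State) (x k y : ℕ) :
    (s.set x k).reg y = if y = x then k else s.reg y := by
  simp [State.set, Function.update_apply]

/-- Put `1` into register `f` if registers `x` and `y` differ, and `0` if they agree. -/
def differ (f x y : ℕ) : Prog := const f 1 ;; .ite (.eq x y) (const f 0) nop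

/-- Repeat `c` while registers `x` and `y` differ; register `f` is used as a flag. -/
def whileNe (f x y : ℕ) (c : Prog) : Prog :=
  differ f x y ;; .loop (.eq f 4) (c ;; differ f x y)

theorem run_differ {f x y : ℕ} (hx : x ≠ f) (hy : y ≠ f) (s : State) :
    (differ f x y).run s = s.set f (if s.reg x = s.reg y then 0 else 1) := by
  simp only [differ, Prog.run, Instr.apply, Test.Holds, Function.update_of_ne hx,
    Function.update_of_ne hy]
  split_ifs <;> simp [State.set]

/-- Tests cannot be negated, so inequality is turned into a flag that is compared with the constant
1 in register `4`; the invariant must therefore survive any change of the flag. The overhead 4 of a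
round is three steps for the flag and one for the test. -/
theorem runs_whileNe {f x y : ℕ} {c : Prog} (hx : x ≠ f) (hy : y ≠ f)
    (I : ℕ → State → Prop)
    (hone : ∀ v s, I v s → s.reg 4 = 1)
    (hset : ∀ v s k, I v s → I v (s.set f k))
    (hI : ∀ v s, I v s → s.reg x ≠ s.reg y →
      Runs c s fun s' m => ∃ v', I v' s' ∧ m + 4 + v' ≤ v)
    {v : ℕ} {s : State} (hs : I v s) :
    Runs (whileNe f x y c) s fun s' m => m ≤ v + 4 ∧ (∃ v', I v' s') ∧ s'.reg x = s'.reg y := by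
  refine Runs.seq (Runs.block rfl fun t ht => ?_)
  rw [run_differ hx hy]
  simp only [differ, Prog.cost] at ht
  have key := Runs.loop (b := .eq f 4) (c := c ;; differ f x y)
    (fun v s => I v s ∧ s.reg f = if s.reg x = s.reg y then 0 else 1)
    (by
      rintro v s ⟨h, hf'⟩ hb
      simp only [Test.Holds, hone v s h] at hb
      have hne : s.reg x ≠ s.reg y := by
        intro h; simp [h, hb] at hf'
      refine Runs.seq ((hI v s h hne).mono ?_)
      rintro s' m ⟨v', hv', hle⟩
      refine Runs.block rfl fun t ht => ?_
      simp only [differ, Prog.cost] at ht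
      rw [run_differ hx hy]
      refine ⟨v', ⟨hset _ _ _ hv', ?_⟩, by omega⟩
      simp [State.set_reg, hx, hy])
    (v := v) (s := s.set f (if s.reg x = s.reg y then 0 else 1))
    ⟨hset _ _ _ hs, by simp [State.set_reg, hx, hy]⟩
  refine key.mono ?_
  rintro s' m ⟨hm, ⟨v', h, h'⟩, hb⟩
  refine ⟨by omega, ⟨v', h⟩, ?_⟩
  by_contra hne
  simp [Test.Holds, hone _ _ h, h', hne] at hb

end DynInterval

end

/-! ### The combinatorics of levels: good intervals, insertion, removal. -/

noncomputable section

namespace DynInterval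

/-! ### Levels

Intervals are half-open intervals `[L u, R u)` of a linear order. -/

section Levels

variable {P : Type*} [LinearOrder P] {L R : ℕ → P} {lev lev' : ℕ → ℕ} {S : Finset ℕ}

def Cov (L R : ℕ → P) (u : ℕ) (p : P) : Prop := L u ≤ p ∧ p < R u

/-- All levels below `b` occur at the point `p`. -/
def Full (L R : ℕ → P) (lev : ℕ → ℕ) (S : Finset ℕ) (p : P) (b : ℕ) : Prop :=
  ∀ i < b, ∃ u ∈ S, lev u = i ∧ Cov L R u p

/-- The interval `w` contains a point where all lower levels occur, and where `w` is the only
interval of its level. -/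
def Good (L R : ℕ → P) (lev : ℕ → ℕ) (S : Finset ℕ) (w : ℕ) : Prop :=
  ∃ p, Cov L R w p ∧ Full L R lev (S.erase w) p (lev w) ∧
    ∀ u ∈ S, u ≠ w → lev u = lev w → ¬ Cov L R u p

def Meets (L R : ℕ → P) (u w : ℕ) : Prop := L u < R w ∧ L w < R u

theorem Meets.symm {u w : ℕ} (h : Meets L R u w) : Meets L R w u := ⟨h.2, h.1⟩

theorem Cov.meets {u w : ℕ} {p : P} (hu : Cov L R u p) (hw : Cov L R w p) : Meets L R u w :=
  ⟨hu.1.trans_lt hw.2, hw.1.trans_lt hu.2⟩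

theorem Full.mono {T : Finset ℕ} {p : P} {b : ℕ} (h : Full L R lev S p b) (hST : S ⊆ T) :
    Full L R lev T p b := fun i hi => by
  obtain ⟨u, hu, h⟩ := h i hi
  exact ⟨u, hST hu, h⟩

theorem Full.congr {L' R' : ℕ → P} {p : P} {b : ℕ} (h : Full L R lev S p b)
    (hL : ∀ u ∈ S, L' u = L u) (hR : ∀ u ∈ S, R' u = R u) (hlev : ∀ u ∈ S, lev' u = lev u) :
    Full L' R' lev' S p b := fun i hi => by
  obtain ⟨u, hu, h, h'⟩ := h i hi
  exact ⟨u, hu, by rw [hlev u hu, h], by rwa [Cov, hL u hu, hR u hu]⟩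

theorem Good.congr {L' R' : ℕ → P} {w : ℕ} (hw : w ∈ S) (h : Good L R lev S w)
    (hL : ∀ u ∈ S, L' u = L u) (hR : ∀ u ∈ S, R' u = R u) (hlev : ∀ u ∈ S, lev' u = lev u) :
    Good L' R' lev' S w := by
  obtain ⟨p, hp, hf, hn⟩ := h
  refine ⟨p, by rwa [Cov, hL w hw, hR w hw], ?_, fun u hu hne => ?_⟩
  · rw [hlev w hw]
    exact hf.congr (fun u hu => hL u (Finset.mem_of_mem_erase hu))
      (fun u hu => hR u (Finset.mem_of_mem_erase hu))
      (fun u hu => hlev u (Finset.mem_of_mem_erase hu))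
  · rw [hlev u hu, hlev w hw, Cov, hL u hu, hR u hu]
    exact hn u hu hne

theorem Full.succ {u : ℕ} {p : P} (hu : u ∈ S) (hf : Full L R lev (S.erase u) p (lev u))
    (hp : Cov L R u p) : Full L R lev S p (lev u + 1) := fun i hi => by
  rcases Nat.lt_succ_iff_lt_or_eq.1 hi with hi | rfl
  · exact hf.mono (Finset.erase_subset _ _) i hi
  · exact ⟨u, hu, rfl, hp⟩

/-- An interval that is put on the highest possible level is good, and the others stay good. -/
theorem good_insert {z b : ℕ} (hz : z ∉ S) (hS : ∀ u ∈ S, Good L R lev S u)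
    (hb : ∃ p, Cov L R z p ∧ Full L R lev S p b)
    (hmax : ∀ p, Cov L R z p → ¬ Full L R lev S p (b + 1))
    (hlz : lev' z = b) (hlev : ∀ u ∈ S, lev' u = lev u) :
    ∀ u ∈ insert z S, Good L R lev' (insert z S) u := by
  intro u hu'
  rcases Finset.mem_insert.1 hu' with rfl | hu
  · obtain ⟨p, hp, hf⟩ := hb
    refine ⟨p, hp, ?_, fun w hw hne hl hc => ?_⟩
    · rw [Finset.erase_insert hz, hlz]
      exact hf.congr (fun _ _ => rfl) (fun _ _ => rfl) hlev
    · have hw := Finset.mem_of_mem_insert_of_ne hw hne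
      -- A second interval of level `b` at the witness would make all levels up to `b` occur at a
      -- point of `z`.
      refine hmax p hp fun i hi => ?_
      rcases Nat.lt_succ_iff_lt_or_eq.1 hi with hi | rfl
      · exact hf i hi
      · exact ⟨w, hw, by rw [← hlev w hw, hl, hlz], hc⟩
  · obtain ⟨p, hp, hf, hn⟩ := hS u hu
    have huz : u ≠ z := by rintro rfl; exact hz hu
    refine ⟨p, hp, ?_, fun w hw hne hl hc => ?_⟩
    · rw [hlev u hu]
      refine Full.mono (S := S.erase u) (hf.congr (fun _ _ => rfl) (fun _ _ => rfl) ?_) ?_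
      · exact fun w hw => hlev w (Finset.mem_of_mem_erase hw)
      · exact Finset.erase_subset_erase _ (Finset.subset_insert _ _)
    · clear hu'
      rcases Finset.mem_insert.1 hw with rfl | hw
      · rw [hlz, hlev u hu] at hl
        subst hl
        -- If `z` had the level of `u` and covered the witness of `u`, then `u` and the lower levels
        -- at that point would contradict the maximality of `b`.
        exact hmax p hc (Full.succ hu hf hp)
      · rw [hlev u hu, hlev w hw] at hl
        exact hn w hw hne hl hc

/-- On the highest possible level of `z` there are at most two neighbours of `z`. -/
theorem not_three_neighbours {z b : ℕ} (hS : ∀ u ∈ S, Good L R lev S u)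
    (hb : ∃ p, Cov L R z p ∧ Full L R lev S p b)
    (hmax : ∀ p, Cov L R z p → ¬ Full L R lev S p (b + 1))
    {f : Fin 3 → ℕ} (hf : Function.Injective f) (hfS : ∀ i, f i ∈ S) (hfb : ∀ i, lev (f i) = b)
    (hfz : ∀ i, Meets L R (f i) z) : False := by
  obtain ⟨q, hq, hfull⟩ := hb
  -- The witness of an interval of level `b` lies outside `z`, since all levels up to `b` occur
  -- there.
  have out : ∀ u ∈ S, lev u = b → ∀ p, Cov L R u p → Full L R lev (S.erase u) p (lev u) →
      ¬ Cov L R z p := by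
    rintro u hu rfl p hp hf hz
    exact hmax p hz (Full.succ hu hf hp)
  -- At `q` all levels below `b` occur, so no interval of level `b` may cover it: each one lies on
  -- one side of `q`.
  have hnq : ∀ u ∈ S, lev u = b → R u ≤ q ∨ q < L u := by
    intro u hu hlu
    by_contra! hcon
    refine hmax q hq fun i hi => ?_
    rcases Nat.lt_succ_iff_lt_or_eq.1 hi with hi | rfl
    · exact hfull i hi
    · exact ⟨u, hu, hlu, hcon.2, hcon.1⟩
  -- To the right of `q` both witnesses lie beyond the right end of `z`, while both intervals start
  -- before that end. The interval with the farther witness therefore covers the nearer witness,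
  -- which belongs to only one interval of this level. `left` is the mirror image.
  have right : ∀ u ∈ S, ∀ w ∈ S, lev u = b → lev w = b → Meets L R u z → Meets L R w z →
      q < L u → q < L w → u = w := by
    intro u hu w hw hlu hlw huz hwz h₁ h₂
    by_contra hne
    obtain ⟨p, hp, hpf, hpn⟩ := hS u hu
    obtain ⟨p', hp', hpf', hpn'⟩ := hS w hw
    have o : R z ≤ p := not_lt.1 fun h =>
      out u hu hlu p hp hpf ⟨hq.1.trans (h₁.le.trans hp.1), h⟩
    have o' : R z ≤ p' := not_lt.1 fun h =>
      out w hw hlw p' hp' hpf' ⟨hq.1.trans (h₂.le.trans hp'.1), h⟩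
    rcases le_total p p' with h | h
    · exact hpn w hw (Ne.symm hne) (by rw [hlu, hlw]) ⟨hwz.1.le.trans o, h.trans_lt hp'.2⟩
    · exact hpn' u hu hne (by rw [hlu, hlw]) ⟨huz.1.le.trans o', h.trans_lt hp.2⟩
  have left : ∀ u ∈ S, ∀ w ∈ S, lev u = b → lev w = b → Meets L R u z → Meets L R w z →
      R u ≤ q → R w ≤ q → u = w := by
    intro u hu w hw hlu hlw huz hwz h₁ h₂
    by_contra hne
    obtain ⟨p, hp, hpf, hpn⟩ := hS u hu
    obtain ⟨p', hp', hpf', hpn'⟩ := hS w hw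
    have o : p < L z := not_le.1 fun h =>
      out u hu hlu p hp hpf ⟨h, (hp.2.trans_le h₁).trans hq.2⟩
    have o' : p' < L z := not_le.1 fun h =>
      out w hw hlw p' hp' hpf' ⟨h, (hp'.2.trans_le h₂).trans hq.2⟩
    rcases le_total p p' with h | h
    · exact hpn' u hu hne (by rw [hlu, hlw]) ⟨hp.1.trans h, o'.trans huz.2⟩
    · exact hpn w hw (Ne.symm hne) (by rw [hlu, hlw]) ⟨hp'.1.trans h, o.trans hwz.2⟩
  have h01 : f 0 ≠ f 1 := fun h => absurd (hf h) (by decide)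
  have h02 : f 0 ≠ f 2 := fun h => absurd (hf h) (by decide)
  have h12 : f 1 ≠ f 2 := fun h => absurd (hf h) (by decide)
  have l := fun i j => left (f i) (hfS i) (f j) (hfS j) (hfb i) (hfb j) (hfz i) (hfz j)
  have r := fun i j => right (f i) (hfS i) (f j) (hfS j) (hfb i) (hfb j) (hfz i) (hfz j)
  rcases hnq _ (hfS 0) (hfb 0) with a | a <;> rcases hnq _ (hfS 1) (hfb 1) with b | b <;>
    rcases hnq _ (hfS 2) (hfb 2) with c | c
  · exact h01 (l 0 1 a b)
  · exact h01 (l 0 1 a b)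
  · exact h02 (l 0 2 a c)
  · exact h12 (r 1 2 b c)
  · exact h12 (l 1 2 b c)
  · exact h02 (r 0 2 a c)
  · exact h01 (r 0 1 a b)
  · exact h01 (r 0 1 a b)

/-- The larger of the two left endpoints would be a point of `z` at which level 0 occurs. This is
maximality for the level 0 of `z`, and it is why offset 0 suffices there. -/
theorem not_meets_of_level_zero {z u : ℕ} (hu : u ∈ S) (hLR : L u < R u) (hzz : L z < R z)
    (hmax : ∀ p, Cov L R z p → ¬ Full L R lev S p 1) (hl : lev u = 0) : ¬ Meets L R u z := by
  intro hm
  refine hmax (max (L u) (L z)) ⟨le_max_right _ _, max_lt hm.1 hzz⟩ fun i hi => ?_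
  exact ⟨u, hu, by omega, le_max_left _ _, max_lt hLR hm.2⟩

/-- Whatever supplies a lower level at the witness of `w` shares that point with `w`, so an interval
that misses `w` is not needed. -/
theorem Good.erase {v w : ℕ} (h : Good L R lev S w) (hvw : ¬ Meets L R v w) :
    Good L R lev (S.erase v) w := by
  obtain ⟨p, hp, hf, hn⟩ := h
  refine ⟨p, hp, fun i hi => ?_, fun u hu => hn u (Finset.mem_of_mem_erase hu)⟩
  obtain ⟨u, hu, hl, hc⟩ := hf i hi
  refine ⟨u, ?_, hl, hc⟩
  have huv : u ≠ v := by rintro rfl; exact hvw (hc.meets hp)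
  simp only [Finset.mem_erase] at hu ⊢
  exact ⟨hu.1, huv, hu.2⟩

/-- Removing an interval that is not good leaves all good intervals good. -/
theorem Good.erase_of_not_good {v w : ℕ} (hw : w ∈ S) (h : Good L R lev S w)
    (hv : ¬ Good L R lev S v) : Good L R lev (S.erase v) w := by
  by_contra hcon
  obtain ⟨p, hp, hf, hn⟩ := h
  have : ¬ Full L R lev ((S.erase v).erase w) p (lev w) := fun h' =>
    hcon ⟨p, hp, h', fun u hu => hn u (Finset.mem_of_mem_erase hu)⟩
  simp only [Full, not_forall] at this
  obtain ⟨i, hi, hno⟩ := this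
  -- `w` loses its witness only if the removed interval alone supplied some level `i` there.
  have hv' : ∀ u ∈ S.erase w, lev u = i → Cov L R u p → u = v := by
    intro u hu hl hc
    by_contra hne
    simp only [Finset.mem_erase] at hu
    exact hno ⟨u, by simp [hu, hne], hl, hc⟩
  obtain ⟨u, hu, hl, hc⟩ := hf i hi
  obtain rfl := hv' u hu hl hc
  have hwu : w ≠ u := fun h => by subst h; simp at hu
  -- At this same point all levels below `i` occur and level `i` occurs once, so the point witnesses
  -- the goodness of the removed interval.
  refine hv ⟨p, hc, fun k hk => ?_, fun x hx hne hlx hcx => ?_⟩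
  · obtain ⟨x, hx, hlx, hcx⟩ := hf k (by omega)
    refine ⟨x, ?_, hlx, hcx⟩
    simp only [Finset.mem_erase] at hx ⊢
    exact ⟨by rintro rfl; omega, hx.2⟩
  · have hxw : x ≠ w := by rintro rfl; omega
    exact hne (hv' x (by simp [hxw, hx]) (by rw [hlx, hl]) hcx)

/-- A good interval of level `k` contains a point that lies in at least `k + 1` intervals. -/
theorem Good.exists_card {w : ℕ} (hw : w ∈ S) (h : Good L R lev S w) :
    ∃ p, ∃ T ⊆ S, (∀ u ∈ T, Cov L R u p) ∧ lev w + 1 ≤ T.card := by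
  classical
  obtain ⟨p, hp, hf, hn⟩ := h
  refine ⟨p, S.filter (fun u => Cov L R u p), Finset.filter_subset _ _,
    fun u hu => (Finset.mem_filter.1 hu).2, ?_⟩
  have : Finset.range (lev w + 1) ⊆ (S.filter (fun u => Cov L R u p)).image lev := by
    intro i hi
    obtain ⟨u, hu, hl, hc⟩ := Full.succ hw hf hp i (Finset.mem_range.1 hi)
    exact Finset.mem_image.2 ⟨u, Finset.mem_filter.2 ⟨hu, hc⟩, hl⟩
  calc lev w + 1 = (Finset.range (lev w + 1)).card := by simp
    _ ≤ _ := Finset.card_le_card this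
    _ ≤ _ := Finset.card_image_le

end Levels

end DynInterval

end

/-! ### Storage layout and augmented AVL trees. -/

noncomputable section

namespace DynInterval

/-! ### The arrays

An interval is named by an index `t`; its two endpoints are nodes, numbered from `1` on. -/

/-- `1` if the interval `t` takes part in the coloring, and `0` otherwise -/
notation "aST" => 2
/-- the node of the left endpoint of `t` -/
notation "aLN" => 3
/-- the node of the right endpoint of `t` -/
notation "aRN" => 4
/-- the interval of a node -/
notation "aOWN" => 5
/-- `0` for left endpoints -/
notation "aTY" => 6
/-- nonzero for left endpoints of intervals that are present -/
notation "aLV" => 7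
/-- left child in the search tree -/
notation "aLC" => 8
/-- right child in the search tree -/
notation "aRC" => 9
/-- height of the subtree -/
notation "aHT" => 10
/-- the node of the subtree with nonzero entry in `aLV` that has the largest entry in `kRK` -/
notation "aAG" => 11
/-- the next node from left to right -/
notation "aNXT" => 12
/-- the number of active intervals of a level during a sweep -/
notation "aCNT" => 13
/-- the path from the root, and the directions taken -/
notation "aSTK" => 14
notation "aDIR" => 15
/-- a list of intervals -/
notation "aNB" => 16
/-- the endpoint of a node -/
notation "kKEY" => 0
/-- the right endpoint of the interval of a node -/
notation "kRK" => 1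

/-! ### Search trees in memory -/

/-- The number 0 is the empty pointer, so nodes start from 1. Throughout, register `1` holds the
root, register `2` the number of nodes, and registers `3` and `4` the constants 0 and 1. -/
inductive Tree where
  | leaf : Tree
  | node (l : Tree) (x : ℕ) (r : Tree) : Tree

namespace Tree

def root : Tree → ℕ
  | leaf => 0
  | node _ x _ => x

def ht : Tree → ℕ
  | leaf => 0
  | node l _ r => max l.ht r.ht + 1

def inorder : Tree → List ℕ
  | leaf => []
  | node l x r => l.inorder ++ x :: r.inorder

def Avl : Tree → Prop
  | leaf => True
  | node l _ r => l.Avl ∧ r.Avl ∧ l.ht ≤ r.ht + 1 ∧ r.ht ≤ l.ht + 1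

def mirror : Tree → Tree
  | leaf => leaf
  | node l x r => node r.mirror x l.mirror

@[simp] theorem root_mirror (t : Tree) : t.mirror.root = t.root := by cases t <;> rfl

@[simp] theorem ht_mirror (t : Tree) : t.mirror.ht = t.ht := by
  induction t <;> simp_all [mirror, ht, max_comm]

@[simp] theorem inorder_mirror (t : Tree) : t.mirror.inorder = t.inorder.reverse := by
  induction t <;> simp_all [mirror, inorder]

@[simp] theorem avl_mirror (t : Tree) : t.mirror.Avl ↔ t.Avl := by
  induction t <;> simp_all [mirror, Avl]; tauto

/-- Induction over the two subtrees, whose heights i ≤ j differ by at most 1. With sizes p and q one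
has to bound 2·2^j by (p + q + 2)²: four times the smaller square is enough if q ≤ p, and otherwise
2^j ≤ (q + 1)² and 2^j ≤ 2·2^i ≤ 2(p + 1)² add up to it. -/
theorem two_pow_le_sq_of_avl : ∀ {t : Tree}, t.Avl → 2 ^ t.ht ≤ (t.inorder.length + 1) ^ 2
  | leaf, _ => by simp [ht, inorder]
  | node l x r, h => by
    obtain ⟨hl, hr, h₁, h₂⟩ := h
    have a := two_pow_le_sq_of_avl hl
    have b := two_pow_le_sq_of_avl hr
    simp only [ht, inorder, List.length_append, List.length_cons]
    generalize l.inorder.length = p at *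
    generalize r.inorder.length = q at *
    have key : ∀ i j p q : ℕ, i ≤ j → j ≤ i + 1 → 2 ^ i ≤ (p + 1) ^ 2 → 2 ^ j ≤ (q + 1) ^ 2 →
        2 ^ (j + 1) ≤ (p + q + 2) ^ 2 := by
      intro i j p q h₁ h₂ a b
      have e : 2 ^ j ≤ 2 * 2 ^ i := by
        rw [mul_comm, ← pow_succ]
        exact Nat.pow_le_pow_right (by norm_num) h₂
      have hj : 2 ^ (j + 1) = 2 ^ j + 2 ^ j := by rw [pow_succ]; ring
      rcases le_total (q + 1) (p + 1) with h | h
      · nlinarith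
      · nlinarith
    rcases le_total l.ht r.ht with h | h
    · rw [max_eq_right h]
      exact (key _ _ p q h h₂ a b).trans (by ring_nf; exact le_rfl)
    · rw [max_eq_left h]
      exact (key _ _ q p h h₁ b a).trans (by ring_nf; exact le_rfl)

end Tree

/-- `a` is a best node of the list `ℓ`, and `0` if there is none. -/
def IsBest (m : ℕ → ℕ → ℕ) (rk : ℕ → ℝ) (ℓ : List ℕ) (a : ℕ) : Prop :=
  (a = 0 ∧ ∀ e ∈ ℓ, m aLV e = 0) ∨
    (a ≠ 0 ∧ a ∈ ℓ ∧ m aLV a ≠ 0 ∧ ∀ e ∈ ℓ, m aLV e ≠ 0 → rk e ≤ rk a)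

/-- The tree is stored in the arrays, where `cl` and `cr` are the arrays of the left and the right
children. -/
def Rep (cl cr : ℕ) (m : ℕ → ℕ → ℕ) (rk : ℕ → ℝ) : Tree → Prop
  | .leaf => True
  | .node l x r => x ≠ 0 ∧ m cl x = l.root ∧ m cr x = r.root ∧ m aHT x = max l.ht r.ht + 1 ∧
      IsBest m rk (l.inorder ++ x :: r.inorder) (m aAG x) ∧ Rep cl cr m rk l ∧ Rep cl cr m rk r

/-- The entries for the leaf. -/
def LeafEntries (m : ℕ → ℕ → ℕ) : Prop := m aHT 0 = 0 ∧ m aAG 0 = 0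

/-- The arrays differ at most in the entries of the nodes in `N` of the arrays of the tree. -/
def Agree (N : List ℕ) (m m' : ℕ → ℕ → ℕ) : Prop :=
  (∀ a, a ≠ aLC → a ≠ aRC → a ≠ aHT → a ≠ aAG → m' a = m a) ∧ ∀ a j, j ∉ N → m' a j = m a j

theorem Agree.trans {N : List ℕ} {m m' m'' : ℕ → ℕ → ℕ} (h : Agree N m m') (h' : Agree N m' m'') :
    Agree N m m'' :=
  ⟨fun a h₁ h₂ h₃ h₄ => (h'.1 a h₁ h₂ h₃ h₄).trans (h.1 a h₁ h₂ h₃ h₄),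
    fun a j hj => (h'.2 a j hj).trans (h.2 a j hj)⟩

theorem Agree.mono {N N' : List ℕ} {m m' : ℕ → ℕ → ℕ} (h : Agree N m m') (hN : N ⊆ N') :
    Agree N' m m' := ⟨h.1, fun a j hj => h.2 a j fun h => hj (hN h)⟩

theorem Agree.leafEntries {N : List ℕ} {m m' : ℕ → ℕ → ℕ} (h : Agree N m m') (h0 : 0 ∉ N)
    (hm : LeafEntries m) : LeafEntries m' := by
  rw [LeafEntries, h.2 _ _ h0, h.2 _ _ h0]; exact hm

theorem IsBest.congr {m m' : ℕ → ℕ → ℕ} {rk : ℕ → ℝ} {ℓ ℓ' : List ℕ} {a : ℕ}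
    (h : IsBest m rk ℓ a) (hm : ∀ e ∈ ℓ, m' aLV e = m aLV e) (hℓ : ∀ e, e ∈ ℓ' ↔ e ∈ ℓ) :
    IsBest m' rk ℓ' a := by
  simp only [IsBest, hℓ]
  rcases h with ⟨rfl, h⟩ | ⟨h0, h1, h2, h3⟩
  · exact .inl ⟨rfl, fun e he => by rw [hm e he, h e he]⟩
  · refine .inr ⟨h0, h1, by rwa [hm a h1], fun e he h => h3 e he ?_⟩
    rwa [hm e he] at h

theorem Rep.congr {cl cr : ℕ} {m m' : ℕ → ℕ → ℕ} {rk : ℕ → ℝ} :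
    ∀ {t : Tree}, Rep cl cr m rk t →
      (∀ e ∈ t.inorder, m' cl e = m cl e ∧ m' cr e = m cr e ∧ m' aHT e = m aHT e ∧
        m' aAG e = m aAG e ∧ m' aLV e = m aLV e) → Rep cl cr m' rk t
  | .leaf, _, _ => trivial
  | .node l x r, h, hm => by
    obtain ⟨h0, h1, h2, h3, h4, h5, h6⟩ := h
    obtain ⟨e1, e2, e3, e4, e5⟩ := hm x (by simp [Tree.inorder])
    refine ⟨h0, e1.trans h1, e2.trans h2, e3.trans h3, ?_, ?_, ?_⟩
    · rw [e4]
      exact h4.congr (fun e he => (hm e he).2.2.2.2) fun _ => Iff.rfl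
    · exact h5.congr fun e he => hm e (by simp [Tree.inorder, he])
    · exact h6.congr fun e he => hm e (by simp [Tree.inorder, he])

theorem Rep.agree {cl cr : ℕ} {m m' : ℕ → ℕ → ℕ} {rk : ℕ → ℝ} {t : Tree} {N : List ℕ}
    (h : Rep cl cr m rk t) (hm : Agree N m m') (hN : ∀ e ∈ t.inorder, e ∉ N) :
    Rep cl cr m' rk t :=
  h.congr fun e he => ⟨hm.2 _ _ (hN e he), hm.2 _ _ (hN e he), hm.2 _ _ (hN e he),
    hm.2 _ _ (hN e he), hm.2 _ _ (hN e he)⟩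

theorem Rep.mirror {cl cr : ℕ} {m : ℕ → ℕ → ℕ} {rk : ℕ → ℝ} :
    ∀ {t : Tree}, Rep cl cr m rk t → Rep cr cl m rk t.mirror
  | .leaf, _ => trivial
  | .node l x r, h => by
    obtain ⟨h0, h1, h2, h3, h4, h5, h6⟩ := h
    refine ⟨h0, by simpa using h2, by simpa using h1, by simpa [max_comm] using h3, ?_, h6.mirror,
      h5.mirror⟩
    exact h4.congr (fun _ _ => rfl) (fun e => by simp; tauto)

theorem Rep.ht_root {cl cr : ℕ} {m : ℕ → ℕ → ℕ} {rk : ℕ → ℝ} {t : Tree} (hm : LeafEntries m)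
    (h : Rep cl cr m rk t) : m aHT t.root = t.ht := by
  cases t with
  | leaf => exact hm.1
  | node l x r => exact h.2.2.2.1

theorem Rep.isBest_root {cl cr : ℕ} {m : ℕ → ℕ → ℕ} {rk : ℕ → ℝ} {t : Tree} (hm : LeafEntries m)
    (h : Rep cl cr m rk t) : IsBest m rk t.inorder (m aAG t.root) := by
  cases t with
  | leaf => exact .inl ⟨hm.2, by simp [Tree.inorder]⟩
  | node l x r => exact h.2.2.2.2.1

theorem Tree.root_eq_zero {cl cr : ℕ} {m : ℕ → ℕ → ℕ} {rk : ℕ → ℝ} {t : Tree}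
    (h : Rep cl cr m rk t) : t.root = 0 ↔ t = .leaf := by
  cases t with
  | leaf => simp [Tree.root]
  | node l x r => simp [Tree.root, h.1]

/-! ### Recomputing the entries of a node -/

open Classical in
def better (rk : ℕ → ℝ) (a b : ℕ) : ℕ :=
  if b = 0 then a else if a = 0 then b else if rk a ≤ rk b then b else a

theorem IsBest.better {m : ℕ → ℕ → ℕ} {rk : ℕ → ℝ} {ℓ ℓ' : List ℕ} {a b : ℕ}
    (h : IsBest m rk ℓ a) (h' : IsBest m rk ℓ' b) :
    IsBest m rk (ℓ ++ ℓ') (DynInterval.better rk a b) := by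
  simp only [IsBest, DynInterval.better, List.mem_append]
  rcases h with ⟨rfl, h⟩ | ⟨h0, h1, h2, h3⟩ <;> rcases h' with ⟨rfl, h'⟩ | ⟨h0', h1', h2', h3'⟩
  · left
    simp only [if_true, true_and]
    rintro e (he | he)
    exacts [h e he, h' e he]
  · right
    rw [if_neg h0', if_pos rfl]
    refine ⟨h0', .inr h1', h2', ?_⟩
    rintro e (he | he) hl
    exacts [absurd (h e he) hl, h3' e he hl]
  · right
    rw [if_pos rfl]
    refine ⟨h0, .inl h1, h2, ?_⟩
    rintro e (he | he) hl
    exacts [h3 e he hl, absurd (h' e he) hl]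
  · right
    rw [if_neg h0', if_neg h0]
    split_ifs with hle
    · refine ⟨h0', .inr h1', h2', ?_⟩
      rintro e (he | he) hl
      exacts [(h3 e he hl).trans hle, h3' e he hl]
    · refine ⟨h0, .inl h1, h2, ?_⟩
      rintro e (he | he) hl
      exacts [h3 e he hl, (h3' e he hl).trans (le_of_not_ge hle)]

/-- Replace the node in register `84` by the better one of the nodes in registers `84`, `85`. -/
def combine : Prog :=
  .ite (.eq 85 3) nop <|
    .ite (.eq 84 3) (copy 84 85) <|
      kload 10 kRK 84 ;; kload 11 kRK 85 ;; .ite (.kle 10 11) (copy 84 85) nop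

theorem run_combine (s : State) (h0 : s.reg 3 = 0) :
    (combine.run s).mem = s.mem ∧ (combine.run s).kmem = s.kmem ∧
      (combine.run s).reg 84 = better (s.kmem kRK) (s.reg 84) (s.reg 85) ∧
      ∀ x, x ≠ 84 → (combine.run s).reg x = s.reg x := by
  simp only [combine, Prog.run, Test.Holds, Instr.apply, h0, better, Function.update_apply]
  split_ifs <;> simp_all

/-- Recompute the height of the node in register `n`, and collect candidates for the best node. -/
def pullHeight (n : ℕ) : Prog :=
  load 80 aLC n ;; load 81 aRC n ;; load 82 aHT 80 ;; load 83 aHT 81 ;;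
    .ite (.lt 82 83) (copy 82 83) nop ;; inc 82 ;; store aHT n 82 ;;
    load 84 aLV n ;; .ite (.eq 84 3) nop (copy 84 n) ;; load 85 aAG 80

theorem run_pullHeight (n : ℕ) (hn : n < 80) (s : State) (h0 : s.reg 3 = 0) :
    ((pullHeight n).run s).kmem = s.kmem ∧
    (∀ x < 80, ((pullHeight n).run s).reg x = s.reg x) ∧
    ((pullHeight n).run s).reg 81 = s.mem aRC (s.reg n) ∧
    ((pullHeight n).run s).reg 84 = (if s.mem aLV (s.reg n) = 0 then 0 else s.reg n) ∧
    ((pullHeight n).run s).reg 85 = s.mem aAG (s.mem aLC (s.reg n)) ∧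
    ∀ a j, ((pullHeight n).run s).mem a j = if a = aHT ∧ j = s.reg n then
      max (s.mem aHT (s.mem aLC (s.reg n))) (s.mem aHT (s.mem aRC (s.reg n))) + 1
      else s.mem a j := by
  have e : ∀ k, 80 ≤ k → n ≠ k := fun k hk => by omega
  have f : ∀ x < 80, ∀ k, 80 ≤ k → x ≠ k := fun x hx k hk => by omega
  refine ⟨?_, fun x hx => ?_, ?_, ?_, ?_, fun a j => ?_⟩ <;>
  simp only [pullHeight, Prog.run, Test.Holds, Instr.apply, Function.update_apply] <;>
  simp [e] <;> split_ifs <;> simp_all <;>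
  rcases eq_or_ne a aHT with rfl | ha <;> simp_all <;> omega

/-- Recompute height and best node of the node in register `n`. -/
def pull (n : ℕ) : Prog :=
  pullHeight n ;; combine ;; load 85 aAG 81 ;; combine ;; store aAG n 84

/-- The best node below is the best among the node itself, which counts only if its entry in `aLV`
is nonzero, and the stored best nodes of its two children. It is described by lists rather than
trees so that it applies to either orientation of the children. -/
theorem run_pull (n : ℕ) (hn : n < 80) (s : State) (h0 : s.reg 3 = 0) :
    ((pull n).run s).kmem = s.kmem ∧ (∀ x < 80, ((pull n).run s).reg x = s.reg x) ∧
      ∃ av, (∀ a j, ((pull n).run s).mem a j =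
        if a = aHT ∧ j = s.reg n then
          max (s.mem aHT (s.mem aLC (s.reg n))) (s.mem aHT (s.mem aRC (s.reg n))) + 1
        else if a = aAG ∧ j = s.reg n then av else s.mem a j) ∧
      (s.reg n ≠ 0 →
        ∀ ℓ₁ ℓ₂, IsBest s.mem (s.kmem kRK) ℓ₁ (s.mem aAG (s.mem aLC (s.reg n))) →
        IsBest s.mem (s.kmem kRK) ℓ₂ (s.mem aAG (s.mem aRC (s.reg n))) →
        IsBest s.mem (s.kmem kRK) (ℓ₁ ++ s.reg n :: ℓ₂) av) := by
  obtain ⟨k1, r1, r81, r84, r85, m1⟩ := run_pullHeight n hn s h0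
  simp only [pull, Prog.run]
  generalize (pullHeight n).run s = s1 at *
  obtain ⟨m2, k2, r84', r2⟩ := run_combine s1 (by rw [r1 3 (by norm_num), h0])
  generalize combine.run s1 = s2 at *
  generalize hs3 : Instr.apply (.load 85 aAG 81) s2 = s3
  have m3 : s3.mem = s2.mem := by subst hs3; rfl
  have k3 : s3.kmem = s2.kmem := by subst hs3; rfl
  have r85' : s3.reg 85 = s2.mem aAG (s2.reg 81) := by subst hs3; simp [Instr.apply]
  have r3 : ∀ x, x ≠ 85 → s3.reg x = s2.reg x := by
    intro x hx; subst hs3; simp [Instr.apply, hx]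
  obtain ⟨m4, k4, r84'', r4⟩ := run_combine s3
    (by rw [r3 3 (by norm_num), r2 3 (by norm_num), r1 3 (by norm_num), h0])
  generalize combine.run s3 = s4 at *
  have r4' : ∀ x < 80, s4.reg x = s.reg x := fun x hx => by
    rw [r4 x (by omega), r3 x (by omega), r2 x (by omega), r1 x hx]
  refine ⟨by simp [Instr.apply, k4, k3, k2, k1], fun x hx => by simp [Instr.apply, r4' x hx],
    s4.reg 84, fun a j => ?_, fun hn0 ℓ₁ ℓ₂ h₁ h₂ => ?_⟩
  · simp only [Instr.apply, Function.update_apply, r4' n hn, m4, m3, m2]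
    by_cases ha : a = 11 <;> by_cases hj : j = s.reg n <;> simp [ha, hj, m1]
  · rw [r84'', r3 84 (by norm_num), r84', r85', r84, r85, k3, k2, k1, m2, r2 81 (by norm_num),
      r81, m1, if_neg (c := 11 = 10 ∧ _) (by norm_num)]
    -- The candidates are combined in the order node, left, right, which is a permutation of the
    -- inorder list.
    have h : IsBest s.mem (s.kmem kRK) [s.reg n]
        (if s.mem aLV (s.reg n) = 0 then 0 else s.reg n) := by
      split_ifs with hl
      · exact .inl ⟨rfl, by simp [hl]⟩
      · exact .inr ⟨hn0, by simp, hl, by simp⟩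
    refine ((h.better h₁).better h₂).congr (fun _ _ => rfl) fun e => ?_
    simp; tauto

/-- The arrays of left and right children, in any order. -/
def ChildArrays (a b : ℕ) : Prop := (a = aLC ∧ b = aRC) ∨ (a = aRC ∧ b = aLC)

/-- Height and best node are symmetric in the children, so the program, which fixes left and right,
is also correct with the two arrays exchanged. The mirrored rotation relies on this. -/
theorem run_pull_rep {a b : ℕ} (hab : ChildArrays a b) (n : ℕ) (hn : n < 80) (s : State)
    (h0 : s.reg 3 = 0) (hm : LeafEntries s.mem) {l r : Tree} (hx0 : s.reg n ≠ 0)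
    (hla : s.mem a (s.reg n) = l.root) (hrb : s.mem b (s.reg n) = r.root)
    (hl : Rep a b s.mem (s.kmem kRK) l) (hr : Rep a b s.mem (s.kmem kRK) r)
    (hxl : s.reg n ∉ l.inorder) (hxr : s.reg n ∉ r.inorder) :
    ((pull n).run s).kmem = s.kmem ∧ (∀ x < 80, ((pull n).run s).reg x = s.reg x) ∧
    Agree [s.reg n] s.mem ((pull n).run s).mem ∧
    (∀ c, c ≠ aHT → c ≠ aAG → ((pull n).run s).mem c = s.mem c) ∧
    LeafEntries ((pull n).run s).mem ∧
    Rep a b ((pull n).run s).mem (s.kmem kRK) (.node l (s.reg n) r) := by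
  obtain ⟨hk, hr', av, hm', hav⟩ := run_pull n hn s h0
  have hc : ∀ c, c ≠ aHT → c ≠ aAG → ((pull n).run s).mem c = s.mem c := by
    intro c h1 h2
    funext j
    rw [hm' c j, if_neg (by tauto), if_neg (by tauto)]
  have hag : Agree [s.reg n] s.mem ((pull n).run s).mem := by
    refine ⟨fun c _ _ h1 h2 => hc c h1 h2, fun c j hj => ?_⟩
    simp only [List.mem_singleton] at hj
    rw [hm' c j, if_neg (by tauto), if_neg (by tauto)]
  refine ⟨hk, hr', hag, hc, hag.leafEntries (by simpa using hx0.symm) hm, hx0, ?_, ?_, ?_, ?_,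
    hl.agree hag (by rintro e he h; simp at h; exact hxl (h ▸ he)),
    hr.agree hag (by rintro e he h; simp at h; exact hxr (h ▸ he))⟩
  · rw [hc a (by rcases hab with h | h <;> omega) (by rcases hab with h | h <;> omega), hla]
  · rw [hc b (by rcases hab with h | h <;> omega) (by rcases hab with h | h <;> omega), hrb]
  · rw [hm', if_pos ⟨rfl, rfl⟩]
    rcases hab with ⟨rfl, rfl⟩ | ⟨rfl, rfl⟩
    · rw [hla, hrb, hl.ht_root hm, hr.ht_root hm]
    · rw [hla, hrb, hl.ht_root hm, hr.ht_root hm, max_comm]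
  · rw [hm', if_neg (by norm_num), if_pos ⟨rfl, rfl⟩]
    rcases hab with ⟨rfl, rfl⟩ | ⟨rfl, rfl⟩
    · refine (hav hx0 l.inorder r.inorder ?_ ?_).congr (fun e _ => ?_) fun _ => Iff.rfl
      · rw [hla]; exact hl.isBest_root hm
      · rw [hrb]; exact hr.isBest_root hm
      · rw [hc _ (by norm_num) (by norm_num)]
    · refine (hav hx0 r.inorder l.inorder ?_ ?_).congr (fun e _ => ?_) fun e => ?_
      · rw [hrb]; exact hr.isBest_root hm
      · rw [hla]; exact hl.isBest_root hm
      · rw [hc _ (by norm_num) (by norm_num)]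
      · simp; tauto

end DynInterval

end

/-! ### AVL rotations. -/

noncomputable section

namespace DynInterval

/-! ### Rebalancing -/

theorem agree_store {c : ℕ} (hc : c = aLC ∨ c = aRC) (n v : ℕ) (s : State) :
    Agree [s.reg n] s.mem ((Instr.store c n v).apply s).mem := by
  refine ⟨fun a h1 h2 _ _ => ?_, fun a j hj => ?_⟩
  · simp only [Instr.apply]
    rw [Function.update_of_ne (by rcases hc with rfl | rfl <;> assumption)]
  · simp only [List.mem_singleton] at hj
    rcases eq_or_ne a c with rfl | h
    · simp [Instr.apply, hj]
    · simp [Instr.apply, h]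

/-- Make the node in register `v` a child of the node in register `n`. -/
def link (c n v : ℕ) : Prog := store c n v ;; pull n

theorem run_link {a b : ℕ} (hab : ChildArrays a b) (c n v : ℕ) (hn : n < 80) (s : State)
    (h0 : s.reg 3 = 0) (hm : LeafEntries s.mem) {l r : Tree} {x : ℕ} (hx : s.reg n = x)
    (hx0 : x ≠ 0)
    (hc : (c = a ∧ s.reg v = l.root ∧ s.mem b x = r.root) ∨
      (c = b ∧ s.mem a x = l.root ∧ s.reg v = r.root))
    (hl : Rep a b s.mem (s.kmem kRK) l) (hr : Rep a b s.mem (s.kmem kRK) r)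
    (hxl : x ∉ l.inorder) (hxr : x ∉ r.inorder) :
    ((link c n v).run s).kmem = s.kmem ∧ (∀ x < 80, ((link c n v).run s).reg x = s.reg x) ∧
    Agree [x] s.mem ((link c n v).run s).mem ∧
    LeafEntries ((link c n v).run s).mem ∧
    Rep a b ((link c n v).run s).mem (s.kmem kRK) (.node l x r) := by
  subst hx
  have hc' : c = aLC ∨ c = aRC := by rcases hab with h | h <;> omega
  have hne : a ≠ b := by rcases hab with h | h <;> omega
  have hag := agree_store hc' n v s
  simp only [link, Prog.run]
  have e1 : ((Instr.store c n v).apply s).mem a (s.reg n) = l.root := by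
    rcases hc with ⟨rfl, h, h'⟩ | ⟨rfl, h, h'⟩
    · simp [Instr.apply, h]
    · simp [Instr.apply, h, hne]
  have e2 : ((Instr.store c n v).apply s).mem b (s.reg n) = r.root := by
    rcases hc with ⟨rfl, h, h'⟩ | ⟨rfl, h, h'⟩
    · simp [Instr.apply, h', hne.symm]
    · simp [Instr.apply, h']
  have hreg : ((Instr.store c n v).apply s).reg = s.reg := rfl
  have hkm : ((Instr.store c n v).apply s).kmem = s.kmem := rfl
  have hm1 := hag.leafEntries (by simpa using hx0.symm) hm
  have hl1 := hl.agree hag (by rintro e he h; simp at h; exact hxl (h ▸ he))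
  have hr1 := hr.agree hag (by rintro e he h; simp at h; exact hxr (h ▸ he))
  generalize (Instr.store c n v).apply s = s1 at *
  rw [← hreg] at h0 hx0 hxl hxr e1 e2 hag ⊢
  obtain ⟨k, r', ag, -, hm2, hrep⟩ := run_pull_rep hab n hn s1 h0 hm1 hx0 e1 e2
    (by rwa [hkm]) (by rwa [hkm]) hxl hxr
  exact ⟨k.trans hkm, r', hag.trans ag, hm2, by rwa [← hkm]⟩

/-- Rotate at the node in register `35`, whose `a`-child is too high. -/
def heavy (a b : ℕ) : Prog :=
  (load 65 a 35 ;; load 66 a 65 ;; load 67 b 65 ;; load 68 aHT 66 ;; load 69 aHT 67) ;;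
  .ite (.lt 68 69)
    ((load 70 a 67 ;; load 71 b 67) ;; link b 65 70 ;; link a 35 71 ;; store a 67 65 ;;
      link b 67 35 ;; copy 35 67)
    (link a 35 67 ;; link b 65 35 ;; copy 35 65)

/-- What rebalancing a subtree achieves: the node in register `35` is the root of a balanced tree
with nodes `ℓ`, and its height has the property `Q`. -/
def Balanced (a b : ℕ) (s s' : State) (ℓ : List ℕ) (Q : ℕ → Prop) : Prop :=
  s'.kmem = s.kmem ∧ (∀ x < 60, x ≠ 35 → s'.reg x = s.reg x) ∧ Agree ℓ s.mem s'.mem ∧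
    LeafEntries s'.mem ∧ ∃ t : Tree, Rep a b s'.mem (s'.kmem kRK) t ∧ t.root = s'.reg 35 ∧
      t.inorder = ℓ ∧ t.Avl ∧ Q t.ht

/-- If the inner grandchild is the higher one, a double rotation lifts it to the root and the height
becomes that of the old high child. Otherwise a single rotation lifts the child; the height is then
the same, or one more when the grandchildren are equally high. The parts of the tree have disjoint
nodes, so each relinking leaves the other parts intact. -/
theorem run_heavy {a b : ℕ} (hab : ChildArrays a b) (s : State) (h0 : s.reg 3 = 0)
    (hm : LeafEntries s.mem) {l r : Tree} (hx0 : s.reg 35 ≠ 0)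
    (hla : s.mem a (s.reg 35) = l.root) (hrb : s.mem b (s.reg 35) = r.root)
    (hl : Rep a b s.mem (s.kmem kRK) l) (hr : Rep a b s.mem (s.kmem kRK) r)
    (hnd : (l.inorder ++ s.reg 35 :: r.inorder).Nodup)
    (hlA : l.Avl) (hrA : r.Avl) (hht : l.ht = r.ht + 2) :
    Balanced a b s ((heavy a b).run s) (l.inorder ++ s.reg 35 :: r.inorder)
      (fun k => k = l.ht ∨ k = l.ht + 1) := by
  cases l with
  | leaf => simp [Tree.ht] at hht
  | node ll y lr =>
    obtain ⟨hy0, hya, hyb, hyh, -, hll, hlr⟩ := hl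
    have hne : a ≠ b := by rcases hab with h | h <;> omega
    simp only [Tree.root] at hla
    generalize hx : s.reg 35 = x at *
    rw [heavy, run_seq]
    generalize hs1 : Prog.run _ s = s1
    have m1 : s1.mem = s.mem := by subst hs1; rfl
    have k1 : s1.kmem = s.kmem := by subst hs1; rfl
    have r1 : ∀ i < 60, s1.reg i = s.reg i := by
      intro i hi; subst hs1
      simp only [Prog.run, Instr.apply, Function.update_apply]
      simp [show i ≠ 65 by omega, show i ≠ 66 by omega, show i ≠ 67 by omega,
        show i ≠ 68 by omega, show i ≠ 69 by omega]
    have q : s1.reg 65 = y ∧ s1.reg 67 = lr.root ∧ s1.reg 68 = ll.ht ∧ s1.reg 69 = lr.ht := by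
      subst hs1
      simp [Prog.run, Instr.apply, hx, hla, hya, hyb, hll.ht_root hm, hlr.ht_root hm]
    obtain ⟨q65, q67, q68, q69⟩ := q
    clear hs1
    have r3 : s1.reg 3 = 0 := by rw [r1 3 (by norm_num), h0]
    have r35 : s1.reg 35 = x := by rw [r1 35 (by norm_num), hx]
    rw [← m1] at hm hla hrb hr hya hyb hll hlr
    rw [← k1] at hr hll hlr
    simp only [Balanced]
    rw [← m1, ← k1]
    simp only [Tree.inorder, List.append_assoc, List.cons_append] at hnd ⊢
    simp only [Tree.ht] at hht
    have hnd' := hnd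
    simp only [List.nodup_append, List.nodup_cons, List.mem_append, List.mem_cons] at hnd'
    obtain ⟨hllA, hlrA, hA1, hA2⟩ := hlA
    by_cases hcase : ll.ht < lr.ht
    · rw [run_ite_pos (by simpa [Test.Holds, q68, q69] using hcase)]
      cases lr with
      | leaf => simp [Tree.ht] at hcase
      | node lrl w lrr =>
        simp only [Tree.inorder, List.append_assoc, List.cons_append] at hnd ⊢
        simp only [Tree.root] at q67
        obtain ⟨hw0, hwa, hwb, -, -, hlrl, hlrr⟩ := hlr
        simp only [Tree.inorder, List.mem_append, List.mem_cons, List.nodup_append,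
          List.nodup_cons] at hnd'
        have hyw : y ≠ w := by tauto
        have hyx : y ≠ x := by tauto
        have hwx : w ≠ x := by grind
        rw [run_seq]
        generalize hs2 : Prog.run _ s1 = s2
        have m2 : s2.mem = s1.mem := by subst hs2; rfl
        have k2 : s2.kmem = s1.kmem := by subst hs2; rfl
        have r2 : ∀ i < 70, s2.reg i = s1.reg i := by
          intro i hi; subst hs2
          simp only [Prog.run, Instr.apply, Function.update_apply]
          simp [show i ≠ 70 by omega, show i ≠ 71 by omega]
        have q : s2.reg 70 = lrl.root ∧ s2.reg 71 = lrr.root := by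
          subst hs2
          simp [Prog.run, Instr.apply, q67, hwa, hwb]
        obtain ⟨q70, q71⟩ := q
        clear hs2
        rw [← m2] at hm hla hrb hr hya hyb hll hwa hwb hlrl hlrr ⊢
        rw [← k2] at hr hll hlrl hlrr ⊢
        rw [run_seq]
        obtain ⟨k3, r3', ag3, hm3, rep3⟩ := run_link hab b 65 70 (by norm_num) s2
          (by rw [r2 3 (by norm_num), r3]) hm (l := ll) (r := lrl)
          (by rw [r2 65 (by norm_num), q65]) hy0 (.inr ⟨rfl, hya, q70⟩) hll hlrl
          (by grind) (by grind)
        generalize Prog.run _ s2 = s3 at *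
        have hr3 := hr.agree ag3 (by grind)
        have hlrr3 := hlrr.agree ag3 (by grind)
        rw [run_seq]
        obtain ⟨k4, r4', ag4, hm4, rep4⟩ := run_link hab a 35 71 (by norm_num) s3
          (by rw [r3' 3 (by norm_num), r2 3 (by norm_num), r3]) hm3 (l := lrr) (r := r)
          (by rw [r3' 35 (by norm_num), r2 35 (by norm_num), r35]) hx0
          (.inl ⟨rfl, by rw [r3' 71 (by norm_num), q71], by rw [ag3.2 _ _ (by grind), hrb]⟩)
          (by rwa [k3]) (by rwa [k3]) (by grind) (by grind)
        generalize Prog.run _ s3 = s4 at *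
        have rep3' := rep3.agree ag4 (by simp only [Tree.inorder]; grind)
        have q4 : ∀ i < 70, s4.reg i = s1.reg i := fun i hi => by
          rw [r4' i (by omega), r3' i (by omega), r2 i hi]
        rw [run_seq, run_instr, run_seq]
        have ag5 := agree_store (c := a) (by rcases hab with h | h <;> omega) 67 65 s4
        have e5 : ((Instr.store a 67 65).apply s4).mem a w = y := by
          simp [Instr.apply, q4, q65, q67]
        have k5 : ((Instr.store a 67 65).apply s4).kmem = s4.kmem := rfl
        have r5 : ((Instr.store a 67 65).apply s4).reg = s4.reg := rfl
        rw [q4 67 (by norm_num), q67] at ag5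
        generalize (Instr.store a 67 65).apply s4 = s5 at *
        have rep4' := rep4.agree ag5 (by simp only [Tree.inorder]; grind)
        have rep3'' := rep3'.agree ag5 (by simp only [Tree.inorder]; grind)
        obtain ⟨k6, r6', ag6, hm6, rep6⟩ := run_link hab b 67 35 (by norm_num) s5
          (by rw [r5, q4 3 (by norm_num), r3]) (ag5.leafEntries (by simpa using hw0.symm) hm4)
          (l := .node ll y lrl) (r := .node lrr x r)
          (by rw [r5, q4 67 (by norm_num), q67]) hw0
          (.inr ⟨rfl, e5, by rw [r5, q4 35 (by norm_num), r35]; rfl⟩)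
          (by rwa [k5, k4, k3]) (by rwa [k5, k4]) (by simp only [Tree.inorder]; grind)
          (by simp only [Tree.inorder]; grind)
        generalize Prog.run _ s5 = s6 at *
        refine ⟨by simp [Prog.run, Instr.apply, k6, k5, k4, k3], ?_, ?_, ?_,
          .node (.node ll y lrl) w (.node lrr x r), ?_, ?_, ?_, ?_, ?_⟩
        · intro i hi hi'
          simp only [Prog.run, Instr.apply, Function.update_apply, if_neg hi']
          rw [r6' i (by omega), r5, q4 i (by omega), r1 i hi]
        · simp only [Prog.run, Instr.apply]
          exact (((ag3.mono (by grind)).trans (ag4.mono (by grind))).trans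
            (ag5.mono (by grind))).trans (ag6.mono (by grind))
        · exact hm6
        · simp only [Prog.run, Instr.apply]
          rwa [k6]
        · simp [Prog.run, Instr.apply, Tree.root, r6', r5, q4, q67]
        · simp [Tree.inorder]
        · simp only [Tree.Avl, Tree.ht] at *
          refine ⟨⟨hllA, hlrA.1, ?_, ?_⟩, ⟨hlrA.2.1, hrA, ?_, ?_⟩, ?_, ?_⟩ <;> omega
        · simp only [Tree.Avl, Tree.ht] at *
          omega
    · rw [run_ite_neg (by simpa [Test.Holds, q68, q69] using hcase)]
      have hyx : y ≠ x := by grind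
      rw [run_seq]
      obtain ⟨k3, r3', ag3, hm3, rep3⟩ := run_link hab a 35 67 (by norm_num) s1 r3 hm (l := lr)
        (r := r) r35 hx0 (.inl ⟨rfl, q67, hrb⟩) hlr hr (by grind) (by grind)
      generalize Prog.run _ s1 = s3 at *
      rw [run_seq]
      obtain ⟨k4, r4', ag4, hm4, rep4⟩ := run_link hab b 65 35 (by norm_num) s3
        (by rw [r3' 3 (by norm_num), r3]) hm3 (l := ll) (r := .node lr x r)
        (by rw [r3' 65 (by norm_num), q65]) hy0
        (.inr ⟨rfl, by rw [ag3.2 _ _ (by grind), hya],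
          by rw [r3' 35 (by norm_num), r35]; rfl⟩)
        (by rw [k3]; exact hll.agree ag3 (by grind)) (by rwa [k3]) (by grind)
        (by simp only [Tree.inorder]; grind)
      generalize Prog.run _ s3 = s4 at *
      refine ⟨by simp [Prog.run, Instr.apply, k4, k3], ?_, ?_, ?_,
        .node ll y (.node lr x r), ?_, ?_, ?_, ?_, ?_⟩
      · intro i hi hi'
        simp only [Prog.run, Instr.apply, Function.update_apply, if_neg hi']
        rw [r4' i (by omega), r3' i (by omega), r1 i hi]
      · simp only [Prog.run, Instr.apply]
        exact (ag3.mono (by grind)).trans (ag4.mono (by grind))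
      · exact hm4
      · simp only [Prog.run, Instr.apply]
        rwa [k4]
      · simp [Prog.run, Instr.apply, Tree.root, r4', r3', q65]
      · simp [Tree.inorder]
      · simp only [Tree.Avl, Tree.ht] at *
        refine ⟨hllA, ⟨hlrA, hrA, ?_, ?_⟩, ?_, ?_⟩ <;> omega
      · simp only [Tree.ht] at *
        omega

theorem Balanced.mirror {a b : ℕ} {s s' : State} {ℓ : List ℕ} {Q : ℕ → Prop}
    (h : Balanced a b s s' ℓ Q) : Balanced b a s s' ℓ.reverse Q := by
  obtain ⟨hk, hr, hag, hm, t, h1, h2, h3, h4, h5⟩ := h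
  exact ⟨hk, hr, hag.mono (by simp), hm, t.mirror, h1.mirror, by simpa using h2, by simp [h3],
    by simpa using h4, by simpa using h5⟩

/-- Rebalance at the node in register `35`. -/
def rebalance : Prog :=
  (load 60 aLC 35 ;; load 61 aRC 35 ;; load 62 aHT 60 ;; load 63 aHT 61 ;; copy 64 63 ;;
    copy 72 62 ;; inc 64 ;; inc 72) ;;
  .ite (.lt 64 62) (heavy aLC aRC) (.ite (.lt 72 63) (heavy aRC aLC) (pull 35))

theorem run_rebalance (s : State) (h0 : s.reg 3 = 0)
    (hm : LeafEntries s.mem) {l r : Tree} (hx0 : s.reg 35 ≠ 0)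
    (hla : s.mem aLC (s.reg 35) = l.root) (hrb : s.mem aRC (s.reg 35) = r.root)
    (hl : Rep aLC aRC s.mem (s.kmem kRK) l) (hr : Rep aLC aRC s.mem (s.kmem kRK) r)
    (hnd : (l.inorder ++ s.reg 35 :: r.inorder).Nodup)
    (hlA : l.Avl) (hrA : r.Avl) (hlr : l.ht ≤ r.ht + 2) (hrl : r.ht ≤ l.ht + 2) :
    Balanced aLC aRC s (rebalance.run s) (l.inorder ++ s.reg 35 :: r.inorder) (fun k =>
      if l.ht = r.ht + 2 then k = l.ht ∨ k = l.ht + 1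
      else if r.ht = l.ht + 2 then k = r.ht ∨ k = r.ht + 1 else k = max l.ht r.ht + 1) := by
  rw [rebalance, run_seq]
  generalize hs1 : Prog.run _ s = s1
  have m1 : s1.mem = s.mem := by subst hs1; rfl
  have k1 : s1.kmem = s.kmem := by subst hs1; rfl
  have r1 : ∀ i < 60, s1.reg i = s.reg i := by
    intro i hi; subst hs1
    simp only [Prog.run, Instr.apply, Function.update_apply]
    simp [show i ≠ 60 by omega, show i ≠ 61 by omega, show i ≠ 62 by omega,
      show i ≠ 63 by omega, show i ≠ 64 by omega, show i ≠ 72 by omega]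
  have q : s1.reg 62 = l.ht ∧ s1.reg 63 = r.ht ∧ s1.reg 64 = r.ht + 1 ∧ s1.reg 72 = l.ht + 1 := by
    subst hs1
    simp [Prog.run, Instr.apply, hla, hrb, hl.ht_root hm, hr.ht_root hm]
  obtain ⟨q62, q63, q64, q72⟩ := q
  clear hs1
  rw [← m1] at hm hla hrb hl hr
  rw [← k1] at hl hr
  rw [← r1 35 (by norm_num)] at hx0 hla hrb hnd ⊢
  rw [← r1 3 (by norm_num)] at h0
  have tr : ∀ {s' ℓ Q}, Balanced aLC aRC s1 s' ℓ Q → Balanced aLC aRC s s' ℓ Q := by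
    rintro s' ℓ Q ⟨h1, h2, h3, h4⟩
    exact ⟨h1.trans k1, fun x hx hx' => (h2 x hx hx').trans (r1 x hx), m1 ▸ h3, h4⟩
  apply tr
  by_cases c1 : l.ht = r.ht + 2
  · rw [run_ite_pos (by simp only [Test.Holds]; omega)]
    simp only [c1, if_true]
    rw [← c1]
    exact run_heavy (.inl ⟨rfl, rfl⟩) s1 h0 hm hx0 hla hrb hl hr hnd hlA hrA c1
  · rw [run_ite_neg (by simp only [Test.Holds]; omega)]
    by_cases c2 : r.ht = l.ht + 2
    · rw [run_ite_pos (by simp only [Test.Holds]; omega)]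
      simp only [if_neg c1, if_pos c2]
      -- The right-heavy case is the left-heavy one for the mirrored tree with the child arrays
      -- exchanged.
      have := run_heavy (.inr ⟨rfl, rfl⟩) s1 h0 hm hx0 (l := r.mirror) (r := l.mirror)
        (by simpa using hrb) (by simpa using hla) hr.mirror hl.mirror
        (by rw [← List.nodup_reverse]; simpa using hnd) (by simpa using hrA) (by simpa using hlA)
        (by simpa using c2)
      simpa using this.mirror
    · rw [run_ite_neg (by simp only [Test.Holds]; omega)]
      simp only [c1, c2, if_false]
      have hxl : s1.reg 35 ∉ l.inorder := by
        intro h; simp only [List.nodup_append] at hnd; grind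
      have hxr : s1.reg 35 ∉ r.inorder := by
        intro h; simp only [List.nodup_append] at hnd; grind
      obtain ⟨k2, r2, ag2, -, hm2, rep2⟩ := run_pull_rep (.inl ⟨rfl, rfl⟩) 35 (by norm_num) s1 h0 hm
        hx0 hla hrb hl hr hxl hxr
      exact ⟨k2, fun x hx _ => r2 x (by omega), ag2.mono (by simp), hm2,
        .node l _ r, by rwa [k2],
        by rw [r2 35 (by norm_num)]; rfl, rfl, ⟨hlA, hrA, by omega, by omega⟩, rfl⟩

end DynInterval

end

/-! ### The linear order of endpoints and the descent from the root. -/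

noncomputable section

namespace DynInterval

/-! ### The order of the nodes -/

/-- The position of a node. Equal endpoints are ordered such that left endpoints come before right
endpoints; among left (right) endpoints, later nodes come earlier (later). -/
def pos (m : ℕ → ℕ → ℕ) (km : ℕ → ℕ → ℝ) (e : ℕ) : ℝ ×ₗ ℤ :=
  toLex (km kKEY e, if m aTY e = 0 then -(e : ℤ) else e)

theorem pos_lt {m : ℕ → ℕ → ℕ} {km : ℕ → ℕ → ℝ} {e f : ℕ} :
    pos m km e < pos m km f ↔ km kKEY e < km kKEY f ∨ km kKEY e = km kKEY f ∧
      (if m aTY e = 0 then -(e : ℤ) else e) < (if m aTY f = 0 then -(f : ℤ) else f) :=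
  Prod.Lex.toLex_lt_toLex

theorem pos_injective {m : ℕ → ℕ → ℕ} {km : ℕ → ℕ → ℝ} {e f : ℕ}
    (h : pos m km e = pos m km f) : e = f := by
  have h2 := congrArg (fun p => (ofLex p).2) h
  simp only [pos, ofLex_toLex] at h2
  split_ifs at h2 <;> omega

theorem pos_congr {m m' : ℕ → ℕ → ℕ} {km km' : ℕ → ℕ → ℝ} (hm : m' aTY = m aTY) (hk : km' = km) :
    pos m' km' = pos m km := by
  funext e; simp only [pos, hm, hk]

/-- Put `1` into register `60` if the node in register `30` comes before that in register `32`. -/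
def compareNodes : Prog :=
  kload 20 kKEY 30 ;; kload 21 kKEY 32 ;; load 61 aTY 30 ;; load 62 aTY 32 ;; const 60 0 ;;
    .ite (.kle 20 21)
      (.ite (.kle 21 20)
        (.ite (.eq 61 3) (.ite (.eq 62 3) (.ite (.lt 32 30) (const 60 1) nop) (const 60 1))
          (.ite (.eq 62 3) nop (.ite (.lt 30 32) (const 60 1) nop)))
        (const 60 1))
      nop

/-- A left and a right endpoint with equal keys carry integers of opposite signs, and these differ
as long as the node numbers are not both zero; this is the role of `h2`. -/
theorem run_compareNodes (s : State) (h0 : s.reg 3 = 0) (h2 : s.reg 32 ≠ 0) :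
    (pos s.mem s.kmem (s.reg 30) < pos s.mem s.kmem (s.reg 32) →
      (compareNodes.run s).reg 60 = 1) ∧
    (¬ pos s.mem s.kmem (s.reg 30) < pos s.mem s.kmem (s.reg 32) →
      (compareNodes.run s).reg 60 = 0) := by
  rw [pos_lt]
  have tri : s.kmem 0 (s.reg 30) < s.kmem 0 (s.reg 32) ↔
    s.kmem 0 (s.reg 30) ≤ s.kmem 0 (s.reg 32) ∧
    ¬ s.kmem 0 (s.reg 32) ≤ s.kmem 0 (s.reg 30) := lt_iff_le_not_ge
  have tri' : s.kmem 0 (s.reg 30) = s.kmem 0 (s.reg 32) ↔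
    s.kmem 0 (s.reg 30) ≤ s.kmem 0 (s.reg 32) ∧
    s.kmem 0 (s.reg 32) ≤ s.kmem 0 (s.reg 30) := le_antisymm_iff
  rw [tri, tri']
  by_cases c1 : s.kmem 0 (s.reg 30) ≤ s.kmem 0 (s.reg 32) <;>
  by_cases c2 : s.kmem 0 (s.reg 32) ≤ s.kmem 0 (s.reg 30) <;>
  by_cases c3 : s.mem aTY (s.reg 30) = 0 <;>
  by_cases c4 : s.mem aTY (s.reg 32) = 0 <;>
  by_cases c5 : s.reg 30 < s.reg 32 <;>
  by_cases c6 : s.reg 32 < s.reg 30 <;>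
  refine ⟨?_, ?_⟩ <;>
  simp [compareNodes, Prog.run, Test.Holds, Instr.apply, c1, c2, c3, c4, c5, c6, h0] <;> omega

/-! ### Descending to a node -/

/-- A step of a path from the root: whether it leads to the left, the node where it starts, and
the other subtree. -/
abbrev Frame := Bool × ℕ × Tree

/-- The nodes to the left of a path. -/
def pathPre : List Frame → List ℕ
  | [] => []
  | (true, _, _) :: c => pathPre c
  | (false, x, t) :: c => pathPre c ++ (t.inorder ++ [x])

/-- The nodes to the right of a path. -/
def pathPost : List Frame → List ℕ
  | [] => []
  | (true, x, t) :: c => x :: (t.inorder ++ pathPost c)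
  | (false, _, _) :: c => pathPost c

/-- The path (last step first) is on the stack, its subtrees are stored in the arrays, and the
whole tree is balanced if the path leads to a subtree of height `h`. -/
def PathRep (m : ℕ → ℕ → ℕ) (rk : ℕ → ℝ) : List Frame → ℕ → Prop
  | [], _ => True
  | (d, x, t) :: c, h => x ≠ 0 ∧ m aSTK c.length = x ∧ m aDIR c.length = (if d then 0 else 1) ∧
      m (if d then aRC else aLC) x = t.root ∧ Rep aLC aRC m rk t ∧ t.Avl ∧ h ≤ t.ht + 1 ∧
      t.ht ≤ h + 1 ∧ PathRep m rk c (max h t.ht + 1)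

theorem PathRep.congr {m m' : ℕ → ℕ → ℕ} {rk : ℕ → ℝ} : ∀ {c : List Frame} {h : ℕ},
    PathRep m rk c h →
    (∀ i < c.length, m' aSTK i = m aSTK i ∧ m' aDIR i = m aDIR i) →
    (∀ e, e ∈ pathPre c ∨ e ∈ pathPost c → ∀ a, a = aLC ∨ a = aRC ∨ a = aHT ∨ a = aAG ∨ a = aLV →
      m' a e = m a e) → PathRep m' rk c h
  | [], _, _, _, _ => trivial
  | (d, x, t) :: c, h, hp, hs, hm => by
    obtain ⟨h1, h2, h3, h4, h5, h6, h7, h8, h9⟩ := hp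
    have hx : x ∈ pathPre ((d, x, t) :: c) ∨ x ∈ pathPost ((d, x, t) :: c) := by
      cases d <;> simp [pathPre, pathPost]
    have ht : ∀ e ∈ t.inorder, e ∈ pathPre ((d, x, t) :: c) ∨ e ∈ pathPost ((d, x, t) :: c) := by
      intro e he; cases d <;> simp [pathPre, pathPost, he]
    have hc : ∀ e, e ∈ pathPre c ∨ e ∈ pathPost c →
        e ∈ pathPre ((d, x, t) :: c) ∨ e ∈ pathPost ((d, x, t) :: c) := by
      intro e he; cases d <;> simp [pathPre, pathPost] <;> tauto
    refine ⟨h1, (hs _ (by simp)).1.trans h2, (hs _ (by simp)).2.trans h3, ?_, ?_, h6, h7, h8, ?_⟩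
    · rw [hm x hx _ (by cases d <;> simp), h4]
    · exact h5.congr fun e he => ⟨hm e (ht e he) _ (by simp), hm e (ht e he) _ (by simp),
        hm e (ht e he) _ (by simp), hm e (ht e he) _ (by simp), hm e (ht e he) _ (by simp)⟩
    · exact h9.congr (fun i hi => hs i (by simp; omega)) fun e he => hm e (hc e he)

/-- If register `32` holds no node, note this in register `36` and put the node of register `30`
there. -/
def atLeaf : Prog := .ite (.eq 32 3) (const 36 1 ;; copy 32 30) nop

def descendStep : Prog :=
  store aSTK 33 32 ;;
  .ite (.eq 60 4) (store aDIR 33 3 ;; load 32 aLC 32)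
    (store aDIR 33 4 ;; copy 34 32 ;; load 32 aRC 32) ;;
  inc 33 ;; atLeaf

/-- Descend from the root to the node in register `30`, or to the place where it is missing. -/
def descend : Prog :=
  (copy 32 1 ;; const 33 0 ;; const 34 0 ;; const 36 0 ;; atLeaf) ;;
  whileNe 37 32 30 (compareNodes ;; descendStep)

theorem run_descendStep (s : State) (h0 : s.reg 3 = 0) (h1 : s.reg 4 = 1) {d : Bool}
    (hd : s.reg 60 = if d then 1 else 0) {y : ℕ}
    (hy : s.mem (if d then aLC else aRC) (s.reg 32) = y) :
    (descendStep.run s).reg 33 = s.reg 33 + 1 ∧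
    (descendStep.run s).reg 34 = (if d then s.reg 34 else s.reg 32) ∧
    (descendStep.run s).reg 32 = (if y = 0 then s.reg 30 else y) ∧
    (descendStep.run s).reg 36 = (if y = 0 then 1 else s.reg 36) ∧
    (∀ i, (descendStep.run s).mem aSTK i = if i = s.reg 33 then s.reg 32 else s.mem aSTK i) ∧
    (∀ i, (descendStep.run s).mem aDIR i =
      if i = s.reg 33 then (if d then 0 else 1) else s.mem aDIR i) := by
  subst hy
  cases d <;> simp only [Bool.false_eq_true, if_true, if_false] at hd ⊢
  · by_cases hy : s.mem aRC (s.reg 32) = 0 <;>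
    simp [descendStep, atLeaf, Prog.run, Test.Holds, Instr.apply, h0, h1, hd, hy,
      Function.update_apply]
  · by_cases hy : s.mem aLC (s.reg 32) = 0 <;>
    simp [descendStep, atLeaf, Prog.run, Test.Holds, Instr.apply, h0, h1, hd, hy,
      Function.update_apply]

/-- The state while descending to the node `q`. -/
structure Descent (m : ℕ → ℕ → ℕ) (km : ℕ → ℕ → ℝ) (q H : ℕ) (ℓ : List ℕ) (c : List Frame)
    (t : Tree) (s : State) : Prop where
  zero : s.reg 3 = 0
  one : s.reg 4 = 1
  query : s.reg 30 = q
  depth : s.reg 33 = c.length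
  pred : s.reg 34 = (pathPre c).getLastD 0
  cur : (t = .leaf ∧ s.reg 32 = q ∧ s.reg 36 = 1) ∨ (t ≠ .leaf ∧ s.reg 32 = t.root ∧ s.reg 36 = 0)
  path : PathRep s.mem (km kRK) c t.ht
  rep : Rep aLC aRC s.mem (km kRK) t
  avl : t.Avl
  list : pathPre c ++ t.inorder ++ pathPost c = ℓ
  pre : ∀ e ∈ pathPre c, pos m km e < pos m km q
  post : ∀ e ∈ pathPost c, pos m km q < pos m km e
  height : c.length + t.ht ≤ H
  mem : ∀ a, a ≠ aSTK → a ≠ aDIR → s.mem a = m a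
  kmem : s.kmem = km

/-- Each comparison moves one node and one subtree from the current tree to the path, on the side
that keeps `q` between `pathPre` and `pathPost`. At an empty subtree register `32` receives the
query itself, so the one exit condition covers a node that is found as well as one that is missing.
-/
theorem Descent.step {m : ℕ → ℕ → ℕ} {km : ℕ → ℕ → ℝ} {q H : ℕ} {ℓ : List ℕ} {c : List Frame}
    {t : Tree} {s : State} (h : Descent m km q H ℓ c t s)
    (hℓ : ℓ.Pairwise fun e f => pos m km e < pos m km f) (hne : s.reg 32 ≠ s.reg 30) :
    ∃ c' t', Descent m km q H ℓ c' t' ((compareNodes ;; descendStep).run s) ∧ t'.ht + 1 ≤ t.ht := by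
  obtain ⟨zero, one, query, depth, pred, cur, path, rep, avl, list, pre, post, height, mem,
    kmem⟩ := h
  cases t with
  | leaf => simp [query] at cur hne; exact absurd cur.1 hne
  | node l x r =>
    obtain ⟨hx0, hxl, hxr, hh, hb, repl, repr⟩ := rep
    obtain ⟨avll, avlr, a1, a2⟩ := avl
    simp only [Tree.root, reduceCtorEq, false_and, ne_eq, not_false_eq_true, true_and,
      false_or] at cur
    obtain ⟨c32, c36⟩ := cur
    rw [c32, query] at hne
    have hp : pos s.mem s.kmem = pos m km := pos_congr (mem _ (by norm_num) (by norm_num)) kmem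
    obtain ⟨e1, e0⟩ := run_compareNodes s zero (by rwa [c32])
    have fr1 := Prog.framed_run (c := compareNodes) rfl s
    rw [c32, query, hp] at e1 e0
    rw [run_seq]
    have m1 := fr1.mem_eq rfl
    have k1 := fr1.kmem_eq rfl
    have r1 := fr1.reg_lt (k := 60) rfl
    clear fr1
    generalize compareNodes.run s = s1 at *
    simp only [Tree.inorder, List.append_assoc, List.cons_append] at list
    have hsort := hℓ
    rw [← list] at hsort
    simp only [List.pairwise_append, List.pairwise_cons, List.mem_append, List.mem_cons] at hsort
    have fr2 := Prog.framed_run (c := descendStep) rfl s1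
    have rr : ∀ i < 30, (descendStep.run s1).reg i = s.reg i := fun i hi => by
      rw [fr2.reg_lt (k := 32) rfl i (by omega), r1 i (by omega)]
    have memr : ∀ a, a ≠ aSTK → a ≠ aDIR → (descendStep.run s1).mem a = s.mem a := by
      intro a h1 h2
      rw [fr2.mem a (by simp [descendStep, atLeaf, Prog.arrs, h1, h2]), m1]
    -- Both directions at once: `d = true` means going left.
    have finish : ∀ d : Bool, s1.reg 60 = (if d then 1 else 0) →
        (if d then pos m km q < pos m km x else pos m km x < pos m km q) →
        Descent m km q H ℓ ((d, x, if d then r else l) :: c) (if d then l else r)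
          (descendStep.run s1) := by
      intro d hd hlt
      obtain ⟨f33, f34, f32, f36, fS, fD⟩ := run_descendStep s1 (by rw [r1 3 (by norm_num), zero])
        (by rw [r1 4 (by norm_num), one]) hd rfl
      have hroot : s1.mem (if d then aLC else aRC) (s1.reg 32) = (if d then l else r).root := by
        rw [m1, r1 32 (by norm_num), c32]
        cases d <;> simp [hxl, hxr]
      rw [hroot] at f32 f36
      have reps : Rep aLC aRC s.mem (km kRK) (if d then l else r) := by cases d <;> simp [repl,
        repr]
      have reps' : Rep aLC aRC s.mem (km kRK) (if d then r else l) := by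
        cases d <;> simp [repl, repr]
      have hz := Tree.root_eq_zero reps
      rw [r1 33 (by norm_num), depth] at f33 fS fD
      rw [r1 34 (by norm_num), r1 32 (by norm_num), c32] at f34
      rw [r1 32 (by norm_num), c32] at fS
      refine ⟨by rw [rr 3 (by norm_num), zero], by rw [rr 4 (by norm_num), one], ?_,
        by simp [f33], ?_, ?_, ?_, ?_, ?_, ?_, ?_, ?_, ?_, ?_, ?_⟩
      · rw [fr2.reg_lt (k := 32) rfl 30 (by norm_num), r1 30 (by norm_num), query]
      · rw [f34, pred]
        cases d <;> simp [pathPre]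
      · rw [f32, f36, r1 30 (by norm_num), query, r1 36 (by norm_num), c36]
        by_cases hleaf : (if d then l else r).root = 0
        · left; simp [hz.1 hleaf, Tree.root]
        · right; simp only [hleaf, if_false, and_true, ne_eq]; exact fun h => hleaf (hz.2 h)
      · refine ⟨hx0, by simp [fS], by simp [fD], ?_, ?_, ?_, ?_, ?_, ?_⟩
        · rw [memr _ (by cases d <;> simp) (by cases d <;> simp)]
          cases d <;> simp [hxl, hxr]
        · exact reps'.congr fun e _ => by
            simp [memr]
        · cases d <;> simp [avll, avlr]
        · cases d <;> simp <;> omega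
        · cases d <;> simp <;> omega
        · have : max (if d then l else r).ht (if d then r else l).ht + 1 = (Tree.node l x r).ht :=
            by
            cases d <;> simp [Tree.ht, max_comm]
          rw [this]
          refine path.congr (fun i hi => ?_) (fun e _ a ha => ?_)
          · rw [fS, fD, if_neg (by omega), if_neg (by omega), m1]; simp
          · rw [memr a (by omega) (by omega)]
      · exact reps.congr fun e _ => by simp [memr]
      · cases d <;> simp [avll, avlr]
      · rw [← list]
        cases d <;> simp [pathPre, pathPost]
      · cases d
        · simp only [pathPre, List.mem_append, List.mem_singleton, Bool.false_eq_true,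
            if_false] at hlt ⊢
          rintro e (he | he | rfl)
          · exact pre e he
          · exact (hsort.2.1.2.2 e he x (by simp)).trans hlt
          · exact hlt
        · exact pre
      · cases d
        · exact post
        · simp only [pathPost, List.mem_append, List.mem_cons, if_true] at hlt ⊢
          rintro e (rfl | he | he)
          · exact hlt
          · exact hlt.trans (hsort.2.1.2.1.1 e (.inl he))
          · exact post e he
      · have : (if d then l else r).ht + 1 ≤ (Tree.node l x r).ht := by
          cases d <;> simp [Tree.ht]
        simp only [List.length_cons]
        omega
      · intro a h1 h2
        rw [memr a h1 h2, mem a h1 h2]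
      · rw [fr2.kmem_eq rfl, k1, kmem]
    rcases lt_trichotomy (pos m km q) (pos m km x) with hlt | heq | hlt
    · exact ⟨_, _, finish true (by simpa using e1 hlt) (by simpa using hlt), by simp [Tree.ht]⟩
    · exact absurd (pos_injective heq).symm hne
    · exact ⟨_, _, finish false (by simpa using e0 hlt.asymm) (by simpa using hlt),
        by simp [Tree.ht]⟩

theorem runs_descend {s : State} {q : ℕ} {t : Tree} (h0 : s.reg 3 = 0) (h1 : s.reg 4 = 1)
    (hq : s.reg 30 = q) (hroot : s.reg 1 = t.root)
    (hrep : Rep aLC aRC s.mem (s.kmem kRK) t) (havl : t.Avl)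
    (hsort : t.inorder.Pairwise fun e f => pos s.mem s.kmem e < pos s.mem s.kmem f) :
    Runs descend s fun s' n => n ≤ 50 * (t.ht + 1) ∧
      ∃ c t', Descent s.mem s.kmem q t.ht t.inorder c t' s' ∧ s'.reg 32 = q := by
  rw [descend]
  refine Runs.seq (Runs.block rfl fun n hn => ?_)
  simp only [atLeaf, Prog.cost] at hn
  have start : Descent s.mem s.kmem q t.ht t.inorder [] t (Prog.run
      (copy 32 1 ;; const 33 0 ;; const 34 0 ;; const 36 0 ;; atLeaf) s) := by
    have hz := Tree.root_eq_zero hrep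
    by_cases hleaf : t.root = 0
    · have hl := hz.1 hleaf
      constructor <;> simp [atLeaf, Prog.run, Test.Holds, Instr.apply, h0, h1, hq, hroot,
        pathPre, pathPost, PathRep, hl, Tree.root, Rep, Tree.Avl]
    · have hl : t ≠ .leaf := fun h => hleaf (hz.2 h)
      constructor <;> simp [atLeaf, Prog.run, Test.Holds, Instr.apply, h0, h1, hq, hroot, hleaf,
        pathPre, pathPost, PathRep, hl, hrep, havl]
  refine Runs.mono (runs_whileNe (by norm_num) (by norm_num)
    (fun v s' => ∃ c t', Descent s.mem s.kmem q t.ht t.inorder c t' s' ∧ 40 * t'.ht ≤ v)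
    ?_ ?_ ?_ ⟨[], t, start, le_rfl⟩) ?_
  · rintro v s' ⟨c, t', h, -⟩; exact h.one
  · rintro v s' k ⟨c, t', h, hv⟩
    obtain ⟨zero, one, query, depth, pred, cur, path, rep, avl, list, pre, post, height, mem,
      kmem⟩ := h
    refine ⟨c, t', ⟨?_, ?_, ?_, ?_, ?_, by simpa [State.set_reg] using cur, path, rep, avl, list,
      pre, post, height, mem,
      kmem⟩, hv⟩ <;> rw [State.set_reg, if_neg (by norm_num)] <;> assumption
  · rintro v s' ⟨c, t', h, hv⟩ hne
    refine Runs.block rfl fun n hn => ?_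
    obtain ⟨c'', t'', h', hlt⟩ := h.step hsort hne
    simp only [compareNodes, descendStep, atLeaf, Prog.cost] at hn
    norm_num at hn
    exact ⟨40 * t''.ht, ⟨c'', t'', h', le_rfl⟩, by omega⟩
  · rintro s' n' ⟨hn', ⟨v, c, t', h, -⟩, he⟩
    norm_num at hn
    exact ⟨by omega, c, t', h, by rw [he, h.query]⟩

end DynInterval

end

/-! ### Updating a node and returning to the root. -/

noncomputable section

namespace DynInterval

/-! ### Inserting and updating a node -/

def climbStart : Prog :=
  .ite (.eq 36 4) (store aLC 30 3 ;; store aRC 30 3) nop ;; store aLV 30 31 ;; copy 35 30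

def climbStep : Prog :=
  dec 33 ;; load 32 aSTK 33 ;; load 38 aDIR 33 ;;
    .ite (.eq 38 3) (store aLC 32 35) (store aRC 32 35) ;; copy 35 32

/-- Insert the node in register `30` into the tree, or update it if it is in the tree, such that
its entry in `aLV` becomes that in register `31`. Then register `34` holds the predecessor. -/
def touch : Prog :=
  descend ;; (climbStart ;; rebalance) ;; .loop (.lt 3 33) (climbStep ;; rebalance) ;; copy 1 35

/-- The state while returning to the root. -/
structure Ascent (m : ℕ → ℕ → ℕ) (km : ℕ → ℕ → ℝ) (ℓ : List ℕ) (c : List Frame)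
    (t : Tree) (s : State) : Prop where
  zero : s.reg 3 = 0
  depth : s.reg 33 = c.length
  cur : s.reg 35 = t.root
  path : ∃ h, PathRep s.mem (km kRK) c h ∧ (t.ht = h ∨ t.ht = h + 1)
  rep : Rep aLC aRC s.mem (km kRK) t
  avl : t.Avl
  leaf : LeafEntries s.mem
  list : pathPre c ++ t.inorder ++ pathPost c = ℓ
  mem : ∀ a, a ≠ aLC → a ≠ aRC → a ≠ aHT → a ≠ aAG → s.mem a = m a
  kmem : s.kmem = km

/-- The frames still describe the heights before the update, and the current subtree has the old
height or one more. Hence the two subtrees of the parent differ by at most 2, which is what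
rebalancing can repair. -/
theorem Ascent.step {m : ℕ → ℕ → ℕ} {km : ℕ → ℕ → ℝ} {ℓ : List ℕ} {c : List Frame}
    {t : Tree} {s : State} (h : Ascent m km ℓ c t s) (hnd : ℓ.Nodup) (hc : 0 < s.reg 33) :
    ∃ f c' t', c = f :: c' ∧ Ascent m km ℓ c' t' ((climbStep ;; rebalance).run s) := by
  obtain ⟨zero, depth, cur, ⟨h, path, hth⟩, rep, avl, leaf, list, mem, kmem⟩ := h
  subst kmem
  rcases c with _ | ⟨⟨d, x, sib⟩, c⟩
  · simp at depth; omega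
  obtain ⟨p1, p2, p3, p4, p5, p6, p7, p8, p9⟩ := path
  refine ⟨(d, x, sib), c, ?_⟩
  -- the nodes are distinct
  have hdisj : x ∉ t.inorder ∧ x ∉ sib.inorder ∧ (∀ e ∈ t.inorder, e ∉ sib.inorder) ∧
      ((if d then t else sib).inorder ++ x :: (if d then sib else t).inorder).Nodup ∧
      ∀ e, e ∈ pathPre c ∨ e ∈ pathPost c →
        e ∉ (if d then t else sib).inorder ++ x :: (if d then sib else t).inorder := by
    rw [← list] at hnd
    cases d <;> simp only [pathPre, pathPost, List.nodup_append, List.nodup_cons, List.mem_append,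
      List.mem_cons, if_true, if_false, Bool.false_eq_true] at hnd ⊢ <;> grind
  obtain ⟨d1, d2, d3, d4, d5⟩ := hdisj
  rw [run_seq]
  simp only [List.length_cons] at depth
  have hfr := Prog.framed_run (c := climbStep) rfl s
  obtain ⟨s1, hs1⟩ : ∃ s1, climbStep.run s = s1 := ⟨_, rfl⟩
  have q : s1.reg 3 = 0 ∧ s1.reg 33 = c.length ∧ s1.reg 35 = x ∧
      s1.mem (if d then aLC else aRC) x = t.root ∧ Agree [x] s.mem s1.mem ∧
      s1.mem (if d then aRC else aLC) = s.mem (if d then aRC else aLC) := by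
    subst hs1
    cases d <;> simp only [if_true, if_false, Bool.false_eq_true] at p3 p4 ⊢
    · refine ⟨?_, ?_, ?_, ?_, ?_, ?_⟩
      rotate_left 4
      · have := agree_store (c := aRC) (.inr rfl) 32 35
          ({ s with reg := Function.update s.reg 32 x } : State)
        simp only [Function.update_self] at this
        convert this using 1
        simp [climbStep, Prog.run, Test.Holds, Instr.apply, zero, depth, p2, p3, cur]
      all_goals simp [climbStep, Prog.run, Test.Holds, Instr.apply, zero, depth, p2, p3, cur]
    · refine ⟨?_, ?_, ?_, ?_, ?_, ?_⟩
      rotate_left 4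
      · have := agree_store (c := aLC) (.inl rfl) 32 35
          ({ s with reg := Function.update s.reg 32 x } : State)
        simp only [Function.update_self] at this
        convert this using 1
        simp [climbStep, Prog.run, Test.Holds, Instr.apply, zero, depth, p2, p3, cur]
      all_goals simp [climbStep, Prog.run, Test.Holds, Instr.apply, zero, depth, p2, p3, cur]
  rw [hs1] at hfr ⊢
  obtain ⟨q3, q33, q35, qx, qag, qo⟩ := q
  have k1 : s1.kmem = s.kmem := hfr.kmem_eq rfl
  have leaf1 := qag.leafEntries (by simpa using p1.symm) leaf
  have rept := rep.agree qag (by rintro e he hx; simp at hx; exact d1 (hx ▸ he))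
  have reps := p5.agree qag (by rintro e he hx; simp at hx; exact d2 (hx ▸ he))
  have bal := run_rebalance s1 q3 leaf1 (l := if d then t else sib) (r := if d then sib else t)
    (by rwa [q35]) (by rw [q35]; cases d <;> simp_all) (by rw [q35]; cases d <;> simp_all)
    (by rw [k1]; cases d <;> simp [rept, reps]) (by rw [k1]; cases d <;> simp [rept, reps])
    (by rwa [q35]) (by cases d <;> simp [avl, p6]) (by cases d <;> simp [avl, p6])
    (by cases d <;> simp <;> omega) (by cases d <;> simp <;> omega)
  rw [q35] at bal
  obtain ⟨b1, b2, b3, b4, t', b5, b6, b7, b8, b9⟩ := bal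
  have hpath : PathRep (rebalance.run s1).mem (s.kmem kRK) c (max h sib.ht + 1) := by
    refine p9.congr (fun i hi => ?_) (fun e he a ha => ?_)
    · rw [b3.1 _ (by norm_num) (by norm_num) (by norm_num) (by norm_num),
        b3.1 _ (by norm_num) (by norm_num) (by norm_num) (by norm_num),
        qag.1 _ (by norm_num) (by norm_num) (by norm_num) (by norm_num),
        qag.1 _ (by norm_num) (by norm_num) (by norm_num) (by norm_num)]
      simp
    · have hn := d5 e he
      rw [b3.2 _ _ hn, qag.2 _ _ (fun hx => hn (by simp at hx; simp [hx]))]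
  refine ⟨t', rfl, ?_, ?_, b6.symm, ⟨_, hpath, ?_⟩, by rwa [b1, k1] at b5, b8, b4, ?_, ?_, ?_⟩
  · rw [b2 3 (by norm_num) (by norm_num), q3]
  · rw [b2 33 (by norm_num) (by norm_num), q33]
  -- The parent's subtree used to have height `max h sib.ht + 1`. A rotation occurs only if the
  -- higher subtree is the current one and has just grown, and then its result has this height or
  -- one more.
  · cases d <;> simp only [if_true, if_false, Bool.false_eq_true] at b9 <;> split_ifs at b9 <;>
      omega
  · rw [b7, ← list]
    cases d <;> simp [pathPre, pathPost]
  · intro a h1 h2 h3 h4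
    rw [b3.1 a h1 h2 h3 h4, qag.1 a h1 h2 h3 h4, mem a h1 h2 h3 h4]
  · rw [b1, k1]

theorem runs_ascent {m : ℕ → ℕ → ℕ} {km : ℕ → ℕ → ℝ} {ℓ : List ℕ} {c : List Frame}
    {t : Tree} {s : State} (h : Ascent m km ℓ c t s) (hnd : ℓ.Nodup) :
    Runs (.loop (.lt 3 33) (climbStep ;; rebalance)) s fun s' n => n ≤ 200 * c.length + 1 ∧
      ∃ t', Ascent m km ℓ [] t' s' := by
  refine (Runs.loop (fun v s => ∃ c t, Ascent m km ℓ c t s ∧ 200 * c.length ≤ v) ?_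
    ⟨c, t, h, le_rfl⟩).mono ?_
  · rintro v s ⟨c, t, h, hv⟩ hb
    simp only [Test.Holds, h.zero] at hb
    obtain ⟨f, c', t', rfl, h'⟩ := h.step hnd hb
    refine Runs.block rfl fun n hn => ⟨200 * c'.length, ⟨c', t', h', le_rfl⟩, ?_⟩
    have : (climbStep ;; rebalance).cost ≤ 190 := by decide
    simp only [List.length_cons] at hv
    omega
  · rintro s' n ⟨hn, ⟨v, path, tree, hA, -⟩, hb⟩
    simp only [Test.Holds, hA.zero, hA.depth] at hb
    obtain rfl : path = [] := List.length_eq_zero_iff.1 (by omega)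
    exact ⟨hn, tree, hA⟩

/-- The tree of the nodes in the list `ℓ`, in this order. -/
structure Indexed (ℓ : List ℕ) (s : State) : Prop where
  leaf : LeafEntries s.mem
  tree : ∃ t : Tree, Rep aLC aRC s.mem (s.kmem kRK) t ∧ t.root = s.reg 1 ∧ t.Avl ∧ t.inorder = ℓ
  sorted : ℓ.Pairwise fun e f => pos s.mem s.kmem e < pos s.mem s.kmem f

theorem Rep.update_live {cl cr : ℕ} {m m' : ℕ → ℕ → ℕ} {rk : ℕ → ℝ} {t : Tree} {q : ℕ}
    (h : Rep cl cr m rk t) (hq : q ∉ t.inorder) (hm : ∀ a j, j ≠ q → m' a j = m a j) :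
    Rep cl cr m' rk t :=
  h.congr fun e he => by
    have : e ≠ q := by rintro rfl; exact hq he
    simp [hm, this]

/-- One program inserts a missing node and changes the entry of an existing one: the ascent
recomputes heights and best nodes along the whole path in either case. Register `34` is specified
only for a missing node, since the predecessor of an existing node may lie in its left subtree. -/
theorem runs_touch {s : State} {q : ℕ} {ℓ : List ℕ} (h0 : s.reg 3 = 0) (h1 : s.reg 4 = 1)
    (hq : s.reg 30 = q) (hq0 : q ≠ 0) (hI : Indexed ℓ s) :
    Runs touch s fun s' n => (∃ k, 2 ^ k ≤ (ℓ.length + 1) ^ 2 ∧ n ≤ 600 * (k + 1)) ∧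
      (∀ a, a ≠ aLV → a ≠ aLC → a ≠ aRC → a ≠ aHT → a ≠ aAG → a ≠ aSTK → a ≠ aDIR →
        s'.mem a = s.mem a) ∧
      s'.mem aLV = Function.update (s.mem aLV) q (s.reg 31) ∧
      ∃ pre post, ((ℓ = pre ++ post ∧ s'.reg 34 = pre.getLastD 0) ∨ ℓ = pre ++ q :: post) ∧
        Indexed (pre ++ q :: post) s' := by
  obtain ⟨leaf, ⟨t, rep, hroot, avl, rfl⟩, sorted⟩ := hI
  have hht := Tree.two_pow_le_sq_of_avl avl
  rw [touch]
  refine Runs.seq ((runs_descend h0 h1 hq hroot.symm rep avl sorted).framed.mono ?_)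
  rintro s1 n1 ⟨⟨hn1, c, t1, hD, h32⟩, fr1⟩
  obtain ⟨zero, one, query, depth, pred, cur, path, rep1, avl1, list, pre, post, height, mem,
    kmem⟩ := hD
  have r31 : s1.reg 31 = s.reg 31 := fr1.reg_lt (k := 32) rfl 31 (by norm_num)
  have leaf1 : LeafEntries s1.mem := by
    rw [LeafEntries, mem _ (by norm_num) (by norm_num), mem _ (by norm_num) (by norm_num)]
    exact leaf
  -- the subtrees of the node
  obtain ⟨l, r, hl, hr, hlA, hrA, hsub⟩ : ∃ l r : Tree, Rep aLC aRC s1.mem (s.kmem kRK) l ∧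
      Rep aLC aRC s1.mem (s.kmem kRK) r ∧ l.Avl ∧ r.Avl ∧
      ((t1 = .leaf ∧ s1.reg 36 = 1 ∧ l = .leaf ∧ r = .leaf) ∨
        (t1 = .node l q r ∧ s1.reg 36 = 0 ∧ s1.mem aLC q = l.root ∧ s1.mem aRC q = r.root ∧
          l.ht ≤ r.ht + 1 ∧ r.ht ≤ l.ht + 1)) := by
    rcases cur with ⟨h, -, h'⟩ | ⟨h, h', h''⟩
    · exact ⟨.leaf, .leaf, trivial, trivial, trivial, trivial, .inl ⟨h, h', rfl, rfl⟩⟩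
    · cases t1 with
      | leaf => exact absurd rfl h
      | node l x r =>
        obtain ⟨-, e1, e2, -, -, e3, e4⟩ := rep1
        rw [h32] at h'
        simp only [Tree.root] at h'
        subst h'
        exact ⟨l, r, e3, e4, avl1.1, avl1.2.1, .inr ⟨rfl, h'', e1, e2, avl1.2.2.1, avl1.2.2.2⟩⟩
  have hlist : pathPre c ++ (l.inorder ++ q :: r.inorder) ++ pathPost c =
      (pathPre c ++ l.inorder) ++ q :: (r.inorder ++ pathPost c) := by simp
  have hsorted : ((pathPre c ++ l.inorder) ++ q :: (r.inorder ++ pathPost c)).Pairwise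
      fun e f => pos s.mem s.kmem e < pos s.mem s.kmem f := by
    rcases hsub with ⟨rfl, -, rfl, rfl⟩ | ⟨rfl, -⟩
    · simp only [Tree.inorder, List.append_nil, List.nil_append] at list ⊢
      rw [← list, List.pairwise_append] at sorted
      rw [List.pairwise_append, List.pairwise_cons]
      refine ⟨sorted.1, ⟨post, sorted.2.1⟩, ?_⟩
      intro e he f hf
      rcases List.mem_cons.1 hf with rfl | hf
      exacts [pre e he, sorted.2.2 e he f hf]
    · rw [← hlist]
      rw [← list] at sorted
      exact sorted
  have hnd : ((pathPre c ++ l.inorder) ++ q :: (r.inorder ++ pathPost c)).Nodup :=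
    hsorted.imp fun h he => absurd (he ▸ h) (lt_irrefl _)
  have hnd' := hnd
  simp only [List.nodup_append, List.nodup_cons, List.mem_append, List.mem_cons] at hnd'
  refine Runs.seq (Runs.block rfl fun n2 hn2 => ?_)
  rw [run_seq]
  have fr2 := Prog.framed_run (c := climbStart) rfl s1
  obtain ⟨s2, hs2⟩ : ∃ s2, climbStart.run s1 = s2 := ⟨_, rfl⟩
  have e2 : s2.reg 35 = q ∧ s2.mem aLC q = l.root ∧ s2.mem aRC q = r.root ∧
      s2.mem aLV = Function.update (s.mem aLV) q (s.reg 31) ∧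
      (∀ a j, j ≠ q → s2.mem a j = s1.mem a j) := by
    have hLV := mem aLV (by norm_num) (by norm_num)
    subst hs2
    rcases hsub with ⟨-, h36, rfl, rfl⟩ | ⟨-, h36, hlc, hrc, -⟩
    · refine ⟨?_, ?_, ?_, ?_, fun a j hj => ?_⟩
      rotate_right
      · simp only [climbStart, Prog.run, Test.Holds, Instr.apply, h36, one, query,
          Function.update_apply, if_true]
        split_ifs <;> simp_all
      all_goals simp [climbStart, Prog.run, Test.Holds, Instr.apply, h36, one, query, zero, r31,
        Tree.root, hLV]
    · refine ⟨?_, ?_, ?_, ?_, fun a j hj => ?_⟩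
      rotate_right
      · simp only [climbStart, Prog.run, Test.Holds, Instr.apply, h36, one, query,
          Function.update_apply]
        simp only [zero_ne_one, if_false]
        split_ifs <;> simp_all
      all_goals simp [climbStart, Prog.run, Test.Holds, Instr.apply, h36, one, query, r31, hLV,
        hlc, hrc]
  rw [hs2] at fr2 ⊢
  obtain ⟨q35, qlc, qrc, qlv, qoff⟩ := e2
  have k2 : s2.kmem = s.kmem := (fr2.kmem_eq rfl).trans kmem
  have qz : s2.reg 3 = 0 := by rw [fr2.reg_lt (k := 35) rfl 3 (by norm_num), zero]
  have leaf2 : LeafEntries s2.mem := by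
    rw [LeafEntries, qoff _ _ hq0.symm, qoff _ _ hq0.symm]; exact leaf1
  have bal := run_rebalance s2 qz leaf2 (l := l) (r := r) (by rwa [q35]) (by rwa [q35])
    (by rwa [q35]) (by rw [k2]; exact hl.update_live (by grind) qoff)
    (by rw [k2]; exact hr.update_live (by grind) qoff)
    (by rw [q35]; simp only [List.nodup_append, List.nodup_cons, List.mem_cons]; grind) hlA hrA
    (by rcases hsub with ⟨-, -, rfl, rfl⟩ | h <;> omega)
    (by rcases hsub with ⟨-, -, rfl, rfl⟩ | h <;> omega)
  rw [q35] at bal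
  obtain ⟨b1, b2, b3, b4, t', b5, b6, b7, b8, b9⟩ := bal
  have hpath : PathRep (rebalance.run s2).mem (s.kmem kRK) c t1.ht := by
    refine path.congr (fun i hi => ?_) (fun e he a ha => ?_)
    · rw [b3.1 _ (by norm_num) (by norm_num) (by norm_num) (by norm_num),
        b3.1 _ (by norm_num) (by norm_num) (by norm_num) (by norm_num),
        fr2.mem _ (by decide), fr2.mem _ (by decide)]
      simp
    · have hn : e ∉ l.inorder ++ q :: r.inorder := by
        simp only [List.mem_append, List.mem_cons]
        grind
      rw [b3.2 _ _ hn, qoff _ _ (fun hx => hn (by simp [hx]))]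
  have asc : Ascent s2.mem s.kmem ((pathPre c ++ l.inorder) ++ q :: (r.inorder ++ pathPost c)) c t'
      (rebalance.run s2) := by
    refine ⟨?_, ?_, b6.symm, ⟨_, hpath, ?_⟩, by rwa [b1, k2] at b5, b8, b4, ?_, b3.1, by rw [b1,
      k2]⟩
    · rw [b2 3 (by norm_num) (by norm_num), qz]
    · rw [b2 33 (by norm_num) (by norm_num), fr2.reg_lt (k := 35) rfl 33 (by norm_num), depth]
    · rcases hsub with ⟨rfl, -, rfl, rfl⟩ | ⟨rfl, -, -, -, h1, h2⟩
      · simp [Tree.ht] at b9 ⊢; omega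
      · rw [if_neg (by omega), if_neg (by omega)] at b9
        simp only [Tree.ht]; omega
    · rw [b7, ← hlist]
  have r34 : (rebalance.run s2).reg 34 = (pathPre c).getLastD 0 := by
    rw [b2 34 (by norm_num) (by norm_num), fr2.reg_lt (k := 35) rfl 34 (by norm_num), pred]
  refine Runs.seq ((runs_ascent asc hnd).framed.mono ?_)
  rintro s3 n3 ⟨⟨hn3, t3, hA⟩, fr3⟩
  refine Runs.block rfl fun n4 hn4 => ?_
  obtain ⟨-, -, cur3, -, rep3, avl3, leaf3, list3, mem3, kmem3⟩ := hA
  have hmem3 : ∀ a, a ≠ aLV → a ≠ aLC → a ≠ aRC → a ≠ aHT → a ≠ aAG → a ≠ aSTK → a ≠ aDIR →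
      s3.mem a = s.mem a := by
    intro a g1 g2 g3 g4 g5 g6 g7
    rw [mem3 a g2 g3 g4 g5, fr2.mem a (by simp [climbStart, Prog.arrs]; omega), mem a g6 g7]
  have hcost : (climbStart ;; rebalance).cost ≤ 190 := by decide
  simp only [Prog.cost] at hn4
  simp only [Prog.run, Instr.apply]
  refine ⟨⟨t.ht, hht, by omega⟩, hmem3, by rw [mem3 _ (by norm_num) (by norm_num) (by norm_num)
    (by norm_num), qlv], pathPre c ++ l.inorder, r.inorder ++ pathPost c, ?_, leaf3,
    ⟨t3, ?_, ?_, avl3, ?_⟩, ?_⟩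
  · rcases hsub with ⟨rfl, -, rfl, rfl⟩ | ⟨rfl, -⟩
    · left
      simp only [Tree.inorder, List.append_nil, List.nil_append] at list ⊢
      refine ⟨list.symm, ?_⟩
      rw [Function.update_of_ne (by norm_num), fr3.reg 34 (by decide), r34]
    · right
      rw [← list, ← hlist]; rfl
  · rwa [kmem3]
  · simp [cur3]
  · rw [← list3]
    simp [pathPre, pathPost]
  · rw [pos_congr (hmem3 aTY (by norm_num) (by norm_num) (by norm_num) (by norm_num) (by norm_num)
      (by norm_num) (by norm_num)) kmem3]
    exact hsorted

end DynInterval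

end

/-! ### Search for the leftmost interval that reaches a point. -/

noncomputable section

namespace DynInterval

/-! ### Searching for the leftmost interval that reaches a point -/

/-- The node `e` is the left endpoint of an interval that is present and reaches `x`. -/
def Hits (m : ℕ → ℕ → ℕ) (rk : ℕ → ℝ) (x : ℝ) (e : ℕ) : Prop := m aLV e ≠ 0 ∧ x ≤ rk e

/-- The farthest-reaching candidate alone decides whether a subtree contains a hit. -/
theorem IsBest.exists_hits {m : ℕ → ℕ → ℕ} {rk : ℕ → ℝ} {ℓ : List ℕ} {a : ℕ} (h : IsBest m rk ℓ a)
    (x : ℝ) : (∃ e ∈ ℓ, Hits m rk x e) ↔ a ≠ 0 ∧ x ≤ rk a := by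
  rcases h with ⟨rfl, h⟩ | ⟨h0, h1, h2, h3⟩
  · simp only [ne_eq, not_true_eq_false, false_and, iff_false, not_exists, not_and]
    exact fun e he hh => hh.1 (h e he)
  · constructor
    · rintro ⟨e, he, hl, hx⟩
      exact ⟨h0, hx.trans (h3 e he hl)⟩
    · rintro ⟨-, hx⟩
      exact ⟨a, h1, h2, hx⟩

/-- Put `1` into register `61` if the subtree with root in register `40` contains a hit. -/
def testSubtree : Prog :=
  load 60 aAG 40 ;; const 61 0 ;;
    .ite (.eq 60 3) nop (kload 21 kRK 60 ;; .ite (.kle 20 21) (const 61 1) nop)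

theorem run_testSubtree {s : State} (h0 : s.reg 3 = 0) {t : Tree} (hm : LeafEntries s.mem)
    (hrep : Rep aLC aRC s.mem (s.kmem kRK) t) (hroot : s.reg 40 = t.root) :
    (testSubtree.run s).kreg 20 = s.kreg 20 ∧
    ((∃ e ∈ t.inorder, Hits s.mem (s.kmem kRK) (s.kreg 20) e) → (testSubtree.run s).reg 61 = 1) ∧
    ((¬ ∃ e ∈ t.inorder, Hits s.mem (s.kmem kRK) (s.kreg 20) e) →
      (testSubtree.run s).reg 61 = 0) := by
  rw [(hrep.isBest_root hm).exists_hits, ← hroot]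
  by_cases c1 : s.mem aAG (s.reg 40) = 0
  · simp [testSubtree, Prog.run, Test.Holds, Instr.apply, h0, c1]
  · by_cases c2 : s.kreg 20 ≤ s.kmem kRK (s.mem aAG (s.reg 40)) <;>
    simp [testSubtree, Prog.run, Test.Holds, Instr.apply, h0, c1, c2]

def findTail : Prog :=
  .ite (.eq 61 4) (copy 41 40)
    (load 62 aLV 41 ;; .ite (.eq 62 3) (load 41 aRC 41)
      (kload 21 kRK 41 ;; .ite (.kle 20 21) (copy 39 41) (load 41 aRC 41)))

def findStep : Prog := load 40 aLC 41 ;; testSubtree ;; findTail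

/-- Put the leftmost hit, for the endpoint of the node in register `30`, into register `39`. -/
def findFirst : Prog :=
  (kload 20 kKEY 30 ;; const 39 0 ;; copy 41 1 ;; copy 40 1 ;; testSubtree) ;;
    .ite (.eq 61 4) (.loop (.eq 39 3) findStep) nop

theorem run_findTail {s : State} (h0 : s.reg 3 = 0) (h1 : s.reg 4 = 1) (h39 : s.reg 39 = 0) :
    (findTail.run s).kreg 20 = s.kreg 20 ∧
    (s.reg 61 = 1 → (findTail.run s).reg 39 = 0 ∧ (findTail.run s).reg 41 = s.reg 40) ∧
    (s.reg 61 = 0 → Hits s.mem (s.kmem kRK) (s.kreg 20) (s.reg 41) →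
      (findTail.run s).reg 39 = s.reg 41) ∧
    (s.reg 61 = 0 → ¬ Hits s.mem (s.kmem kRK) (s.kreg 20) (s.reg 41) →
      (findTail.run s).reg 39 = 0 ∧ (findTail.run s).reg 41 = s.mem aRC (s.reg 41)) := by
  simp only [Hits]
  by_cases c0 : s.reg 61 = 1
  · simp [findTail, Prog.run, Test.Holds, Instr.apply, h1, c0, h39]
  · by_cases c1 : s.mem aLV (s.reg 41) = 0
    · simp [findTail, Prog.run, Test.Holds, Instr.apply, h0, h1, c0, c1, h39]
    · by_cases c2 : s.kreg 20 ≤ s.kmem kRK (s.reg 41) <;>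
      simp [findTail, Prog.run, Test.Holds, Instr.apply, h0, h1, c0, c1, c2, h39]

/-- The node `w` is the first hit in the list `ℓ`. -/
def FirstHit (m : ℕ → ℕ → ℕ) (rk : ℕ → ℝ) (x : ℝ) (ℓ : List ℕ) (w : ℕ) : Prop :=
  Hits m rk x w ∧ ∃ pre post, ℓ = pre ++ w :: post ∧ ∀ e ∈ pre, ¬ Hits m rk x e

/-- The state while searching. -/
structure Searching (m : ℕ → ℕ → ℕ) (km : ℕ → ℕ → ℝ) (x : ℝ) (ℓ : List ℕ) (v : ℕ)
    (s : State) : Prop where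
  zero : s.reg 3 = 0
  one : s.reg 4 = 1
  key : s.kreg 20 = x
  mem : s.mem = m
  kmem : s.kmem = km
  cur : (s.reg 39 ≠ 0 ∧ FirstHit m (km kRK) x ℓ (s.reg 39)) ∨
    (s.reg 39 = 0 ∧ ∃ t pre post, ℓ = pre ++ (Tree.inorder t ++ post) ∧
      Rep aLC aRC m (km kRK) t ∧ s.reg 41 = t.root ∧ (∃ e ∈ t.inorder, Hits m (km kRK) x e) ∧
      (∀ e ∈ pre, ¬ Hits m (km kRK) x e) ∧ 20 * t.ht ≤ v)

/-- The current subtree is known to contain a hit and nothing to its left does. If the left subtree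
contains none and the node is none, the right subtree must contain one, so the search never
backtracks. -/
theorem Searching.step {m : ℕ → ℕ → ℕ} {km : ℕ → ℕ → ℝ} {x : ℝ} {ℓ : List ℕ} {v : ℕ}
    {s : State} (hm : LeafEntries m) (h : Searching m km x ℓ v s) (h39 : s.reg 39 = 0) :
    ∃ v', Searching m km x ℓ v' (findStep.run s) ∧ v' + 20 ≤ v := by
  obtain ⟨zero, one, key, rfl, rfl, cur⟩ := h
  rcases cur with h | ⟨-, t, pre, post, hℓ, hrep, hroot, hex, hpre, hv⟩
  · exact absurd h39 h.1
  cases t with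
  | leaf => simp [Tree.inorder] at hex
  | node l y r =>
    obtain ⟨hy0, hl, hr, -, -, repl, repr⟩ := hrep
    simp only [Tree.root] at hroot
    rw [findStep, run_seq, run_seq, run_instr]
    obtain ⟨s1, hs1⟩ : ∃ s1, (Instr.load 40 aLC 41).apply s = s1 := ⟨_, rfl⟩
    have e1 : s1.mem = s.mem ∧ s1.kmem = s.kmem ∧ s1.kreg = s.kreg ∧ s1.reg 40 = l.root ∧
        s1.reg 3 = 0 ∧ s1.reg 4 = 1 ∧ s1.reg 39 = 0 ∧ s1.reg 41 = y := by
      subst hs1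
      simp [Instr.apply, hroot, hl, zero, one, h39]
    rw [hs1]
    obtain ⟨m1, k1, kr1, q40, q3, q4, q39, q41⟩ := e1
    have t1 := run_testSubtree q3 (t := l) (by rwa [m1]) (by rwa [m1, k1]) q40
    have fr2 := Prog.framed_run (c := testSubtree) rfl s1
    rw [m1, k1, kr1, key] at t1
    obtain ⟨tk, tpos, tneg⟩ := t1
    obtain ⟨s2, hs2⟩ : ∃ s2, testSubtree.run s1 = s2 := ⟨_, rfl⟩
    rw [hs2] at fr2 tk tpos tneg ⊢
    have m2 : s2.mem = s.mem := (fr2.mem_eq rfl).trans m1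
    have k2 : s2.kmem = s.kmem := (fr2.kmem_eq rfl).trans k1
    have r2 := fr2.reg_lt (k := 60) rfl
    obtain ⟨uk, u1, u2, u3⟩ := run_findTail (s := s2) (by rw [r2 3 (by norm_num), q3])
      (by rw [r2 4 (by norm_num), q4]) (by rw [r2 39 (by norm_num), q39])
    have fr3 := Prog.framed_run (c := findTail) rfl s2
    rw [m2, k2, tk, r2 41 (by norm_num), q41] at u2 u3
    rw [r2 40 (by norm_num), q40] at u1
    have q3' : (findTail.run s2).reg 3 = 0 := by
      rw [fr3.reg_lt (k := 39) rfl 3 (by norm_num), r2 3 (by norm_num), q3]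
    have q4' : (findTail.run s2).reg 4 = 1 := by
      rw [fr3.reg_lt (k := 39) rfl 4 (by norm_num), r2 4 (by norm_num), q4]
    have m3 : (findTail.run s2).mem = s.mem := (fr3.mem_eq rfl).trans m2
    have k3 : (findTail.run s2).kmem = s.kmem := (fr3.kmem_eq rfl).trans k2
    simp only [Tree.inorder, List.append_assoc, List.cons_append] at hℓ
    simp only [Tree.ht] at hv
    by_cases c1 : ∃ e ∈ l.inorder, Hits s.mem (s.kmem kRK) x e
    · obtain ⟨v1, v2⟩ := u1 (tpos c1)
      exact ⟨20 * l.ht, ⟨q3', q4', by rw [uk, tk], m3, k3, .inr ⟨v1, l, pre, _, hℓ, repl, v2, c1,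
        hpre, le_rfl⟩⟩, by omega⟩
    · have hz := tneg c1
      have hpre' : ∀ e ∈ pre ++ l.inorder, ¬ Hits s.mem (s.kmem kRK) x e := by
        intro e he hh
        rcases List.mem_append.1 he with he | he
        exacts [hpre e he hh, c1 ⟨e, he, hh⟩]
      by_cases c2 : Hits s.mem (s.kmem kRK) x y
      · have v1 := u2 hz c2
        refine ⟨0, ⟨q3', q4', by rw [uk, tk], m3, k3, .inl ?_⟩, by omega⟩
        rw [v1]
        exact ⟨hy0, c2, pre ++ l.inorder, r.inorder ++ post, by simp [hℓ], hpre'⟩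
      · obtain ⟨v1, v2⟩ := u3 hz c2
        refine ⟨20 * r.ht, ⟨q3', q4', by rw [uk, tk], m3, k3, .inr ⟨v1, r,
          pre ++ (l.inorder ++ [y]), post, by simp [hℓ], repr, v2.trans hr, ?_, ?_, le_rfl⟩⟩,
          by omega⟩
        · obtain ⟨e, he, hh⟩ := hex
          simp only [Tree.inorder, List.mem_append, List.mem_cons] at he
          rcases he with he | rfl | he
          exacts [absurd ⟨e, he, hh⟩ c1, absurd hh c2, ⟨e, he, hh⟩]
        · intro e he
          rw [← List.append_assoc, List.mem_append, List.mem_singleton] at he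
          rcases he with he | rfl
          exacts [hpre' e he, c2]

theorem runs_findFirst {s : State} {ℓ : List ℕ} (h0 : s.reg 3 = 0) (h1 : s.reg 4 = 1)
    (hI : Indexed ℓ s) :
    Runs findFirst s fun s' n => (∃ k, 2 ^ k ≤ (ℓ.length + 1) ^ 2 ∧ n ≤ 40 * (k + 1)) ∧
      ((s'.reg 39 = 0 ∧ ∀ e ∈ ℓ, ¬ Hits s.mem (s.kmem kRK) (s.kmem kKEY (s.reg 30)) e) ∨
        (s'.reg 39 ≠ 0 ∧
          FirstHit s.mem (s.kmem kRK) (s.kmem kKEY (s.reg 30)) ℓ (s'.reg 39))) := by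
  obtain ⟨leaf, ⟨t, rep, hroot, avl, rfl⟩, sorted⟩ := hI
  have hht := Tree.two_pow_le_sq_of_avl avl
  rw [findFirst]
  refine Runs.seq (Runs.block rfl fun n1 hn1 => ?_)
  simp only [testSubtree, Prog.cost] at hn1
  norm_num at hn1
  obtain ⟨s1, hs1⟩ : ∃ s1, Prog.run (kload 20 kKEY 30 ;; const 39 0 ;; copy 41 1 ;; copy 40 1) s =
    s1 :=
    ⟨_, rfl⟩
  have e1 : s1.mem = s.mem ∧ s1.kmem = s.kmem ∧ s1.kreg 20 = s.kmem kKEY (s.reg 30) ∧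
      s1.reg 40 = t.root ∧ s1.reg 3 = 0 ∧ s1.reg 4 = 1 ∧ s1.reg 39 = 0 ∧ s1.reg 41 = t.root := by
    subst hs1
    simp [Prog.run, Instr.apply, hroot, h0, h1]
  obtain ⟨m1, k1, kr1, q40, q3, q4, q39, q41⟩ := e1
  have t1 := run_testSubtree q3 (t := t) (by rwa [m1]) (by rwa [m1, k1]) q40
  have fr2 := Prog.framed_run (c := testSubtree) rfl s1
  rw [m1, k1, kr1] at t1
  have heq : Prog.run (kload 20 kKEY 30 ;; const 39 0 ;; copy 41 1 ;; copy 40 1 ;; testSubtree) s =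
      testSubtree.run s1 := by rw [← hs1]; rfl
  rw [heq]
  obtain ⟨tk, tpos, tneg⟩ := t1
  generalize testSubtree.run s1 = s2 at *
  have m2 : s2.mem = s.mem := (fr2.mem_eq rfl).trans m1
  have k2 : s2.kmem = s.kmem := (fr2.kmem_eq rfl).trans k1
  have r2 := fr2.reg_lt (k := 60) rfl
  generalize s.kmem kKEY (s.reg 30) = x at *
  have z2 : s2.reg 4 = 1 := by rw [r2 4 (by norm_num), q4]
  refine Runs.ite (fun hb => ?_) (fun hb => ?_)
  · simp only [Test.Holds, z2] at hb
    have hex : ∃ e ∈ t.inorder, Hits s.mem (s.kmem kRK) x e := by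
      by_contra hno
      rw [tneg hno] at hb
      exact zero_ne_one hb
    refine (Runs.loop (Searching s.mem s.kmem x t.inorder) ?_ (v := 20 * t.ht)
      ⟨by rw [r2 3 (by norm_num), q3], z2, tk, m2, k2, .inr ⟨by rw [r2 39 (by norm_num), q39], t,
        [],
        [], by simp, rep, by rw [r2 41 (by norm_num), q41], hex, by simp, le_rfl⟩⟩).mono ?_
    · intro v s' h hb
      simp only [Test.Holds, h.zero] at hb
      obtain ⟨v', h', hv'⟩ := h.step leaf hb
      refine Runs.block rfl fun n hn => ⟨v', h', ?_⟩
      have : findStep.cost ≤ 18 := by decide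
      omega
    · rintro s' n ⟨hn, ⟨v, h⟩, hb⟩
      simp only [Test.Holds, h.zero] at hb
      refine ⟨⟨t.ht, hht, by omega⟩, .inr ⟨hb, ?_⟩⟩
      rcases h.cur with h | h
      · exact h.2
      · exact absurd h.1 hb
  · refine Runs.block rfl fun n hn => ?_
    simp only [Prog.cost] at hn
    refine ⟨⟨t.ht, hht, by omega⟩, .inl ⟨?_, ?_⟩⟩
    · simp [Prog.run, Instr.apply, r2, q39]
    · intro e he hh
      exact hb (by simp only [Test.Holds, z2]; exact tpos ⟨e, he, hh⟩)

end DynInterval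

end

/-! ### The interval table, the endpoint list and the level counters. -/

noncomputable section

namespace DynInterval

/-! ### The stored intervals -/

/-- The positions of the endpoints of the interval `t`. -/
def lpos (s : State) (t : ℕ) : ℝ ×ₗ ℤ := pos s.mem s.kmem (s.mem aLN t)
def rpos (s : State) (t : ℕ) : ℝ ×ₗ ℤ := pos s.mem s.kmem (s.mem aRN t)

/-- The nodes in use. -/
def nodes (s : State) : Finset ℕ := Finset.Icc 1 (s.reg 2)

/-- The list pointers lead from each node (and from `0`) to the next node, if there is one. -/
def NextOk (s : State) : Prop :=
  ∀ e g, (e = 0 ∨ e ∈ nodes s) → g ∈ nodes s →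
    (e = 0 ∨ pos s.mem s.kmem e < pos s.mem s.kmem g) →
    s.mem aNXT e ∈ nodes s ∧
    (e = 0 ∨ pos s.mem s.kmem e < pos s.mem s.kmem (s.mem aNXT e)) ∧
    pos s.mem s.kmem (s.mem aNXT e) ≤ pos s.mem s.kmem g

/-- The entries of the endpoints of the interval `t`. -/
structure Entry (t : ℕ) (I : NonemptyInterval ℝ) (s : State) : Prop where
  left_mem : s.mem aLN t ∈ nodes s
  right_mem : s.mem aRN t ∈ nodes s
  own_left : s.mem aOWN (s.mem aLN t) = t
  own_right : s.mem aOWN (s.mem aRN t) = t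
  ty_left : s.mem aTY (s.mem aLN t) = 0
  ty_right : s.mem aTY (s.mem aRN t) = 1
  key_left : s.kmem kKEY (s.mem aLN t) = I.fst
  key_right : s.kmem kKEY (s.mem aRN t) = I.snd
  rk_left : s.kmem kRK (s.mem aLN t) = I.snd
  rk_right : s.kmem kRK (s.mem aRN t) = I.snd
  live_right : s.mem aLV (s.mem aRN t) = 0

/-- The intervals `I t` with `t ∈ X` are stored, and those with `t ∈ V` are present. -/
structure Store (X V : Finset ℕ) (I : ℕ → NonemptyInterval ℝ) (s : State) : Prop where
  sub : V ⊆ X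
  card : s.reg 2 = 2 * X.card
  entry : ∀ t ∈ X, Entry t (I t) s
  own : ∀ e ∈ nodes s, s.mem aOWN e ∈ X ∧
    (e = s.mem aLN (s.mem aOWN e) ∨ e = s.mem aRN (s.mem aOWN e))
  live : ∀ t ∈ X, s.mem aLV (s.mem aLN t) ≠ 0 ↔ t ∈ V
  index : ∃ ℓ, Indexed ℓ s ∧ ∀ e, e ∈ ℓ ↔ e ∈ nodes s
  next : NextOk s

theorem nodes_ne_zero {s : State} {e : ℕ} (h : e ∈ nodes s) : e ≠ 0 := by
  simp [nodes] at h; omega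

/-- For equal keys the integer of a left endpoint is negative and that of a right endpoint positive,
so touching counts as meeting. This translates closed real intervals into half-open intervals of
positions. -/
theorem Store.lpos_lt_rpos {X V : Finset ℕ} {I : ℕ → NonemptyInterval ℝ} {s : State}
    (h : Store X V I s) {t u : ℕ} (ht : t ∈ X) (hu : u ∈ X) :
    lpos s t < rpos s u ↔ (I t).fst ≤ (I u).snd := by
  have a := h.entry t ht
  have b := h.entry u hu
  have := nodes_ne_zero a.left_mem
  rw [lpos, rpos, pos_lt, a.key_left, b.key_right, a.ty_left, b.ty_right, le_iff_lt_or_eq]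
  simp only [if_true, one_ne_zero, if_false]
  constructor
  · rintro (h | h)
    exacts [.inl h, .inr h.1]
  · rintro (h | h)
    · exact .inl h
    · exact .inr ⟨h, by omega⟩

theorem Store.lpos_ne_rpos {X V : Finset ℕ} {I : ℕ → NonemptyInterval ℝ} {s : State}
    (h : Store X V I s) {t u : ℕ} (ht : t ∈ X) (hu : u ∈ X) : lpos s t ≠ rpos s u := by
  intro he
  have := pos_injective he
  have a := (h.entry t ht).ty_left
  rw [this, (h.entry u hu).ty_right] at a
  exact one_ne_zero a

theorem Store.lpos_injective {X V : Finset ℕ} {I : ℕ → NonemptyInterval ℝ} {s : State}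
    (h : Store X V I s) {t u : ℕ} (ht : t ∈ X) (hu : u ∈ X) (he : lpos s t = lpos s u) : t = u := by
  have := pos_injective he
  rw [← (h.entry t ht).own_left, this, (h.entry u hu).own_left]

/-! ### Walking along the list -/

/-- Execute `c` for the nodes from that in register `45` to that in register `r`, exclusively. -/
def walk (r : ℕ) (c : Prog) : Prog := whileNe 52 45 r (c ;; load 45 aNXT 45)

/-- The nodes from `e` to `z`, exclusively. -/
def between (s : State) (e z : ℕ) : Finset ℕ :=
  open Classical in (nodes s).filter fun g =>
    pos s.mem s.kmem e ≤ pos s.mem s.kmem g ∧ pos s.mem s.kmem g < pos s.mem s.kmem z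

/-- Each step strictly increases the position and so removes a node from `between`. The constant `k
+ 5` is the budget `k` of the body, one step to advance and 4 of loop overhead; the potential `v`
lets a body borrow from earlier ones. -/
theorem runs_walk {s₀ : State} (hnext : NextOk s₀) {r : ℕ} (hr : r ≠ 52) {c : Prog} {z k : ℕ}
    (hz : z ∈ nodes s₀) (J : ℕ → ℕ → State → Prop)
    (hJ : ∀ v e s, J v e s → s.reg 4 = 1 ∧ s.reg 45 = e ∧ s.reg r = z)
    (hset : ∀ v e s k, J v e s → J v e (s.set 52 k))
    (hbody : ∀ v e s, e ∈ nodes s₀ → pos s₀.mem s₀.kmem e < pos s₀.mem s₀.kmem z → J v e s →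
      Runs c s fun s' m => s'.mem aNXT = s₀.mem aNXT ∧ s'.reg 45 = e ∧
        ∃ v', J v' (s₀.mem aNXT e) (s'.set 45 (s₀.mem aNXT e)) ∧ m + v' ≤ k + v)
    {v e : ℕ} {s : State} (he : e ∈ nodes s₀)
    (hez : pos s₀.mem s₀.kmem e ≤ pos s₀.mem s₀.kmem z) (hs : J v e s) :
    Runs (walk r c) s fun s' m => (∃ v', J v' z s') ∧
      m ≤ v + (k + 5) * (between s₀ e z).card + 4 := by
  have := runs_whileNe (f := 52) (x := 45) (y := r) (c := c ;; load 45 aNXT 45) (by norm_num) hr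
    (fun w s => ∃ v e, e ∈ nodes s₀ ∧ pos s₀.mem s₀.kmem e ≤ pos s₀.mem s₀.kmem z ∧ J v e s ∧
      v + (k + 5) * (between s₀ e z).card ≤ w)
    (fun w s ⟨v, e, _, _, h, _⟩ => (hJ v e s h).1)
    (fun w s k ⟨v, e, h1, h2, h, h3⟩ => ⟨v, e, h1, h2, hset v e s k h, h3⟩)
    (by
      rintro w s ⟨v, e, h1, h2, h, h3⟩ hne
      obtain ⟨-, h45, hrz⟩ := hJ v e s h
      rw [h45, hrz] at hne
      have hlt : pos s₀.mem s₀.kmem e < pos s₀.mem s₀.kmem z :=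
        lt_of_le_of_ne h2 fun h => hne (pos_injective h)
      obtain ⟨n1, n2, n3⟩ := hnext e z (.inr h1) hz (.inr hlt)
      have n2 := n2.resolve_left (nodes_ne_zero h1)
      refine Runs.seq ((hbody v e s h1 hlt h).mono ?_)
      rintro s' m ⟨e1, e2, v', hJ', hm⟩
      refine Runs.block rfl fun t ht => ?_
      have heq : Prog.run (load 45 aNXT 45) s' = s'.set 45 (s₀.mem aNXT e) := by
        simp [Prog.run, Instr.apply, State.set, e1, e2]
      rw [heq]
      refine ⟨v' + (k + 5) * (between s₀ (s₀.mem aNXT e) z).card,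
        ⟨v', _, n1, n3, hJ', le_rfl⟩, ?_⟩
      simp only [Prog.cost] at ht
      have hcard : (between s₀ (s₀.mem aNXT e) z).card + 1 ≤ (between s₀ e z).card := by
        refine Finset.card_lt_card ⟨fun g hg => ?_, fun hsub => ?_⟩
        · simp only [between, Finset.mem_filter] at hg ⊢
          exact ⟨hg.1, n2.le.trans hg.2.1, hg.2.2⟩
        · have : e ∈ between s₀ e z := by
            simp only [between, Finset.mem_filter]
            exact ⟨h1, le_rfl, hlt⟩
          have := hsub this
          simp only [between, Finset.mem_filter] at this
          exact absurd this.2.1 (not_le.2 n2)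
      have := Nat.mul_le_mul_left (k + 5) hcard
      rw [mul_add] at this
      omega)
    (v := v + (k + 5) * (between s₀ e z).card) ⟨v, e, he, hez, hs, le_rfl⟩
  refine this.mono ?_
  rintro s' m ⟨hm, ⟨w, vz, e', h1, h2, h, h3⟩, hreg⟩
  obtain ⟨-, h45, hrz⟩ := hJ vz e' s' h
  rw [h45, hrz] at hreg
  subst hreg
  exact ⟨⟨vz, h⟩, hm⟩

/-! ### Counting the intervals of each level during a sweep -/

/-- The array `aCNT` counts the intervals in `A` by level, and register `46` the levels below
that in register `44` that do not occur. -/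
structure Tally (A : Finset ℕ) (lev : ℕ → ℕ) (s : State) : Prop where
  count : ∀ i, s.mem aCNT i = (A.filter fun u => lev u = i).card
  missing : s.reg 46 = ((Finset.range (s.reg 44)).filter fun i => s.mem aCNT i = 0).card

def enter : Prog :=
  .ite (.eq 63 3) (.ite (.lt 62 44) (dec 46) nop) nop ;; inc 63 ;; store aCNT 62 63

def leave : Prog :=
  dec 63 ;; store aCNT 62 63 ;; .ite (.eq 63 3) (.ite (.lt 62 44) (inc 46) nop) nop

/-- Count the interval of the node in register `45`, if it takes part in the coloring and reaches
the endpoint of the node in register `42`. -/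
def event : Prog :=
  load 60 aOWN 45 ;; load 61 aST 60 ;; .ite (.eq 61 3) nop
    (kload 20 kKEY 42 ;; kload 21 kRK 45 ;; .ite (.kle 20 21)
      (load 62 0 60 ;; load 63 aCNT 62 ;; load 64 aTY 45 ;; .ite (.eq 64 3) enter leave) nop)

theorem run_event_skip {s : State} (h0 : s.reg 3 = 0)
    (h : s.mem aST (s.mem aOWN (s.reg 45)) = 0 ∨
      ¬ s.kmem kKEY (s.reg 42) ≤ s.kmem kRK (s.reg 45)) :
    (event.run s).mem = s.mem ∧ (event.run s).reg 46 = s.reg 46 := by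
  by_cases c1 : s.mem aST (s.mem aOWN (s.reg 45)) = 0
  · simp [event, Prog.run, Test.Holds, Instr.apply, h0, c1]
  · have c2 := h.resolve_left c1
    simp [event, Prog.run, Test.Holds, Instr.apply, h0, c1, c2]

/-- Separates the index `i` from the others, so that the numbers of missing levels before and after
a change at `i` can be compared through their common part. -/
theorem card_missing_update {m : ℕ → ℕ} {b i k : ℕ} :
    ((Finset.range b).filter fun j => Function.update m i k j = 0).card =
      ((Finset.range b).filter fun j => j ≠ i ∧ m j = 0).card +
        if i < b ∧ k = 0 then 1 else 0 := by
  classical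
  have : (Finset.range b).filter (fun j => Function.update m i k j = 0) =
      (Finset.range b).filter (fun j => j ≠ i ∧ m j = 0) ∪
        (if i < b ∧ k = 0 then {i} else ∅) := by
    ext j
    by_cases hj : j = i
    · subst hj
      by_cases hk : j < b ∧ k = 0
      · simp [hk.1, hk.2]
      · simp only [Finset.mem_filter, Finset.mem_range, Function.update_self, Finset.mem_union,
          ne_eq, not_true_eq_false, false_and, and_false, false_or, if_neg hk, Finset.notMem_empty]
        simpa using hk
    · by_cases hk : i < b ∧ k = 0 <;> simp [hj, hk]
  rw [this, Finset.card_union_of_disjoint]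
  · split_ifs <;> simp
  · split_ifs <;> simp

theorem run_enter {s : State} (h0 : s.reg 3 = 0) :
    (enter.run s).mem aCNT = Function.update (s.mem aCNT) (s.reg 62) (s.reg 63 + 1) ∧
    (enter.run s).reg 46 = s.reg 46 - if s.reg 62 < s.reg 44 ∧ s.reg 63 = 0 then 1 else 0 := by
  by_cases c1 : s.reg 63 = 0 <;> by_cases c2 : s.reg 62 < s.reg 44 <;>
  simp [enter, Prog.run, Test.Holds, Instr.apply, h0, c1, c2]

theorem run_leave {s : State} (h0 : s.reg 3 = 0) :
    (leave.run s).mem aCNT = Function.update (s.mem aCNT) (s.reg 62) (s.reg 63 - 1) ∧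
    (leave.run s).reg 46 = s.reg 46 + if s.reg 62 < s.reg 44 ∧ s.reg 63 - 1 = 0 then 1 else 0 := by
  by_cases c1 : s.reg 63 - 1 = 0 <;> by_cases c2 : s.reg 62 < s.reg 44 <;>
  simp [leave, Prog.run, Test.Holds, Instr.apply, h0, c1, c2]

theorem Tally.update {A B : Finset ℕ} {lev : ℕ → ℕ} {s s' : State} {i k : ℕ}
    (h : Tally A lev s) (hb : s'.reg 44 = s.reg 44)
    (hm : s'.mem aCNT = Function.update (s.mem aCNT) i k)
    (hk : k = (B.filter fun u => lev u = i).card)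
    (hB : ∀ j, j ≠ i → (B.filter fun u => lev u = j).card = (A.filter fun u => lev u = j).card)
    (hmiss : s'.reg 46 + (if i < s.reg 44 ∧ s.mem aCNT i = 0 then 1 else 0) =
      s.reg 46 + if i < s.reg 44 ∧ k = 0 then 1 else 0) : Tally B lev s' := by
  constructor
  · intro j
    rw [hm, Function.update_apply]
    split_ifs with hj
    · rw [hj, hk]
    · rw [h.count, hB j hj]
  · have e1 := card_missing_update (m := s.mem aCNT) (b := s.reg 44) (i := i) (k := k)
    -- The old counters are the update at `i` by their own value.
    have e2 := card_missing_update (m := s.mem aCNT) (b := s.reg 44) (i := i) (k := s.mem aCNT i)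
    rw [Function.update_eq_self, ← h.missing] at e2
    rw [hm, hb, e1]
    omega

theorem run_event_enter {s : State} {A : Finset ℕ} {u : ℕ} (h0 : s.reg 3 = 0)
    (hu : s.mem aOWN (s.reg 45) = u) (hst : s.mem aST u ≠ 0)
    (hc : s.kmem kKEY (s.reg 42) ≤ s.kmem kRK (s.reg 45)) (hty : s.mem aTY (s.reg 45) = 0)
    (hA : u ∉ A) (h : Tally A (s.mem 0) s) : Tally (insert u A) (s.mem 0) (event.run s) := by
  obtain ⟨s1, hs1⟩ : ∃ s1, Prog.run (load 60 aOWN 45 ;; load 61 aST 60 ;; kload 20 kKEY 42 ;;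
    kload 21 kRK 45 ;; load 62 0 60 ;; load 63 aCNT 62 ;; load 64 aTY 45) s = s1 := ⟨_, rfl⟩
  have hrun : event.run s = enter.run s1 := by
    rw [← hs1]
    simp [event, Prog.run, Test.Holds, Instr.apply, h0, hu, hst, hc, hty]
  have q : s1.reg 3 = 0 ∧ s1.mem = s.mem ∧ s1.reg 62 = s.mem 0 u ∧
      s1.reg 63 = s.mem aCNT (s.mem 0 u) ∧ s1.reg 44 = s.reg 44 ∧ s1.reg 46 = s.reg 46 := by
    rw [← hs1]
    simp [Prog.run, Instr.apply, h0, hu]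
  obtain ⟨q3, qm, q62, q63, q44, q46⟩ := q
  obtain ⟨e1, e2⟩ := run_enter (s := s1) q3
  rw [hrun]
  rw [qm, q62, q63] at e1
  rw [q62, q63, q44, q46] at e2
  have hcnt := h.count (s.mem 0 u)
  refine h.update (i := s.mem 0 u) ((Prog.framed_run rfl s1).reg 44 (by decide) |>.trans q44) e1 ?_
    ?_ ?_
  · rw [hcnt, Finset.filter_insert, if_pos rfl, Finset.card_insert_of_notMem]
    simp [hA]
  · intro j hj
    rw [Finset.filter_insert, if_neg hj.symm]
  · rw [e2, if_neg (c := _ ∧ _ + 1 = 0) (by omega)]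
    split_ifs with hif
    -- The level counted as missing, so the decrement is not truncated at 0.
    · have : 0 < s.reg 46 := by
        rw [h.missing]
        exact Finset.card_pos.2 ⟨s.mem 0 u, by simp [hif]⟩
      omega
    · omega

theorem run_event_leave {s : State} {A : Finset ℕ} {u : ℕ} (h0 : s.reg 3 = 0)
    (hu : s.mem aOWN (s.reg 45) = u) (hst : s.mem aST u ≠ 0)
    (hc : s.kmem kKEY (s.reg 42) ≤ s.kmem kRK (s.reg 45)) (hty : s.mem aTY (s.reg 45) = 1)
    (hA : u ∈ A) (h : Tally A (s.mem 0) s) : Tally (A.erase u) (s.mem 0) (event.run s) := by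
  obtain ⟨s1, hs1⟩ : ∃ s1, Prog.run (load 60 aOWN 45 ;; load 61 aST 60 ;; kload 20 kKEY 42 ;;
    kload 21 kRK 45 ;; load 62 0 60 ;; load 63 aCNT 62 ;; load 64 aTY 45) s = s1 := ⟨_, rfl⟩
  have hrun : event.run s = leave.run s1 := by
    rw [← hs1]
    simp [event, Prog.run, Test.Holds, Instr.apply, h0, hu, hst, hc, hty]
  have q : s1.reg 3 = 0 ∧ s1.mem = s.mem ∧ s1.reg 62 = s.mem 0 u ∧
      s1.reg 63 = s.mem aCNT (s.mem 0 u) ∧ s1.reg 44 = s.reg 44 ∧ s1.reg 46 = s.reg 46 := by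
    rw [← hs1]
    simp [Prog.run, Instr.apply, h0, hu]
  obtain ⟨q3, qm, q62, q63, q44, q46⟩ := q
  obtain ⟨e1, e2⟩ := run_leave (s := s1) q3
  rw [hrun]
  rw [qm, q62, q63] at e1
  rw [q62, q63, q44, q46] at e2
  have hcnt := h.count (s.mem 0 u)
  -- `u` itself is counted, so the counter really decreases and its level was not missing before.
  have hpos : 0 < s.mem aCNT (s.mem 0 u) := by
    rw [hcnt]
    exact Finset.card_pos.2 ⟨u, by simp [hA]⟩
  refine h.update (i := s.mem 0 u) ((Prog.framed_run rfl s1).reg 44 (by decide) |>.trans q44) e1 ?_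
    ?_ ?_
  · rw [hcnt, Finset.filter_erase, Finset.card_erase_of_mem]
    simp [hA]
  · intro j hj
    rw [Finset.filter_erase, Finset.erase_eq_of_notMem]
    simp [hj.symm]
  · rw [e2, if_neg (c := _ ∧ s.mem aCNT (s.mem 0 u) = 0) (by omega), add_zero]

end DynInterval

end

/-! ### The sweep: which intervals are active at which position. -/

noncomputable section

namespace DynInterval

/-! ### Sweeping over an interval -/

open Classical in
/-- The intervals in `S` that reach the left endpoint of `z` and contain the position just before
the node `e`. -/
def bef (s : State) (S : Finset ℕ) (z e : ℕ) : Finset ℕ :=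
  S.filter fun u => lpos s z < rpos s u ∧ lpos s u < pos s.mem s.kmem e ∧
    pos s.mem s.kmem e ≤ rpos s u

open Classical in
/-- The intervals in `S` that reach the left endpoint of `z` and contain the position `q`. -/
def aft (s : State) (S : Finset ℕ) (z : ℕ) (q : ℝ ×ₗ ℤ) : Finset ℕ :=
  S.filter fun u => lpos s z < rpos s u ∧ lpos s u ≤ q ∧ q < rpos s u

/-- The state during a sweep over the interval `z` at the node `e`, where the intervals in `A` are
counted. -/
structure SweepAt (s₀ : State) (z : ℕ) (A : Finset ℕ) (e : ℕ) (s : State) : Prop where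
  zero : s.reg 3 = 0
  one : s.reg 4 = 1
  left : s.reg 42 = s₀.mem aLN z
  right : s.reg 43 = s₀.mem aRN z
  cur : s.reg 45 = e
  mem : ∀ a, a ≠ aCNT → s.mem a = s₀.mem a
  kmem : s.kmem = s₀.kmem
  tally : Tally A (s₀.mem 0) s

/-- What is assumed during a sweep over `z`: the intervals in `S` take part in the coloring. -/
structure Scene (X V : Finset ℕ) (I : ℕ → NonemptyInterval ℝ) (S : Finset ℕ) (z : ℕ)
    (s₀ : State) : Prop where
  store : Store X V I s₀
  sub : S ⊆ X
  part : ∀ t, s₀.mem aST t ≠ 0 ↔ t ∈ S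
  mem : z ∈ X
  notMem : z ∉ S

variable {X V S : Finset ℕ} {I : ℕ → NonemptyInterval ℝ} {z : ℕ} {s₀ : State}

theorem Scene.reaches (h : Scene X V I S z s₀) {e : ℕ} (he : e ∈ nodes s₀) :
    s₀.kmem kKEY (s₀.mem aLN z) ≤ s₀.kmem kRK e ↔
      lpos s₀ z < rpos s₀ (s₀.mem aOWN e) := by
  obtain ⟨ho, he'⟩ := h.store.own e he
  have en := h.store.entry _ ho
  rw [h.store.lpos_lt_rpos h.mem ho, (h.store.entry z h.mem).key_left]
  rcases he' with he' | he'
  · rw [← en.rk_left, ← he']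
  · rw [← en.rk_right, ← he']

/-- Intervals that do not reach the left endpoint of `z` are ignored at both ends. This is
essential: one of them may start before the walk does and end during it, and would be counted down
without having been counted up. -/
theorem Scene.run_event (h : Scene X V I S z s₀) {e : ℕ} (he : e ∈ nodes s₀) {s : State}
    (hs : SweepAt s₀ z (bef s₀ S z e) e s) :
    SweepAt s₀ z (aft s₀ S z (pos s₀.mem s₀.kmem e)) e (event.run s) := by
  have fr := Prog.framed_run (c := event) rfl s
  refine ⟨?_, ?_, ?_, ?_, ?_, ?_, ?_, ?_⟩
  · rw [fr.reg 3 (by decide), hs.zero]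
  · rw [fr.reg 4 (by decide), hs.one]
  · rw [fr.reg 42 (by decide), hs.left]
  · rw [fr.reg 43 (by decide), hs.right]
  · rw [fr.reg 45 (by decide), hs.cur]
  · intro a ha
    rw [fr.mem a (by simp [event, enter, leave, Prog.arrs, ha]), hs.mem a ha]
  · rw [fr.kmem_eq rfl, hs.kmem]
  obtain ⟨ho, he'⟩ := h.store.own e he
  have hown : s.mem aOWN (s.reg 45) = s₀.mem aOWN e := by rw [hs.mem _ (by norm_num), hs.cur]
  have hcrit : s.kmem kKEY (s.reg 42) ≤ s.kmem kRK (s.reg 45) ↔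
      lpos s₀ z < rpos s₀ (s₀.mem aOWN e) := by
    rw [hs.kmem, hs.left, hs.cur, h.reaches he]
  generalize hu : s₀.mem aOWN e = u at *
  have en := h.store.entry u ho
  have hty : s.mem aTY (s.reg 45) = s₀.mem aTY e := by rw [hs.mem _ (by norm_num), hs.cur]
  have hlev : s.mem 0 = s₀.mem 0 := hs.mem _ (by norm_num)
  have hpart : s.mem aST u ≠ 0 ↔ u ∈ S := by rw [hs.mem _ (by norm_num), h.part]
  -- the other intervals
  have other : ∀ w ∈ S, w ≠ u → (lpos s₀ w < pos s₀.mem s₀.kmem e ↔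
      lpos s₀ w ≤ pos s₀.mem s₀.kmem e) ∧ (pos s₀.mem s₀.kmem e ≤ rpos s₀ w ↔
      pos s₀.mem s₀.kmem e < rpos s₀ w) := by
    intro w hw hwu
    have hwn := h.store.entry w (h.sub hw)
    have h1 : lpos s₀ w ≠ pos s₀.mem s₀.kmem e := by
      intro heq
      have := pos_injective heq
      rw [← this, hwn.own_left] at hu
      exact hwu hu
    have h2 : pos s₀.mem s₀.kmem e ≠ rpos s₀ w := by
      intro heq
      have := pos_injective heq
      rw [this, hwn.own_right] at hu
      exact hwu hu
    exact ⟨⟨le_of_lt, fun h => lt_of_le_of_ne h h1⟩, ⟨fun h => lt_of_le_of_ne h h2, le_of_lt⟩⟩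
  have htal := hs.tally
  rw [← hlev] at htal ⊢
  by_cases hS : u ∈ S ∧ lpos s₀ z < rpos s₀ u
  · rcases he' with he' | he'
    · have hpe : pos s₀.mem s₀.kmem e = lpos s₀ u := by rw [he']; rfl
      have hlr : lpos s₀ u < rpos s₀ u := (h.store.lpos_lt_rpos ho ho).2 (I u).fst_le_snd
      have hset : aft s₀ S z (pos s₀.mem s₀.kmem e) = insert u (bef s₀ S z e) := by
        ext w
        by_cases hwu : w = u
        · subst hwu
          simp [aft, hS.1, hS.2, hpe, hlr]
        · by_cases hw : w ∈ S
          · simp [aft, bef, hwu, (other w hw hwu)]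
          · simp [aft, bef, hwu, hw]
      rw [hset]
      refine run_event_enter hs.zero hown (hpart.2 hS.1) (hcrit.2 hS.2) ?_ ?_ htal
      · rw [hty, he', en.ty_left]
      · simp [bef, hpe]
    · have hpe : pos s₀.mem s₀.kmem e = rpos s₀ u := by rw [he']; rfl
      have hlr : lpos s₀ u < rpos s₀ u := (h.store.lpos_lt_rpos ho ho).2 (I u).fst_le_snd
      have hset : aft s₀ S z (pos s₀.mem s₀.kmem e) = (bef s₀ S z e).erase u := by
        ext w
        by_cases hwu : w = u
        · subst hwu
          simp [aft, hpe]
        · by_cases hw : w ∈ S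
          · simp [aft, bef, hwu, (other w hw hwu)]
          · simp [aft, bef, hw]
      rw [hset]
      refine run_event_leave hs.zero hown (hpart.2 hS.1) (hcrit.2 hS.2) ?_ ?_ htal
      · rw [hty, he', en.ty_right]
      · simp [bef, hpe, hS.1, hS.2, hlr]
  · have hset : aft s₀ S z (pos s₀.mem s₀.kmem e) = bef s₀ S z e := by
      ext w
      by_cases hwu : w = u
      · subst hwu
        simp only [aft, bef, Finset.mem_filter]
        tauto
      · by_cases hw : w ∈ S
        · simp [aft, bef, (other w hw hwu)]
        · simp [aft, bef, hw]
    rw [hset]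
    obtain ⟨e1, e2⟩ := run_event_skip hs.zero (by
      rw [hown, hcrit]
      by_cases hu' : u ∈ S
      · exact .inr fun h => hS ⟨hu', h⟩
      · exact .inl (by_contra fun h => hu' (hpart.1 h)))
    exact ⟨by rw [e1]; exact htal.count, by
      rw [e1, e2, fr.reg 44 (by decide)]; exact htal.missing⟩

/-- Between a node and the next one there is no endpoint. -/
theorem Scene.lt_next (h : Scene X V I S z s₀) {e g f : ℕ} (he : e ∈ nodes s₀) (hg : g ∈ nodes s₀)
    (heg : pos s₀.mem s₀.kmem e < pos s₀.mem s₀.kmem g) (hf : f ∈ nodes s₀) :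
    pos s₀.mem s₀.kmem f < pos s₀.mem s₀.kmem (s₀.mem aNXT e) ↔
      pos s₀.mem s₀.kmem f ≤ pos s₀.mem s₀.kmem e := by
  obtain ⟨-, h2, -⟩ := h.store.next e g (.inr he) hg (.inr heg)
  have h2 := h2.resolve_left (nodes_ne_zero he)
  constructor
  · intro hlt
    by_contra! hcon
    obtain ⟨-, -, h3⟩ := h.store.next e f (.inr he) hf (.inr hcon)
    exact absurd hlt (not_lt.2 h3)
  · exact fun hle => hle.trans_lt h2

theorem Scene.bef_next (h : Scene X V I S z s₀) {e g : ℕ} (he : e ∈ nodes s₀) (hg : g ∈ nodes s₀)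
    (heg : pos s₀.mem s₀.kmem e < pos s₀.mem s₀.kmem g) :
    bef s₀ S z (s₀.mem aNXT e) = aft s₀ S z (pos s₀.mem s₀.kmem e) := by
  ext u
  simp only [bef, aft, Finset.mem_filter]
  refine and_congr_right fun hu => ?_
  have en := h.store.entry u (h.sub hu)
  have h1 := h.lt_next he hg heg en.left_mem
  have h2 := not_congr (h.lt_next he hg heg en.right_mem)
  rw [not_lt, not_le] at h2
  exact and_congr_right fun _ => and_congr h1 h2

/-- Coverage changes only at endpoints, so the positions from a node up to the next one are all
represented by that node. A sweep over nodes therefore decides statements about all points. -/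
theorem Scene.cov_between (h : Scene X V I S z s₀) {e g : ℕ} (he : e ∈ nodes s₀) (hg : g ∈ nodes s₀)
    (heg : pos s₀.mem s₀.kmem e < pos s₀.mem s₀.kmem g) {q : ℝ ×ₗ ℤ}
    (h1 : pos s₀.mem s₀.kmem e ≤ q) (h2 : q < pos s₀.mem s₀.kmem (s₀.mem aNXT e)) {u : ℕ}
    (hu : u ∈ S) :
    Cov (lpos s₀) (rpos s₀) u q ↔ Cov (lpos s₀) (rpos s₀) u (pos s₀.mem s₀.kmem e) := by
  have en := h.store.entry u (h.sub hu)
  have e1 := h.lt_next he hg heg en.left_mem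
  have e2 := h.lt_next he hg heg en.right_mem
  simp only [Cov, lpos, rpos]
  constructor
  · rintro ⟨c1, c2⟩
    exact ⟨e1.1 (c1.trans_lt h2), h1.trans_lt c2⟩
  · rintro ⟨c1, c2⟩
    refine ⟨c1.trans h1, ?_⟩
    by_contra! hcon
    exact absurd c2 (not_lt.2 (e2.1 (hcon.trans_lt h2)))

/-- To the right of the left endpoint of `z`, reaching it is implied by coverage, so the counted
intervals are exactly those at `q`. -/
theorem mem_aft {q : ℝ ×ₗ ℤ} (hq : lpos s₀ z ≤ q) {u : ℕ} :
    u ∈ aft s₀ S z q ↔ u ∈ S ∧ Cov (lpos s₀) (rpos s₀) u q := by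
  simp only [aft, Finset.mem_filter, Cov]
  refine and_congr_right fun _ => ⟨fun h => h.2, fun h => ⟨hq.trans_lt h.2, h⟩⟩

/-- The endpoint of `z` itself changes nothing because `z` does not belong to `S`; hence no event
has to be processed there. -/
theorem Scene.bef_left (h : Scene X V I S z s₀) :
    bef s₀ S z (s₀.mem aLN z) = aft s₀ S z (lpos s₀ z) := by
  ext u
  simp only [bef, aft, Finset.mem_filter]
  refine and_congr_right fun hu => ?_
  have hne : lpos s₀ u ≠ lpos s₀ z := fun he =>
    h.notMem (h.store.lpos_injective (h.sub hu) h.mem he ▸ hu)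
  have hne' := h.store.lpos_ne_rpos h.mem (h.sub hu)
  change _ ∧ lpos s₀ u < lpos s₀ z ∧ lpos s₀ z ≤ _ ↔ _
  refine and_congr_right fun _ => and_congr ⟨le_of_lt, fun h => lt_of_le_of_ne h hne⟩
    ⟨fun h => lt_of_le_of_ne h hne', le_of_lt⟩

theorem SweepAt.set {A : Finset ℕ} {e : ℕ} {s : State} (h : SweepAt s₀ z A e s) {x : ℕ} (k : ℕ)
    (h3 : 3 ≠ x) (h4 : 4 ≠ x) (h42 : 42 ≠ x) (h43 : 43 ≠ x) (h44 : 44 ≠ x) (h45 : 45 ≠ x)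
    (h46 : 46 ≠ x) : SweepAt s₀ z A e (s.set x k) := by
  obtain ⟨a1, a2, a3, a4, a5, a6, a7, a8, a9⟩ := h
  refine ⟨?_, ?_, ?_, ?_, ?_, a6, a7, a8, ?_⟩
  · rwa [State.set_reg, if_neg h3]
  · rwa [State.set_reg, if_neg h4]
  · rwa [State.set_reg, if_neg h42]
  · rwa [State.set_reg, if_neg h43]
  · rwa [State.set_reg, if_neg h45]
  · rwa [State.set_reg, if_neg h46, State.set_reg, if_neg h44]

theorem SweepAt.set_cur {A : Finset ℕ} {e : ℕ} {s : State} (h : SweepAt s₀ z A e s) (k : ℕ) :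
    SweepAt s₀ z A k (s.set 45 k) := by
  obtain ⟨a1, a2, a3, a4, a5, a6, a7, a8, a9⟩ := h
  refine ⟨?_, ?_, ?_, ?_, by simp [State.set_reg], a6, a7, a8, ?_⟩
  · rwa [State.set_reg, if_neg (by norm_num)]
  · rwa [State.set_reg, if_neg (by norm_num)]
  · rwa [State.set_reg, if_neg (by norm_num)]
  · rwa [State.set_reg, if_neg (by norm_num)]
  · rwa [State.set_reg, if_neg (by norm_num), State.set_reg, if_neg (by norm_num)]

/-- The first part of a sweep: up to the left endpoint. -/
theorem Scene.runs_approach (h : Scene X V I S z s₀) {w : ℕ} (hw : w ∈ nodes s₀)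
    (hwz : pos s₀.mem s₀.kmem w ≤ lpos s₀ z) {s : State} (hs : SweepAt s₀ z (bef s₀ S z w) w s) :
    Runs (walk 42 event) s fun s' m =>
      SweepAt s₀ z (aft s₀ S z (lpos s₀ z)) (s₀.mem aLN z) s' ∧
      m ≤ 25 * (between s₀ w (s₀.mem aRN z)).card + 4 := by
  have en := h.store.entry z h.mem
  refine (runs_walk h.store.next (by norm_num) en.left_mem (k := 20)
    (fun v e s => v = 0 ∧ SweepAt s₀ z (bef s₀ S z e) e s) ?_ ?_ ?_ hw hwz (v := 0)
    ⟨rfl, hs⟩).mono ?_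
  · rintro v e s ⟨-, h⟩
    exact ⟨h.one, h.cur, h.left⟩
  · rintro v e s k ⟨hv, h⟩
    exact ⟨hv, h.set k (by norm_num) (by norm_num) (by norm_num) (by norm_num) (by norm_num)
      (by norm_num) (by norm_num)⟩
  · rintro v e s he hlt ⟨rfl, hs⟩
    refine Runs.block rfl fun n hn => ?_
    have := h.run_event he hs
    refine ⟨this.mem _ (by norm_num), this.cur, 0, ⟨rfl, ?_⟩, ?_⟩
    · rw [h.bef_next he en.left_mem hlt]
      exact this.set_cur _
    · have : event.cost ≤ 20 := by decide
      omega
  · rintro s' m ⟨⟨v, -, hs'⟩, hm⟩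
    rw [h.bef_left] at hs'
    refine ⟨hs', ?_⟩
    have : (between s₀ w (s₀.mem aLN z)).card ≤ (between s₀ w (s₀.mem aRN z)).card := by
      refine Finset.card_le_card fun g hg => ?_
      simp only [between, Finset.mem_filter] at hg ⊢
      refine ⟨hg.1, hg.2.1, hg.2.2.trans ?_⟩
      exact (h.store.lpos_lt_rpos h.mem h.mem).2 (I z).fst_le_snd
    omega

end DynInterval

end

/-! ### Sweeps that find the highest level and test goodness. -/

noncomputable section

namespace DynInterval

variable {X V S : Finset ℕ} {I : ℕ → NonemptyInterval ℝ} {z : ℕ} {s₀ : State}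

/-- Execute `c` at the left endpoint of an interval and at every later node up to its right
endpoint. -/
def traverse (c : Prog) : Prog := c ;; load 45 aNXT 45 ;; walk 43 (event ;; c)

/-- `K v p b f` says that the positions from the left endpoint of `z` to `p`, exclusively, have been
treated, that the registers `44` and `53` hold `b` and `f`, and that the potential is `v`. -/
theorem Scene.runs_traverse (h : Scene X V I S z s₀) {c : Prog} {k : ℕ}
    (K : ℕ → ℝ ×ₗ ℤ → ℕ → ℕ → Prop)
    (hc : ∀ v e s, e ∈ nodes s₀ → lpos s₀ z ≤ pos s₀.mem s₀.kmem e →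
      pos s₀.mem s₀.kmem e < rpos s₀ z → SweepAt s₀ z (aft s₀ S z (pos s₀.mem s₀.kmem e)) e s →
      K v (pos s₀.mem s₀.kmem e) (s.reg 44) (s.reg 53) →
      Runs c s fun s' m => SweepAt s₀ z (aft s₀ S z (pos s₀.mem s₀.kmem e)) e s' ∧
        ∃ v', m + v' ≤ k + v ∧ ∀ p, pos s₀.mem s₀.kmem e < p →
          (∀ q, pos s₀.mem s₀.kmem e ≤ q → q < p → ∀ u ∈ S,
          (Cov (lpos s₀) (rpos s₀) u q ↔ Cov (lpos s₀) (rpos s₀) u (pos s₀.mem s₀.kmem e))) →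
          K v' p (s'.reg 44) (s'.reg 53))
    {s : State} {v : ℕ} (hs : SweepAt s₀ z (aft s₀ S z (lpos s₀ z)) (s₀.mem aLN z) s)
    (hK : K v (lpos s₀ z) (s.reg 44) (s.reg 53)) {w : ℕ}
    (hwz : pos s₀.mem s₀.kmem w ≤ lpos s₀ z) :
    Runs (traverse c) s fun s' m =>
      SweepAt s₀ z (bef s₀ S z (s₀.mem aRN z)) (s₀.mem aRN z) s' ∧
      (∃ v', K v' (rpos s₀ z) (s'.reg 44) (s'.reg 53)) ∧
      m ≤ v + (k + 25) * (between s₀ w (s₀.mem aRN z)).card + k + 5 := by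
  have en := h.store.entry z h.mem
  have hzz : lpos s₀ z < rpos s₀ z := (h.store.lpos_lt_rpos h.mem h.mem).2 (I z).fst_le_snd
  -- one application of `c`
  have one : ∀ v e s, e ∈ nodes s₀ → lpos s₀ z ≤ pos s₀.mem s₀.kmem e →
      pos s₀.mem s₀.kmem e < rpos s₀ z → SweepAt s₀ z (aft s₀ S z (pos s₀.mem s₀.kmem e)) e s →
      K v (pos s₀.mem s₀.kmem e) (s.reg 44) (s.reg 53) →
      Runs c s fun s' m => s'.mem aNXT = s₀.mem aNXT ∧ s'.reg 45 = e ∧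
        ∃ v', m + v' ≤ k + v ∧ K v' (pos s₀.mem s₀.kmem (s₀.mem aNXT e)) (s'.reg 44) (s'.reg 53) ∧
        SweepAt s₀ z (bef s₀ S z (s₀.mem aNXT e)) (s₀.mem aNXT e) (s'.set 45 (s₀.mem aNXT e)) := by
    intro v e s he h1 h2 hs hK
    refine (hc v e s he h1 h2 hs hK).mono ?_
    rintro s' m ⟨hs', v', hv', hK'⟩
    refine ⟨hs'.mem _ (by norm_num), hs'.cur, v', hv', hK' _ ?_ ?_, ?_⟩
    · obtain ⟨-, y2, -⟩ := h.store.next _ _ (.inr he) en.right_mem (.inr h2)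
      exact y2.resolve_left (nodes_ne_zero he)
    · intro q hq hq' u hu
      exact h.cov_between he en.right_mem h2 hq hq' hu
    · rw [h.bef_next he en.right_mem h2]
      exact hs'.set_cur _
  refine Runs.seq ((one v _ s en.left_mem le_rfl hzz hs hK).mono ?_)
  rintro s1 m1 ⟨n1, c1, v1, hm1, hK1, hs1⟩
  refine Runs.seq (Runs.block rfl fun m2 hm2 => ?_)
  simp only [Prog.cost] at hm2
  have heq : Prog.run (load 45 aNXT 45) s1 = s1.set 45 (s₀.mem aNXT (s₀.mem aLN z)) := by
    simp [Prog.run, Instr.apply, State.set, n1, c1]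
  rw [heq]
  obtain ⟨x1, x2, x3⟩ := h.store.next _ _ (.inr en.left_mem) en.right_mem (.inr hzz)
  have x2 := x2.resolve_left (nodes_ne_zero en.left_mem)
  refine (runs_walk h.store.next (by norm_num) en.right_mem (k := k + 20)
    (fun v e s => lpos s₀ z ≤ pos s₀.mem s₀.kmem e ∧ SweepAt s₀ z (bef s₀ S z e) e s ∧
      K v (pos s₀.mem s₀.kmem e) (s.reg 44) (s.reg 53)) ?_ ?_ ?_ x1 x3 (v := v1)
    ⟨x2.le, hs1, ?_⟩).mono ?_
  · rintro v e s ⟨-, h, -⟩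
    exact ⟨h.one, h.cur, h.right⟩
  · rintro v e s k ⟨hv, h, hk⟩
    refine ⟨hv, h.set k (by norm_num) (by norm_num) (by norm_num) (by norm_num) (by norm_num)
      (by norm_num) (by norm_num), ?_⟩
    simpa [State.set_reg] using hk
  · rintro v e s he hlt ⟨h1, hs, hk⟩
    refine Runs.seq (Runs.block rfl fun n hn => ?_)
    have fr := Prog.framed_run (c := event) rfl s
    have hcost : event.cost ≤ 20 := by decide
    have := one v e _ he h1 hlt (h.run_event he hs)
      (by rw [fr.reg 44 (by decide), fr.reg 53 (by decide)]; exact hk)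
    refine this.mono ?_
    rintro s' m ⟨n1, c1, v', hm, hk', hs'⟩
    refine ⟨n1, c1, v', ⟨?_, hs', ?_⟩, by omega⟩
    · obtain ⟨-, y2, -⟩ := h.store.next _ _ (.inr he) en.right_mem (.inr hlt)
      exact h1.trans (y2.resolve_left (nodes_ne_zero he)).le
    · simpa [State.set_reg] using hk'
  · simpa [State.set_reg] using hK1
  · rintro s' m ⟨⟨v', -, hs', hk'⟩, hm⟩
    refine ⟨hs', ⟨v', hk'⟩, ?_⟩
    -- The cost is measured by the longer stretch from `w`, which also bounds the approach and the
    -- cleaning walk.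
    have : (between s₀ (s₀.mem aNXT (s₀.mem aLN z)) (s₀.mem aRN z)).card ≤
        (between s₀ w (s₀.mem aRN z)).card := by
      refine Finset.card_le_card fun g hg => ?_
      simp only [between, Finset.mem_filter] at hg ⊢
      exact ⟨hg.1, (hwz.trans x2.le).trans hg.2.1, hg.2.2⟩
    have := Nat.mul_le_mul_left (k + 25) this
    have e1 : k + 20 + 5 = k + 25 := by ring
    rw [e1] at hm
    omega

/-! ### Finding the level of an interval -/

theorem Tally.count_ne_zero {A : Finset ℕ} {lev : ℕ → ℕ} {s : State} (h : Tally A lev s) {i : ℕ} :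
    s.mem aCNT i ≠ 0 ↔ ∃ u ∈ A, lev u = i := by
  rw [h.count, Finset.card_ne_zero, Finset.filter_nonempty_iff]

theorem Tally.missing_eq_zero {A : Finset ℕ} {lev : ℕ → ℕ} {s : State} (h : Tally A lev s) :
    s.reg 46 = 0 ↔ ∀ i < s.reg 44, ∃ u ∈ A, lev u = i := by
  rw [h.missing, Finset.card_eq_zero, Finset.filter_eq_empty_iff]
  simp only [Finset.mem_range]
  exact forall₂_congr fun i _ => h.count_ne_zero

/-- Set register `54` if all levels up to that in register `44` occur. -/
def probe : Prog :=
  load 60 aCNT 44 ;; const 54 0 ;; .ite (.eq 46 3) (.ite (.eq 60 3) nop (const 54 1)) nop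

/-- Raise the level in register `44` as long as all levels up to it occur. -/
def bump : Prog := probe ;; .loop (.eq 54 4) (inc 44 ;; probe)

theorem run_probe {A : Finset ℕ} {lev : ℕ → ℕ} {s : State} (h0 : s.reg 3 = 0) (h : Tally A lev s) :
    ((probe.run s).reg 54 = 1 ∧ s.reg 46 = 0 ∧ ∀ i < s.reg 44 + 1, ∃ u ∈ A, lev u = i) ∨
    ((probe.run s).reg 54 = 0 ∧ ¬ ∀ i < s.reg 44 + 1, ∃ u ∈ A, lev u = i) := by
  have hsplit : (∀ i < s.reg 44 + 1, ∃ u ∈ A, lev u = i) ↔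
      s.reg 46 = 0 ∧ s.mem aCNT (s.reg 44) ≠ 0 := by
    rw [h.missing_eq_zero, h.count_ne_zero]
    constructor
    · exact fun h => ⟨fun i hi => h i (by omega), h _ (by omega)⟩
    · rintro ⟨h1, h2⟩ i hi
      rcases Nat.lt_succ_iff_lt_or_eq.1 hi with hi | rfl
      exacts [h1 i hi, h2]
  rw [hsplit]
  by_cases c1 : s.reg 46 = 0 <;> by_cases c2 : s.mem aCNT (s.reg 44) = 0 <;>
    simp [probe, Prog.run, Test.Holds, Instr.apply, h0, c1, c2]

theorem SweepAt.framed {A : Finset ℕ} {e : ℕ} {s s' : State} {c : Prog} (h : SweepAt s₀ z A e s)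
    (fr : Framed c s s') (hr : ∀ x ∈ [3, 4, 42, 43, 44, 45, 46], x ∉ c.regs) (ha : c.arrs = [])
    (hk : c.karrs = []) : SweepAt s₀ z A e s' := by
  obtain ⟨a1, a2, a3, a4, a5, a6, a7, a8, a9⟩ := h
  have hm := fr.mem_eq ha
  refine ⟨?_, ?_, ?_, ?_, ?_, ?_, ?_, ?_, ?_⟩
  · rwa [fr.reg _ (hr 3 (by simp))]
  · rwa [fr.reg _ (hr 4 (by simp))]
  · rwa [fr.reg _ (hr 42 (by simp))]
  · rwa [fr.reg _ (hr 43 (by simp))]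
  · rwa [fr.reg _ (hr 45 (by simp))]
  · rwa [hm]
  · rwa [fr.kmem_eq hk]
  · rwa [hm]
  · rwa [fr.reg _ (hr 44 (by simp)), fr.reg _ (hr 46 (by simp)), hm]

/-- The last clause is amortized: the raises are paid for by the drop of `8 * (D - level)`, so over
a whole sweep they cost O(D) although a single node may cause many. -/
theorem runs_bump {A : Finset ℕ} {e : ℕ} {s : State} (hs : SweepAt s₀ z A e s) {D : ℕ}
    (hD : A.card ≤ D) :
    Runs bump s fun s' m => SweepAt s₀ z A e s' ∧ s.reg 44 ≤ s'.reg 44 ∧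
      (s'.reg 44 = s.reg 44 ∨ ∀ i < s'.reg 44, ∃ u ∈ A, s₀.mem 0 u = i) ∧
      (¬ ∀ i < s'.reg 44 + 1, ∃ u ∈ A, s₀.mem 0 u = i) ∧
      m + 8 * (D - s'.reg 44) ≤ 8 * (D - s.reg 44) + 7 := by
  have hpc : probe.cost ≤ 5 := by decide
  have hp44 : ∀ s, (probe.run s).reg 44 = s.reg 44 := fun s =>
    (Prog.framed_run (c := probe) rfl s).reg 44 (by decide)
  have hsw : ∀ s, SweepAt s₀ z A e s → SweepAt s₀ z A e (probe.run s) := fun s hs =>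
    hs.framed (Prog.framed_run (c := probe) rfl s) (by decide) rfl rfl
  refine Runs.seq (Runs.block rfl fun m1 hm1 => ?_)
  have key := Runs.loop_potential (b := .eq 54 4) (c := inc 44 ;; probe)
    (fun v t => v = 8 * (D - t.reg 44) ∧ SweepAt s₀ z A e t ∧ s.reg 44 ≤ t.reg 44 ∧
      (t.reg 44 = s.reg 44 ∨ ∀ i < t.reg 44, ∃ u ∈ A, s₀.mem 0 u = i) ∧
      ((t.reg 54 = 1 ∧ t.reg 46 = 0 ∧ ∀ i < t.reg 44 + 1, ∃ u ∈ A, s₀.mem 0 u = i) ∨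
        (t.reg 54 = 0 ∧ ¬ ∀ i < t.reg 44 + 1, ∃ u ∈ A, s₀.mem 0 u = i)))
    (by
      rintro v t ⟨rfl, hs, hle, -, ho⟩ hb
      simp only [Test.Holds, hs.one] at hb
      rcases ho with ⟨-, h46, hocc⟩ | ⟨h, -⟩
      swap
      · omega
      refine Runs.block rfl fun m hm => ?_
      simp only [Prog.cost] at hm
      rw [run_seq]
      -- The levels up to the current one all occur in `A`, so there are at most as many as
      -- intervals in `A`; the potential really drops with the next raise.
      have hcard : t.reg 44 + 1 ≤ D := by
        refine le_trans ?_ hD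
        have : Finset.range (t.reg 44 + 1) ⊆ A.image (s₀.mem 0) := fun i hi => by
          obtain ⟨u, hu, h⟩ := hocc i (Finset.mem_range.1 hi)
          exact Finset.mem_image.2 ⟨u, hu, h⟩
        have := (Finset.card_le_card this).trans Finset.card_image_le
        simpa using this
      have hinc : Prog.run (inc 44) t = t.set 44 (t.reg 44 + 1) := rfl
      rw [hinc]
      generalize ht' : t.set 44 (t.reg 44 + 1) = t'
      have r44 : t'.reg 44 = t.reg 44 + 1 := by rw [← ht']; simp [State.set_reg]
      have hs' : SweepAt s₀ z A e t' := by
        obtain ⟨a1, a2, a3, a4, a5, a6, a7, a8⟩ := hs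
        subst ht'
        refine ⟨?_, ?_, ?_, ?_, ?_, a6, a7, a8.count, ?_⟩
        iterate 5 rwa [State.set_reg, if_neg (by norm_num)]
        rw [r44, State.set_reg, if_neg (by norm_num), h46, eq_comm, Finset.card_eq_zero,
          Finset.filter_eq_empty_iff]
        intro i hi
        exact a8.count_ne_zero.2 (hocc i (Finset.mem_range.1 hi))
      have := run_probe hs'.zero hs'.tally
      refine ⟨8 * (D - (probe.run t').reg 44), ⟨rfl, hsw _ hs', ?_, .inr ?_, ?_⟩, ?_⟩
      · rw [hp44]; omega
      · rw [hp44, r44]; exact hocc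
      · rw [hp44, (Prog.framed_run (c := probe) rfl t').reg 46 (by decide)]
        exact this
      · rw [hp44, r44]; omega)
    (v := 8 * (D - (probe.run s).reg 44)) (s := probe.run s) ⟨rfl, hsw s hs, (hp44 s).ge,
      .inl (hp44 s), by
      rw [hp44, (Prog.framed_run (c := probe) rfl s).reg 46 (by decide)]
      exact run_probe hs.zero hs.tally⟩
  refine key.mono ?_
  rintro s' m ⟨⟨v', ⟨rfl, h1, h2, h3, h4⟩, hm⟩, hb⟩
  rw [hp44] at hm
  refine ⟨h1, h2, h3, ?_, by omega⟩
  rcases h4 with ⟨h, -⟩ | ⟨-, h⟩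
  · exact absurd (by simp [Test.Holds, h, h1.one]) hb
  · exact h

theorem Full.anti {P : Type*} [LinearOrder P] {L R : ℕ → P} {lev : ℕ → ℕ} {p : P} {b c : ℕ}
    (h : Full L R lev S p c) (hbc : b ≤ c) : Full L R lev S p b := fun i hi => h i (hi.trans_le hbc)

theorem full_iff {q : ℝ ×ₗ ℤ} (hq : lpos s₀ z ≤ q) {b : ℕ} :
    Full (lpos s₀) (rpos s₀) (s₀.mem 0) S q b ↔
      ∀ i < b, ∃ u ∈ aft s₀ S z q, s₀.mem 0 u = i := by
  refine forall₂_congr fun i _ => exists_congr fun u => ?_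
  rw [mem_aft hq]
  tauto

theorem full_congr {P : Type*} [LinearOrder P] {L R : ℕ → P} {lev : ℕ → ℕ} {p q : P}
    (h : ∀ u ∈ S, (Cov L R u q ↔ Cov L R u p)) {b : ℕ} :
    Full L R lev S q b ↔ Full L R lev S p b := by
  refine forall₂_congr fun i _ => exists_congr fun u => and_congr_right fun hu => ?_
  rw [h u hu]

/-- Active intervals have distinct left endpoints on the stretch of the walk. So the length of the
walk bounds every level that can be reached. -/
theorem Scene.card_aft_le (h : Scene X V I S z s₀) {w : ℕ}
    (hw : ∀ u ∈ S, lpos s₀ z < rpos s₀ u → pos s₀.mem s₀.kmem w ≤ lpos s₀ u) {q : ℝ ×ₗ ℤ}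
    (hq : q < rpos s₀ z) :
    (aft s₀ S z q).card ≤ (between s₀ w (s₀.mem aRN z)).card := by
  refine Finset.card_le_card_of_injOn (s₀.mem aLN) ?_ ?_
  · intro u hu
    simp only [aft, Finset.coe_filter, Set.mem_ofPred_eq] at hu
    simp only [between, Finset.coe_filter, Set.mem_ofPred_eq]
    exact ⟨(h.store.entry u (h.sub hu.1)).left_mem, hw u hu.1 hu.2.1, hu.2.2.1.trans_lt hq⟩
  · intro u hu t ht he
    simp only [aft, Finset.coe_filter, Set.mem_ofPred_eq] at hu ht
    refine h.store.lpos_injective (h.sub hu.1) (h.sub ht.1) ?_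
    rw [lpos, lpos, he]

/-- The level only grows during the sweep. Whenever it is raised, the current node is a point at
which all lower levels occur; and no swept position ever has all levels up to the current one. At
the right end this is the maximal level of `z`. -/
theorem Scene.runs_level (h : Scene X V I S z s₀) {w : ℕ} (hwz : pos s₀.mem s₀.kmem w ≤ lpos s₀ z)
    (hw : ∀ u ∈ S, lpos s₀ z < rpos s₀ u → pos s₀.mem s₀.kmem w ≤ lpos s₀ u) {s : State}
    (hs : SweepAt s₀ z (aft s₀ S z (lpos s₀ z)) (s₀.mem aLN z) s) (hb : s.reg 44 = 0) :
    Runs (traverse bump) s fun s' m =>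
      SweepAt s₀ z (bef s₀ S z (s₀.mem aRN z)) (s₀.mem aRN z) s' ∧
      (∃ q, Cov (lpos s₀) (rpos s₀) z q ∧
        Full (lpos s₀) (rpos s₀) (s₀.mem 0) S q (s'.reg 44)) ∧
      (∀ q, Cov (lpos s₀) (rpos s₀) z q →
        ¬ Full (lpos s₀) (rpos s₀) (s₀.mem 0) S q (s'.reg 44 + 1)) ∧
      m ≤ 40 * (between s₀ w (s₀.mem aRN z)).card + 12 := by
  have hzz : lpos s₀ z < rpos s₀ z := (h.store.lpos_lt_rpos h.mem h.mem).2 (I z).fst_le_snd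
  set D := (between s₀ w (s₀.mem aRN z)).card with hD
  refine (h.runs_traverse (c := bump) (k := 7)
    (fun v p b _ => v = 8 * (D - b) ∧ (∃ q, Cov (lpos s₀) (rpos s₀) z q ∧
        Full (lpos s₀) (rpos s₀) (s₀.mem 0) S q b) ∧
      (∀ q, lpos s₀ z ≤ q → q < p → ¬ Full (lpos s₀) (rpos s₀) (s₀.mem 0) S q (b + 1)))
    ?_ hs (v := 8 * (D - 0)) ⟨by rw [hb], ?_, ?_⟩ hwz).mono ?_
  · rintro v e s he h1 h2 hs ⟨rfl, hq, hno⟩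
    refine (runs_bump hs (h.card_aft_le hw h2)).mono ?_
    rintro s' m ⟨hs', hle, hor, hnot, hm⟩
    refine ⟨hs', _, ?_, fun p _ hp => ⟨rfl, ?_, ?_⟩⟩
    · omega
    · rcases hor with hor | hor
      · rwa [hor]
      · exact ⟨_, ⟨h1, h2⟩, (full_iff h1).2 hor⟩
    · intro q hq1 hq2 hf
      rcases lt_or_ge q (pos s₀.mem s₀.kmem e) with hlt | hge
      · exact hno q hq1 hlt (hf.anti (by omega))
      · rw [full_congr (hp q hge hq2), full_iff h1] at hf
        exact hnot hf
  · exact ⟨_, ⟨le_rfl, hzz⟩, by rw [hb]; exact fun i hi => absurd hi (by omega)⟩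
  · exact fun q h1 h2 => absurd h1 (not_le.2 h2)
  · rintro s' m ⟨hs', ⟨v', -, h1, h2⟩, hm⟩
    exact ⟨hs', h1, fun q hq => h2 q hq.1 hq.2, by omega⟩

/-! ### Testing whether an interval is on the right level -/

/-- Set register `53` if all levels below that in register `44` occur, but this level does not. -/
def probeGood : Prog :=
  load 60 aCNT 44 ;; .ite (.eq 46 3) (.ite (.eq 60 3) (const 53 1) nop) nop

theorem run_probeGood {A : Finset ℕ} {lev : ℕ → ℕ} {s : State} (h0 : s.reg 3 = 0)
    (h : Tally A lev s) : (probeGood.run s).reg 53 ≠ 0 ↔ s.reg 53 ≠ 0 ∨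
      ((∀ i < s.reg 44, ∃ u ∈ A, lev u = i) ∧ ∀ u ∈ A, lev u ≠ s.reg 44) := by
  have h1 := h.missing_eq_zero
  have h2 := not_congr (h.count_ne_zero (i := s.reg 44))
  push Not at h2
  rw [← h1, ← h2]
  by_cases c1 : s.reg 46 = 0 <;> by_cases c2 : s.mem aCNT (s.reg 44) = 0 <;>
    simp [probeGood, Prog.run, Test.Holds, Instr.apply, h0, c1, c2]

/-- Since `z` is not in `S`, being alone on its level at a point means that no interval of `S` has
this level there; this is what the counters show. The flag is never cleared, so it records whether
some position succeeded. -/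
theorem Scene.runs_good (h : Scene X V I S z s₀) {w : ℕ} (hwz : pos s₀.mem s₀.kmem w ≤ lpos s₀ z)
    {s : State} (hs : SweepAt s₀ z (aft s₀ S z (lpos s₀ z)) (s₀.mem aLN z) s)
    (hb : s.reg 44 = s₀.mem 0 z) (hf : s.reg 53 = 0) :
    Runs (traverse probeGood) s fun s' m =>
      SweepAt s₀ z (bef s₀ S z (s₀.mem aRN z)) (s₀.mem aRN z) s' ∧
      (s'.reg 53 ≠ 0 ↔ Good (lpos s₀) (rpos s₀) (s₀.mem 0) (insert z S) z) ∧
      m ≤ 40 * (between s₀ w (s₀.mem aRN z)).card + 12 := by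
  have hcost : probeGood.cost ≤ 5 := by decide
  refine (h.runs_traverse (c := probeGood) (k := 5)
    (fun v p b f => v = 0 ∧ b = s₀.mem 0 z ∧ (f ≠ 0 ↔ ∃ q, lpos s₀ z ≤ q ∧ q < p ∧ q < rpos s₀ z ∧
      Full (lpos s₀) (rpos s₀) (s₀.mem 0) S q b ∧ ∀ u ∈ S, s₀.mem 0 u = b →
        ¬ Cov (lpos s₀) (rpos s₀) u q))
    ?_ hs (v := 0) ⟨rfl, hb, ?_⟩ hwz).mono ?_
  · rintro v e s he h1 h2 hs ⟨rfl, hb, hq⟩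
    refine Runs.block rfl fun m hm => ?_
    have fr := Prog.framed_run (c := probeGood) rfl s
    refine ⟨hs.framed fr (by decide) rfl rfl, 0, by omega, fun p hep hp => ⟨rfl, ?_, ?_⟩⟩
    · rw [fr.reg 44 (by decide), hb]
    rw [run_probeGood hs.zero hs.tally, hq, fr.reg 44 (by decide), ← full_iff h1]
    have hcov : ∀ q, pos s₀.mem s₀.kmem e ≤ q → q < p →
        ((Full (lpos s₀) (rpos s₀) (s₀.mem 0) S q (s.reg 44) ∧ ∀ u ∈ S, s₀.mem 0 u = s.reg 44 →
          ¬ Cov (lpos s₀) (rpos s₀) u q) ↔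
        (Full (lpos s₀) (rpos s₀) (s₀.mem 0) S (pos s₀.mem s₀.kmem e) (s.reg 44) ∧
          ∀ u ∈ aft s₀ S z (pos s₀.mem s₀.kmem e), s₀.mem 0 u ≠ s.reg 44)) := by
      intro q hq1 hq2
      rw [full_congr (hp q hq1 hq2)]
      refine and_congr_right fun _ => ?_
      constructor
      · intro hall u hu hl
        obtain ⟨hu, hc⟩ := (mem_aft h1).1 hu
        exact hall u hu hl ((hp q hq1 hq2 u hu).2 hc)
      · intro hall u hu hl hc
        exact hall u ((mem_aft h1).2 ⟨hu, (hp q hq1 hq2 u hu).1 hc⟩) hl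
    constructor
    · rintro (⟨q, a1, a2, a3, a4⟩ | hnew)
      · exact ⟨q, a1, a2.trans hep, a3, a4⟩
      · exact ⟨_, h1, hep, h2, (hcov _ le_rfl hep).2 hnew⟩
    · rintro ⟨q, a1, a2, a3, a4⟩
      rcases lt_or_ge q (pos s₀.mem s₀.kmem e) with hlt | hge
      · exact .inl ⟨q, a1, hlt, a3, a4⟩
      · exact .inr ((hcov q hge a2).1 a4)
  · simp only [hf, ne_eq, not_true_eq_false, false_iff, not_exists, not_and]
    exact fun q h1 h2 => absurd h1 (not_le.2 h2)
  · rintro s' m ⟨hs', ⟨v', -, hb', hg⟩, hm⟩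
    refine ⟨hs', ?_, by omega⟩
    rw [hg, Good, Finset.erase_insert h.notMem, hb']
    constructor
    · rintro ⟨q, h1, -, h2, h3, h4⟩
      refine ⟨q, ⟨h1, h2⟩, h3, fun u hu hne => h4 u ?_⟩
      exact (Finset.mem_insert.1 hu).resolve_left hne
    · rintro ⟨q, ⟨h1, h2⟩, h3, h4⟩
      refine ⟨q, h1, h2, h2, h3, fun u hu => h4 u (Finset.mem_insert_of_mem hu) ?_⟩
      rintro rfl
      exact h.notMem hu

end DynInterval

end

/-! ### Resetting the counters, offsets of neighbours, start of a sweep. -/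

noncomputable section

namespace DynInterval

variable {X V S : Finset ℕ} {I : ℕ → NonemptyInterval ℝ} {z : ℕ} {s₀ : State}

/-! ### Clearing the counters and collecting the colors of the neighbours -/

/-- The offset `k` of the neighbours that is counted by register `47 + k`. -/
def cls (k : ℕ) : ℕ := if k = 0 then 0 else if k = 1 then 1 else 2

def noteColor : Prog :=
  load 63 1 60 ;; .ite (.eq 63 3) (const 47 1) (.ite (.eq 63 4) (const 48 1) (const 49 1))

def cleanStep : Prog :=
  load 60 aOWN 45 ;; load 62 0 60 ;; store aCNT 62 3 ;; load 61 aST 60 ;;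
    .ite (.eq 61 3) nop (kload 20 kKEY 42 ;; kload 21 kRK 45 ;;
      .ite (.kle 20 21) (.ite (.eq 62 44) noteColor nop) nop)

/-- Clear the counters, and collect the offsets of the neighbours on the level in
register `44`. -/
def cleanup : Prog := copy 45 51 ;; walk 43 cleanStep

theorem run_noteColor {s : State} (h0 : s.reg 3 = 0) (h1 : s.reg 4 = 1) {k : ℕ} (hk : k < 3) :
    (noteColor.run s).reg (47 + k) ≠ 0 ↔ s.reg (47 + k) ≠ 0 ∨ cls (s.mem 1 (s.reg 60)) = k := by
  by_cases c1 : s.mem 1 (s.reg 60) = 0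
  · interval_cases k <;> simp [noteColor, Prog.run, Test.Holds, Instr.apply, h0, c1, cls]
  by_cases c2 : s.mem 1 (s.reg 60) = 1
  · interval_cases k <;> simp [noteColor, Prog.run, Test.Holds, Instr.apply, h0, h1, c2, cls]
  · interval_cases k <;> simp [noteColor, Prog.run, Test.Holds, Instr.apply, h0, h1, c1, c2, cls]

theorem run_cleanStep {s : State} (h0 : s.reg 3 = 0) (h1 : s.reg 4 = 1) {u : ℕ}
    (hu : s.mem aOWN (s.reg 45) = u) :
    (cleanStep.run s).mem aCNT = Function.update (s.mem aCNT) (s.mem 0 u) 0 ∧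
    ∀ k < 3, (cleanStep.run s).reg (47 + k) ≠ 0 ↔ s.reg (47 + k) ≠ 0 ∨
      (s.mem aST u ≠ 0 ∧ s.kmem kKEY (s.reg 42) ≤ s.kmem kRK (s.reg 45) ∧
        s.mem 0 u = s.reg 44 ∧ cls (s.mem 1 u) = k) := by
  obtain ⟨s1, hs1⟩ : ∃ s1, Prog.run (load 60 aOWN 45 ;; load 62 0 60 ;; store aCNT 62 3 ;;
    load 61 aST 60) s = s1 := ⟨_, rfl⟩
  obtain ⟨s2, hs2⟩ : ∃ s2, Prog.run (kload 20 kKEY 42 ;; kload 21 kRK 45) s1 = s2 := ⟨_, rfl⟩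
  have q : s1.mem aCNT = Function.update (s.mem aCNT) (s.mem 0 u) 0 ∧
      (∀ k < 3, s1.reg (47 + k) = s.reg (47 + k)) := by
    refine ⟨by rw [← hs1]; simp [Prog.run, Instr.apply, h0, hu], fun k hk => ?_⟩
    interval_cases k <;> (rw [← hs1]; simp [Prog.run, Instr.apply])
  obtain ⟨q1, q2⟩ := q
  have r : s2.mem aCNT = s1.mem aCNT ∧ s2.reg = s1.reg ∧ s2.mem 1 = s.mem 1 ∧ s2.reg 60 = u ∧
      s2.reg 3 = 0 ∧ s2.reg 4 = 1 := by
    rw [← hs2, ← hs1]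
    simp [Prog.run, Instr.apply, h0, h1, hu]
  obtain ⟨r1, r2, r3, r4, r5, r6⟩ := r
  by_cases c1 : s.mem aST u = 0
  · have : cleanStep.run s = s1 := by
      rw [← hs1]
      simp [cleanStep, Prog.run, Test.Holds, Instr.apply, h0, hu, c1]
    rw [this]
    exact ⟨q1, fun k hk => by simp [q2 k hk, c1]⟩
  by_cases c2 : s.kmem kKEY (s.reg 42) ≤ s.kmem kRK (s.reg 45) ∧ s.mem 0 u = s.reg 44
  · have : cleanStep.run s = noteColor.run s2 := by
      rw [← hs2, ← hs1]
      simp [cleanStep, Prog.run, Test.Holds, Instr.apply, h0, hu, c1, c2]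
    rw [this, (Prog.framed_run (c := noteColor) rfl s2).mem_eq rfl, r1]
    refine ⟨q1, fun k hk => ?_⟩
    rw [run_noteColor r5 r6 hk, r2, q2 k hk, r3, ← r2, r4]
    simp [c1, c2]
  · have : cleanStep.run s = s2 := by
      rw [← hs2, ← hs1]
      by_cases c3 : s.kmem kKEY (s.reg 42) ≤ s.kmem kRK (s.reg 45)
      · have c4 : ¬ s.mem 0 u = s.reg 44 := fun h => c2 ⟨c3, h⟩
        simp [cleanStep, Prog.run, Test.Holds, Instr.apply, h0, hu, c1, c3, c4]
      · simp [cleanStep, Prog.run, Test.Holds, Instr.apply, h0, hu, c1, c3]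
    rw [this, r1, r2]
    refine ⟨q1, fun k hk => ?_⟩
    rw [q2 k hk]
    tauto

/-- The state while clearing the counters. -/
structure CleanAt (s₀ : State) (S : Finset ℕ) (z b e : ℕ) (s : State) : Prop where
  zero : s.reg 3 = 0
  one : s.reg 4 = 1
  left : s.reg 42 = s₀.mem aLN z
  right : s.reg 43 = s₀.mem aRN z
  level : s.reg 44 = b
  cur : s.reg 45 = e
  mem : ∀ a, a ≠ aCNT → s.mem a = s₀.mem a
  kmem : s.kmem = s₀.kmem
  count : ∀ i, s.mem aCNT i ≠ 0 → ∃ u ∈ S, lpos s₀ z < rpos s₀ u ∧ pos s₀.mem s₀.kmem e ≤ lpos s₀ u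
    ∧
    lpos s₀ u < rpos s₀ z ∧ s₀.mem 0 u = i
  flag : ∀ k < 3, s.reg (47 + k) ≠ 0 ↔ ∃ u ∈ S, lpos s₀ z < rpos s₀ u ∧
    lpos s₀ u < pos s₀.mem s₀.kmem e ∧ s₀.mem 0 u = b ∧ cls (s₀.mem 1 u) = k

/-- The invariant says that a nonzero counter is due to an interval whose left endpoint is still
ahead. Setting the counter of the current interval's level to zero preserves this, even when other
intervals share the level. -/
theorem Scene.run_cleanStep (h : Scene X V I S z s₀) {b e : ℕ} (he : e ∈ nodes s₀)
    (hez : pos s₀.mem s₀.kmem e < rpos s₀ z) {s : State} (hs : CleanAt s₀ S z b e s) :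
    CleanAt s₀ S z b (s₀.mem aNXT e) ((cleanStep.run s).set 45 (s₀.mem aNXT e)) := by
  have fr := Prog.framed_run (c := cleanStep) rfl s
  have hown : s.mem aOWN (s.reg 45) = s₀.mem aOWN e := by rw [hs.mem _ (by norm_num), hs.cur]
  obtain ⟨e1, e2⟩ := DynInterval.run_cleanStep hs.zero hs.one hown
  obtain ⟨ho, he'⟩ := h.store.own e he
  have hcrit : s.kmem kKEY (s.reg 42) ≤ s.kmem kRK (s.reg 45) ↔
      lpos s₀ z < rpos s₀ (s₀.mem aOWN e) := by
    rw [hs.kmem, hs.left, hs.cur, h.reaches he]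
  have right := (h.store.entry z h.mem).right_mem
  have hle : lpos s₀ (s₀.mem aOWN e) ≤ pos s₀.mem s₀.kmem e := by
    have hlr := (h.store.lpos_lt_rpos ho ho).2 (I (s₀.mem aOWN e)).fst_le_snd
    rcases he' with he' | he'
    · rw [lpos, ← he']
    · rw [rpos, ← he'] at hlr
      exact hlr.le
  have hnext : ∀ u ∈ S, (lpos s₀ u < pos s₀.mem s₀.kmem (s₀.mem aNXT e) ↔
      lpos s₀ u ≤ pos s₀.mem s₀.kmem e) := fun u hu =>
    h.lt_next he right hez (h.store.entry u (h.sub hu)).left_mem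
  have heq : ∀ u ∈ S, lpos s₀ u = pos s₀.mem s₀.kmem e → u = s₀.mem aOWN e := fun u hu heq => by
    have := pos_injective heq
    rw [← this, (h.store.entry u (h.sub hu)).own_left]
  refine ⟨?_, ?_, ?_, ?_, ?_, ?_, ?_, ?_, ?_, ?_⟩
  · rw [State.set_reg, if_neg (by norm_num), fr.reg 3 (by decide), hs.zero]
  · rw [State.set_reg, if_neg (by norm_num), fr.reg 4 (by decide), hs.one]
  · rw [State.set_reg, if_neg (by norm_num), fr.reg 42 (by decide), hs.left]
  · rw [State.set_reg, if_neg (by norm_num), fr.reg 43 (by decide), hs.right]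
  · rw [State.set_reg, if_neg (by norm_num), fr.reg 44 (by decide), hs.level]
  · simp [State.set_reg]
  · intro a ha
    rw [State.set_mem, fr.mem a (by simp [cleanStep, noteColor, Prog.arrs, ha]), hs.mem a ha]
  · rw [State.set_kmem, fr.kmem_eq rfl, hs.kmem]
  · intro i hi
    rw [State.set_mem, e1, Function.update_apply] at hi
    split_ifs at hi with hc
    · exact absurd rfl hi
    obtain ⟨u, hu, a1, a2, a3, a4⟩ := hs.count i hi
    refine ⟨u, hu, a1, ?_, a3, a4⟩
    by_contra! hcon
    have := heq u hu (le_antisymm ((hnext u hu).1 hcon) a2)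
    rw [← this, hs.mem _ (by norm_num)] at hc
    exact hc a4.symm
  · intro k hk
    rw [State.set_reg, if_neg (by omega), e2 k hk, hs.flag k hk, hcrit, hs.mem _ (by norm_num),
      h.part,
      hs.mem _ (by norm_num), hs.mem _ (by norm_num), hs.level]
    constructor
    · rintro (⟨u, hu, a1, a2, a3⟩ | ⟨a1, a2, a3⟩)
      · exact ⟨u, hu, a1, (hnext u hu).2 a2.le, a3⟩
      · exact ⟨_, a1, a2, (hnext _ a1).2 hle, a3⟩
    · rintro ⟨u, hu, a1, a2, a3⟩
      rcases ((hnext u hu).1 a2).lt_or_eq with hlt | heq'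
      · exact .inl ⟨u, hu, a1, hlt, a3⟩
      · rw [← heq u hu heq']
        exact .inr ⟨hu, a1, a3⟩

/-- Every interval that was counted starts on the stretch that is walked again, so clearing the
levels met there clears everything in time proportional to the walk. The same intervals include all
neighbours of `z`, which yields the offsets in use. -/
theorem Scene.runs_cleanup (h : Scene X V I S z s₀) {w : ℕ} (hwn : w ∈ nodes s₀)
    (hwz : pos s₀.mem s₀.kmem w ≤ lpos s₀ z)
    (hw : ∀ u ∈ S, lpos s₀ z < rpos s₀ u → pos s₀.mem s₀.kmem w ≤ lpos s₀ u) {s : State} {e : ℕ}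
    (hs : SweepAt s₀ z (bef s₀ S z (s₀.mem aRN z)) e s) (h51 : s.reg 51 = w)
    (hfl : ∀ k < 3, s.reg (47 + k) = 0) :
    Runs cleanup s fun s' m =>
      s'.mem = Function.update s₀.mem aCNT (fun _ => 0) ∧
      (∀ k < 3, s'.reg (47 + k) ≠ 0 ↔ ∃ u ∈ S, Meets (lpos s₀) (rpos s₀) u z ∧
        s₀.mem 0 u = s.reg 44 ∧ cls (s₀.mem 1 u) = k) ∧
      m ≤ 20 * (between s₀ w (s₀.mem aRN z)).card + 5 := by
  have en := h.store.entry z h.mem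
  have hzz : lpos s₀ z < rpos s₀ z := (h.store.lpos_lt_rpos h.mem h.mem).2 (I z).fst_le_snd
  refine Runs.seq (Runs.block rfl fun m1 hm1 => ?_)
  simp only [Prog.cost] at hm1
  have hc : Prog.run (copy 45 51) s = s.set 45 w := by
    simp [Prog.run, Instr.apply, State.set, h51]
  rw [hc]
  have hstep : cleanStep.cost ≤ 15 := by decide
  refine (runs_walk h.store.next (by norm_num) en.right_mem (k := 15)
    (fun v e t => v = 0 ∧ CleanAt s₀ S z (s.reg 44) e t) ?_ ?_ ?_ hwn (hwz.trans hzz.le) (v := 0)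
    ⟨rfl, ?_⟩).mono ?_
  · rintro v e t ⟨-, h⟩
    exact ⟨h.one, h.cur, h.right⟩
  · rintro v e t k ⟨hv, h⟩
    obtain ⟨a1, a2, a3, a4, a5, a6, a7, a8, a9, a10⟩ := h
    refine ⟨hv, ?_, ?_, ?_, ?_, ?_, ?_, a7, a8, a9, fun k hk => ?_⟩
    iterate 6 rwa [State.set_reg, if_neg (by norm_num)]
    rw [State.set_reg, if_neg (by omega), a10 k hk]
  · rintro v e t he hlt ⟨rfl, ht⟩
    refine Runs.block rfl fun n hn => ?_
    have fr := Prog.framed_run (c := cleanStep) rfl t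
    refine ⟨?_, ?_, 0, ⟨rfl, h.run_cleanStep he hlt ht⟩, by omega⟩
    · rw [fr.mem _ (by decide), ht.mem _ (by norm_num)]
    · rw [fr.reg _ (by decide), ht.cur]
  · have hs' := hs.set_cur w
    refine ⟨hs'.zero, hs'.one, hs'.left, hs'.right, by simp [State.set_reg], hs'.cur, hs'.mem,
      hs'.kmem, fun i hi => ?_, fun k hk => ?_⟩
    · obtain ⟨u, hu, hl⟩ := hs'.tally.count_ne_zero.1 hi
      simp only [bef, Finset.mem_filter] at hu
      exact ⟨u, hu.1, hu.2.1, hw u hu.1 hu.2.1, hu.2.2.1, hl⟩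
    · rw [State.set_reg, if_neg (by omega), hfl k hk]
      simp only [ne_eq, not_true_eq_false, false_iff, not_exists, not_and]
      exact fun u hu a1 a2 => absurd (hw u hu a1) (not_le.2 a2)
  · rintro s' m ⟨⟨v, -, ht⟩, hm⟩
    refine ⟨?_, fun k hk => ?_, by omega⟩
    · funext a
      by_cases ha : a = aCNT
      · subst ha
        funext i
        simp only [Function.update_self]
        by_contra hcon
        obtain ⟨u, hu, a1, a2, a3, a4⟩ := ht.count i hcon
        exact absurd a3 (not_lt.2 a2)
      · rw [Function.update_of_ne ha, ht.mem a ha]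
    · rw [ht.flag k hk]
      refine exists_congr fun u => and_congr_right fun _ => ?_
      simp only [Meets]
      change _ ∧ lpos s₀ u < rpos s₀ z ∧ _ ↔ _
      tauto

/-- The arrays of the stored intervals agree. -/
structure SameTables (s s' : State) : Prop where
  root : s'.reg 1 = s.reg 1
  size : s'.reg 2 = s.reg 2
  mem : ∀ a, 3 ≤ a → a ≤ 12 → s'.mem a = s.mem a
  kmem : s'.kmem = s.kmem

theorem SameTables.trans {s s' s'' : State} (h : SameTables s s') (h' : SameTables s' s'') :
    SameTables s s'' :=
  ⟨h'.root.trans h.root, h'.size.trans h.size, fun a h1 h2 => (h'.mem a h1 h2).trans (h.mem a h1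
    h2),
    h'.kmem.trans h.kmem⟩

theorem SameTables.pos_eq {s s' : State} (h : SameTables s s') :
    pos s'.mem s'.kmem = pos s.mem s.kmem := pos_congr (h.mem _ (by norm_num) (by norm_num)) h.kmem

theorem SameTables.lpos_eq {s s' : State} (h : SameTables s s') : lpos s' = lpos s := by
  funext t; rw [lpos, h.pos_eq, h.mem _ (by norm_num) (by norm_num)]; rfl

theorem SameTables.rpos_eq {s s' : State} (h : SameTables s s') : rpos s' = rpos s := by
  funext t; rw [rpos, h.pos_eq, h.mem _ (by norm_num) (by norm_num)]; rfl

theorem Store.congr {s s' : State} (h : Store X V I s) (e : SameTables s s') : Store X V I s' := by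
  obtain ⟨a1, a2, a3, a4, a5, ⟨ℓ, ⟨b1, ⟨t, b2, b2'⟩, b3⟩, b4⟩, a7⟩ := h
  have hn : nodes s' = nodes s := by simp [nodes, e.size]
  have em : ∀ a, 3 ≤ a ∧ a ≤ 12 → s'.mem a = s.mem a := fun a h => e.mem a h.1 h.2
  have hp := e.pos_eq
  refine ⟨a1, e.size.trans a2, fun t ht => ?_, ?_, ?_, ⟨ℓ, ⟨?_, ⟨t, ?_, ?_⟩, ?_⟩, ?_⟩, ?_⟩
  · obtain ⟨c1, c2, c3, c4, c5, c6, c7, c8, c9, c10, c11⟩ := a3 t ht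
    constructor <;> simp only [em aLN (by norm_num), em aRN (by norm_num), em aOWN (by norm_num),
      em aTY (by norm_num), em aLV (by norm_num), hn, e.kmem] <;> assumption
  · simp only [em aLN (by norm_num), em aRN (by norm_num), em aOWN (by norm_num), hn]
    exact a4
  · simp only [em aLN (by norm_num), em aLV (by norm_num)]
    exact a5
  · rw [LeafEntries, em aHT (by norm_num), em aAG (by norm_num)]
    exact b1
  · rw [e.kmem]
    refine b2.congr fun e _ => ?_
    simp only [em aLC (by norm_num), em aRC (by norm_num), em aHT (by norm_num),
      em aAG (by norm_num), em aLV (by norm_num), and_self]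
  · rw [e.root]
    exact b2'
  · rw [hp]; exact b3
  · rw [hn]; exact b4
  · rw [NextOk, hn, hp, em aNXT (by norm_num)]; exact a7

/-! ### Searching for the first relevant endpoint -/

theorem Store.length {ℓ : List ℕ} {s : State} (h : Store X V I s) (hI : Indexed ℓ s)
    (hℓ : ∀ e, e ∈ ℓ ↔ e ∈ nodes s) : ℓ.length = 2 * X.card := by
  have hnd : ℓ.Nodup := hI.sorted.imp fun hlt heq => by subst heq; exact lt_irrefl _ hlt
  rw [← List.toFinset_card_of_nodup hnd, ← h.card]
  have : ℓ.toFinset = nodes s := by ext e; simp [hℓ]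
  rw [this, nodes, Nat.card_Icc]
  omega

/-- Right endpoints have entry 0 in `aLV`, so hits are exactly the left endpoints of present
intervals reaching `x`, and the first hit in the sorted list belongs to the leftmost such interval.
-/
theorem Store.runs_find {s : State} (h : Store X V I s) (h0 : s.reg 3 = 0) (h1 : s.reg 4 = 1)
    {x : ℝ} (hx : s.kmem kKEY (s.reg 30) = x) :
    Runs findFirst s fun s' n =>
      (∃ k, 2 ^ k ≤ (2 * X.card + 1) ^ 2 ∧ n ≤ 40 * (k + 1)) ∧
      ((s'.reg 39 = 0 ∧ ∀ t ∈ V, ¬ x ≤ (I t).snd) ∨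
        ∃ t ∈ V, s'.reg 39 = s.mem aLN t ∧ x ≤ (I t).snd ∧
          ∀ u ∈ V, x ≤ (I u).snd → lpos s t ≤ lpos s u) := by
  obtain ⟨ℓ, hI, hℓ⟩ := h.index
  have hhit : ∀ t ∈ V, x ≤ (I t).snd → Hits s.mem (s.kmem kRK) x (s.mem aLN t) := fun t ht hxt =>
    ⟨(h.live t (h.sub ht)).2 ht, by rwa [(h.entry t (h.sub ht)).rk_left]⟩
  refine (runs_findFirst h0 h1 hI).mono ?_
  rintro s' n ⟨hn, hres⟩
  rw [h.length hI hℓ] at hn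
  refine ⟨hn, ?_⟩
  rw [hx] at hres
  rcases hres with ⟨h39, hno⟩ | ⟨h39, ⟨hlv, hrk⟩, pre, post, heq, hpre⟩
  · refine .inl ⟨h39, fun t ht hxt => ?_⟩
    exact hno _ ((hℓ _).2 (h.entry t (h.sub ht)).left_mem) (hhit t ht hxt)
  · right
    have hw : s'.reg 39 ∈ nodes s := (hℓ _).1 (by rw [heq]; simp)
    obtain ⟨ho, he⟩ := h.own _ hw
    have en := h.entry _ ho
    generalize s.mem aOWN (s'.reg 39) = t at *
    rcases he with he | he
    swap
    · rw [he] at hlv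
      exact absurd en.live_right hlv
    refine ⟨t, (h.live t ho).1 (by rwa [← he]), he, by rwa [← en.rk_left, ← he], fun u hu hxu => ?_⟩
    have hmem : s.mem aLN u ∈ ℓ := (hℓ _).2 (h.entry u (h.sub hu)).left_mem
    have hsort := hI.sorted
    rw [heq] at hmem hsort
    rw [lpos, ← he]
    rcases List.mem_append.1 hmem with hmem | hmem
    · exact absurd (hhit u hu hxu) (hpre _ hmem)
    · rcases List.mem_cons.1 hmem with hmem | hmem
      · rw [lpos, hmem]
      · exact ((List.pairwise_cons.1 (List.pairwise_append.1 hsort).2.1).1 _ hmem).le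

/-- Registers `42` and `43` receive the endpoints of the interval in register `50`, and register
`51` the node from which all walks start. Register `46` starts with the level itself because no
level occurs yet. -/
def prepare : Prog :=
  (load 42 aLN 50 ;; load 43 aRN 50 ;; copy 30 42) ;; findFirst ;;
    copy 51 39 ;; copy 46 44 ;; const 47 0 ;; const 48 0 ;; const 49 0 ;; const 53 0 ;; copy 45 51

/-- The walks for the interval `z` start at the left endpoint of `t`. -/
structure StartAt (V : Finset ℕ) (s₀ : State) (z t : ℕ) : Prop where
  mem : t ∈ V
  le : lpos s₀ t ≤ lpos s₀ z
  reach : lpos s₀ z < rpos s₀ t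
  first : ∀ u ∈ V, lpos s₀ z < rpos s₀ u → lpos s₀ t ≤ lpos s₀ u

/-- The search cannot fail: `z` is present and reaches its own left endpoint. -/
theorem Scene.runs_prepare (h : Scene X V I S z s₀) (hSV : S ⊆ V) (hz : z ∈ V)
    (h0 : s₀.reg 3 = 0) (h1 : s₀.reg 4 = 1) (h50 : s₀.reg 50 = z) (hcnt : ∀ i, s₀.mem aCNT i = 0) :
    Runs prepare s₀ fun s' n => (∃ k, 2 ^ k ≤ (2 * X.card + 1) ^ 2 ∧ n ≤ 40 * (k + 1) + 10) ∧
      s'.mem = s₀.mem ∧ s'.reg 44 = s₀.reg 44 ∧ (∀ k < 3, s'.reg (47 + k) = 0) ∧ s'.reg 53 = 0 ∧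
      ∃ t, StartAt V s₀ z t ∧ s'.reg 51 = s₀.mem aLN t ∧
        SweepAt s₀ z (bef s₀ S z (s₀.mem aLN t)) (s₀.mem aLN t) s' := by
  refine Runs.seq (Runs.block rfl fun n1 hn1 => ?_)
  simp only [Prog.cost] at hn1
  obtain ⟨s1, hs1⟩ : ∃ s1, Prog.run (load 42 aLN 50 ;; load 43 aRN 50 ;; copy 30 42) s₀ = s1 :=
    ⟨_, rfl⟩
  rw [hs1]
  have q : s1.mem = s₀.mem ∧ s1.kmem = s₀.kmem ∧ s1.reg 42 = s₀.mem aLN z ∧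
      s1.reg 43 = s₀.mem aRN z ∧ s1.reg 30 = s₀.mem aLN z ∧ s1.reg 3 = 0 ∧ s1.reg 4 = 1 ∧
      s1.reg 44 = s₀.reg 44 ∧ s1.reg 1 = s₀.reg 1 ∧ s1.reg 2 = s₀.reg 2 := by
    rw [← hs1]
    simp [Prog.run, Instr.apply, h50, h0, h1]
  obtain ⟨qm, qk, q42, q43, q30, q3, q4, q44, q1, q2⟩ := q
  have hst : Store X V I s1 := h.store.congr ⟨q1, q2, fun a _ _ => by rw [qm], qk⟩
  have hlp : lpos s1 = lpos s₀ := by funext t; simp [lpos, qm, qk]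
  refine Runs.seq ((hst.runs_find q3 q4 (x := (I z).fst) ?_).framed.mono ?_)
  · rw [qk, q30, (h.store.entry z h.mem).key_left]
  rintro s2 n2 ⟨⟨⟨k, hk, hn2⟩, hres⟩, fr⟩
  have hkey : ∀ u ∈ V, ((I z).fst ≤ (I u).snd ↔ lpos s₀ z < rpos s₀ u) := fun u hu =>
    (h.store.lpos_lt_rpos h.mem (h.store.sub hu)).symm
  obtain ⟨t, ht, e39, hreach, hfirst⟩ := hres.resolve_left fun hno =>
    hno.2 z hz (I z).fst_le_snd
  rw [hlp] at hfirst
  rw [qm] at e39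
  have hstart : StartAt V s₀ z t := ⟨ht, hfirst z hz (I z).fst_le_snd, (hkey t ht).1 hreach,
    fun u hu hlt => hfirst u hu ((hkey u hu).2 hlt)⟩
  refine Runs.block rfl fun n3 hn3 => ?_
  simp only [Prog.cost] at hn3
  obtain ⟨s3, hs3⟩ : ∃ s3, Prog.run (copy 51 39 ;; copy 46 44 ;; const 47 0 ;; const 48 0 ;;
    const 49 0 ;; const 53 0 ;; copy 45 51) s2 = s3 := ⟨_, rfl⟩
  rw [hs3]
  have g : ∀ x, x ∉ findFirst.regs → s2.reg x = s1.reg x := fr.reg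
  have g3 := g 3 (by decide)
  have g4 := g 4 (by decide)
  have g42 := g 42 (by decide)
  have g43 := g 43 (by decide)
  have g44 := g 44 (by decide)
  have p : s3.mem = s₀.mem ∧ s3.kmem = s₀.kmem ∧ s3.reg 42 = s₀.mem aLN z ∧
      s3.reg 43 = s₀.mem aRN z ∧ s3.reg 3 = 0 ∧ s3.reg 4 = 1 ∧ s3.reg 44 = s₀.reg 44 ∧
      s3.reg 45 = s₀.mem aLN t ∧ s3.reg 51 = s₀.mem aLN t ∧ s3.reg 46 = s₀.reg 44 ∧
      s3.reg 53 = 0 := by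
    rw [← hs3]
    simp [Prog.run, Instr.apply, g3, g4, g42, g43, g44, q42, q43, q44, q3, q4, e39, qm, qk,
      fr.mem_eq rfl, fr.kmem_eq rfl]
  obtain ⟨pm, pk, p42, p43, p3, p4, p44, p45, p51, p46, p53⟩ := p
  refine ⟨⟨k, hk, by omega⟩, pm, p44, fun k hk => ?_, p53, t, hstart, p51, ?_⟩
  · rw [← hs3]
    interval_cases k <;> simp [Prog.run, Instr.apply]
  -- No present interval that reaches `z` starts before that of `t`, so the sweep begins with
  -- cleared counters.
  · have hemp : bef s₀ S z (s₀.mem aLN t) = ∅ := by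
      refine Finset.filter_eq_empty_iff.2 fun u hu hc => ?_
      exact absurd (hstart.first u (hSV hu) hc.1) (not_le.2 hc.2.1)
    rw [hemp]
    refine ⟨p3, p4, p42, p43, p45, fun a _ => by rw [pm], pk, fun i => ?_, ?_⟩
    · rw [pm, hcnt]; simp
    · rw [pm, p46, p44]; simp [hcnt]

end DynInterval

end

/-! ### The length of walks; testing and coloring one interval. -/

noncomputable section

namespace DynInterval

variable {X V S : Finset ℕ} {I : ℕ → NonemptyInterval ℝ} {z : ℕ} {s₀ : State}

/-! ### The length of the walks -/

/-- Every interval intersects at most `d` others. -/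
def Deg (X : Finset ℕ) (I : ℕ → NonemptyInterval ℝ) (d : ℕ) : Prop :=
  ∀ t ∈ X, ∃ N ⊆ X, (∀ u ∈ X, (I u).fst ≤ (I t).snd → (I t).fst ≤ (I u).snd → u ∈ N) ∧
    N.card ≤ d + 1

/-- A node before the right end of `t` belongs to an interval that meets `t`. A later node lies
beyond the left end of `z`, so its interval meets `z`. The two neighbourhoods have at most `2 * d +
2` members, with two endpoints each. Intervals already deleted are passed as well, which is why `d`
refers to all stored ones. -/
theorem Store.card_between_le {s : State} (h : Store X V I s) {d : ℕ} (hd : Deg X I d) {t : ℕ}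
    (hz : z ∈ X) (ht : StartAt V s z t) :
    (between s (s.mem aLN t) (s.mem aRN z)).card ≤ 4 * d + 4 := by
  classical
  have htX := h.sub ht.mem
  obtain ⟨M, hM, hMt, hMc⟩ := hd t htX
  obtain ⟨N, hN, hNz, hNc⟩ := hd z hz
  have hsub : between s (s.mem aLN t) (s.mem aRN z) ⊆
      (M ∪ N).image (s.mem aLN) ∪ (M ∪ N).image (s.mem aRN) := by
    intro g hg
    simp only [between, Finset.mem_filter] at hg
    obtain ⟨hg, hg1, hg2⟩ := hg
    change lpos s t ≤ _ at hg1
    change _ < rpos s z at hg2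
    obtain ⟨ho, he⟩ := h.own g hg
    generalize s.mem aOWN g = u at *
    have hlr : lpos s u < rpos s u := (h.lpos_lt_rpos ho ho).2 (I u).fst_le_snd
    have hb : lpos s u ≤ pos s.mem s.kmem g ∧ pos s.mem s.kmem g ≤ rpos s u := by
      rcases he with he | he
      · rw [he]; exact ⟨le_rfl, hlr.le⟩
      · rw [he]; exact ⟨hlr.le, le_rfl⟩
    have hu : u ∈ M ∪ N := by
      rcases lt_or_ge (pos s.mem s.kmem g) (rpos s t) with hlt | hge
      · refine Finset.mem_union_left _ (hMt u ho ?_ ?_)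
        · exact (h.lpos_lt_rpos ho htX).1 (hb.1.trans_lt hlt)
        · exact (h.lpos_lt_rpos htX ho).1
            (lt_of_le_of_ne (hg1.trans hb.2) (h.lpos_ne_rpos htX ho))
      · refine Finset.mem_union_right _ (hNz u ho ?_ ?_)
        · exact (h.lpos_lt_rpos ho hz).1 (hb.1.trans_lt hg2)
        · exact (h.lpos_lt_rpos hz ho).1 (ht.reach.trans_le (hge.trans hb.2))
    rcases he with he | he
    · exact Finset.mem_union_left _ (Finset.mem_image.2 ⟨u, hu, he.symm⟩)
    · exact Finset.mem_union_right _ (Finset.mem_image.2 ⟨u, hu, he.symm⟩)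
  have c1 := Finset.card_le_card hsub
  have c2 := Finset.card_union_le ((M ∪ N).image (s.mem aLN)) ((M ∪ N).image (s.mem aRN))
  have c3 := Finset.card_image_le (s := M ∪ N) (f := s.mem aLN)
  have c4 := Finset.card_image_le (s := M ∪ N) (f := s.mem aRN)
  have c5 := Finset.card_union_le M N
  omega

/-- A bound for the height of the tree. -/
def height (c : ℕ) : ℕ := Nat.log 2 ((2 * c + 1) ^ 2)

theorem le_height {k c : ℕ} (h : 2 ^ k ≤ (2 * c + 1) ^ 2) : k ≤ height c :=
  Nat.le_log_of_pow_le (by norm_num) h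

/-! ### The state of the coloring -/

/-- The intervals in `S` are colored properly. -/
structure Colored (S : Finset ℕ) (s : State) : Prop where
  part : ∀ t, s.mem aST t ≠ 0 ↔ t ∈ S
  proper : ∀ u ∈ S, ∀ w ∈ S, u ≠ w → Meets (lpos s) (rpos s) u w →
    s.mem 0 u = s.mem 0 w → s.mem 1 u ≠ s.mem 1 w
  off_le : ∀ u ∈ S, s.mem 1 u ≤ 2
  off_zero : ∀ u ∈ S, s.mem 0 u = 0 → s.mem 1 u = 0
  count : ∀ i, s.mem aCNT i = 0

/-- All intervals in `S` are good. -/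
def AllGood (S : Finset ℕ) (s : State) : Prop :=
  ∀ u ∈ S, Good (lpos s) (rpos s) (s.mem 0) S u

/-! ### Testing an interval -/

/-- Set register `53` if the interval in register `50`, which must not take part in the coloring,
would be good with its level. -/
def check : Prog := load 44 0 50 ;; prepare ;; walk 42 event ;; traverse probeGood ;; cleanup

/-- The counters are zero again at the end, so testing leaves no trace in the word arrays. -/
theorem Store.runs_check {s : State} (h : Store X V I s) (hc : Colored S s) (hSV : S ⊆ V)
    (hz : z ∈ V) (hzS : z ∉ S) (h0 : s.reg 3 = 0) (h1 : s.reg 4 = 1) (h50 : s.reg 50 = z) {d : ℕ}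
    (hd : Deg X I d) :
    Runs check s fun s' n => n ≤ 40 * height X.card + 340 * d + 420 ∧
      s'.mem = s.mem ∧
      (s'.reg 53 ≠ 0 ↔ Good (lpos s) (rpos s) (s.mem 0) (insert z S) z) := by
  refine Runs.seq (Runs.block rfl fun n1 hn1 => ?_)
  simp only [Prog.cost] at hn1
  obtain ⟨s1, hs1⟩ : ∃ s1, Prog.run (load 44 0 50) s = s1 := ⟨_, rfl⟩
  rw [hs1]
  have q : s1.mem = s.mem ∧ s1.kmem = s.kmem ∧ s1.reg 3 = 0 ∧ s1.reg 4 = 1 ∧ s1.reg 50 = z ∧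
      s1.reg 44 = s.mem 0 z ∧ s1.reg 1 = s.reg 1 ∧ s1.reg 2 = s.reg 2 := by
    rw [← hs1]
    simp [Prog.run, Instr.apply, h0, h1, h50]
  obtain ⟨qm, qk, q3, q4, q50, q44, q1, q2⟩ := q
  have same : SameTables s s1 := ⟨q1, q2, fun a _ _ => by rw [qm], qk⟩
  have hst := h.congr same
  have hscene : Scene X V I S z s1 :=
    ⟨hst, hSV.trans h.sub, by rw [qm]; exact hc.part, h.sub hz, hzS⟩
  refine Runs.seq ((hscene.runs_prepare hSV hz q3 q4 q50 (by rw [qm]; exact hc.count)).mono ?_)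
  rintro s2 n2 ⟨⟨k, hk, hn2⟩, -, r44, rfl3, r53, t, ht, r51, sw2⟩
  have htn := (hst.entry t (hst.sub ht.mem)).left_mem
  have hfirst : ∀ u ∈ S, lpos s1 z < rpos s1 u → pos s1.mem s1.kmem (s1.mem aLN t) ≤ lpos s1 u :=
    fun u hu => ht.first u (hSV hu)
  refine Runs.seq ((hscene.runs_approach htn ht.le sw2).framed.mono ?_)
  rintro s3 n3 ⟨⟨sw3, hn3⟩, fr3⟩
  refine Runs.seq ((hscene.runs_good (w := s1.mem aLN t) ht.le sw3 ?_ ?_).framed.mono ?_)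
  · rw [fr3.reg 44 (by decide), r44, q44, qm]
  · rw [fr3.reg 53 (by decide), r53]
  rintro s4 n4 ⟨⟨sw4, hg, hn4⟩, fr4⟩
  refine (hscene.runs_cleanup htn ht.le hfirst sw4 ?_ fun k hk => ?_).framed.mono ?_
  · rw [fr4.reg 51 (by decide), fr3.reg 51 (by decide), r51]
  · have e4 : s4.reg (47 + k) = s3.reg (47 + k) := by
      interval_cases k <;> exact fr4.reg _ (by decide)
    have e3 : s3.reg (47 + k) = s2.reg (47 + k) := by
      interval_cases k <;> exact fr3.reg _ (by decide)
    rw [e4, e3, rfl3 k hk]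
  rintro s5 n5 ⟨⟨hm5, -, hn5⟩, fr5⟩
  have hD := hst.card_between_le hd (h.sub hz) ht
  have := le_height hk
  refine ⟨by omega, ?_, ?_⟩
  · rw [hm5, qm, Function.update_eq_iff]
    exact ⟨funext fun i => (hc.count i).symm, fun _ _ => rfl⟩
  · rw [fr5.reg 53 (by decide), hg, same.lpos_eq, same.rpos_eq, qm]

/-! ### Coloring an interval -/

def choose : Prog :=
  store 0 50 44 ;; const 60 0 ;;
    .ite (.eq 47 3) nop (const 60 1 ;; .ite (.eq 48 3) nop (const 60 2)) ;;
    store 1 50 60 ;; store aST 50 4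

/-- Color the interval in register `50`. -/
def place : Prog := const 44 0 ;; prepare ;; walk 42 event ;; traverse bump ;; cleanup ;; choose

theorem run_choose {s : State} (h0 : s.reg 3 = 0) (h1 : s.reg 4 = 1) :
    ∃ o ≤ 2, (choose.run s).mem = Function.update (Function.update (Function.update s.mem
      0 (Function.update (s.mem 0) (s.reg 50) (s.reg 44)))
      1 (Function.update (s.mem 1) (s.reg 50) o))
      aST (Function.update (s.mem aST) (s.reg 50) 1) ∧
      (∀ k < o, s.reg (47 + k) ≠ 0) ∧ (o < 2 → s.reg (47 + o) = 0) := by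
  by_cases c1 : s.reg 47 = 0
  · refine ⟨0, by norm_num, ?_, by simp, fun _ => c1⟩
    simp [choose, Prog.run, Test.Holds, Instr.apply, h0, h1, c1]
  by_cases c2 : s.reg 48 = 0
  · refine ⟨1, by norm_num, ?_, fun k hk => ?_, fun _ => c2⟩
    · simp [choose, Prog.run, Test.Holds, Instr.apply, h0, h1, c1, c2]
    · interval_cases k
      exact c1
  · refine ⟨2, le_rfl, ?_, fun k hk => ?_, by simp⟩
    · simp [choose, Prog.run, Test.Holds, Instr.apply, h0, h1, c1, c2]
    · interval_cases k
      exacts [c1, c2]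

theorem cls_of_le {k : ℕ} (h : k ≤ 2) : cls k = k := by
  interval_cases k <;> rfl

/-- The sweep supplies the hypotheses of `good_insert`; the offset taken is the smallest one not in
use among the neighbours on the chosen level, with 2 as the last resort. -/
theorem Store.runs_place {s : State} (h : Store X V I s) (hc : Colored S s) (hgood : AllGood S s)
    (hSV : S ⊆ V) (hz : z ∈ V) (hzS : z ∉ S) (h0 : s.reg 3 = 0) (h1 : s.reg 4 = 1)
    (h50 : s.reg 50 = z) {d : ℕ} (hd : Deg X I d) :
    Runs place s fun s' n => n ≤ 40 * height X.card + 340 * d + 430 ∧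
      Store X V I s' ∧ Colored (insert z S) s' ∧ AllGood (insert z S) s' := by
  classical
  refine Runs.seq (Runs.block rfl fun n1 hn1 => ?_)
  simp only [Prog.cost] at hn1
  obtain ⟨s1, hs1⟩ : ∃ s1, Prog.run (const 44 0) s = s1 := ⟨_, rfl⟩
  rw [hs1]
  have q : s1.mem = s.mem ∧ s1.kmem = s.kmem ∧ s1.reg 3 = 0 ∧ s1.reg 4 = 1 ∧ s1.reg 50 = z ∧
      s1.reg 44 = 0 ∧ s1.reg 1 = s.reg 1 ∧ s1.reg 2 = s.reg 2 := by
    rw [← hs1]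
    simp [Prog.run, Instr.apply, h0, h1, h50]
  obtain ⟨qm, qk, q3, q4, q50, q44, q1, q2⟩ := q
  have same : SameTables s s1 := ⟨q1, q2, fun a _ _ => by rw [qm], qk⟩
  have hst := h.congr same
  have hscene : Scene X V I S z s1 :=
    ⟨hst, hSV.trans h.sub, by rw [qm]; exact hc.part, h.sub hz, hzS⟩
  refine Runs.seq ((hscene.runs_prepare hSV hz q3 q4 q50
    (by rw [qm]; exact hc.count)).framed.mono ?_)
  rintro s2 n2 ⟨⟨⟨k, hk, hn2⟩, -, r44, rfl3, r53, t, ht, r51, sw2⟩, fr2⟩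
  have htn := (hst.entry t (hst.sub ht.mem)).left_mem
  have hfirst : ∀ u ∈ S, lpos s1 z < rpos s1 u → pos s1.mem s1.kmem (s1.mem aLN t) ≤ lpos s1 u :=
    fun u hu => ht.first u (hSV hu)
  refine Runs.seq ((hscene.runs_approach htn ht.le sw2).framed.mono ?_)
  rintro s3 n3 ⟨⟨sw3, hn3⟩, fr3⟩
  refine Runs.seq ((hscene.runs_level (w := s1.mem aLN t) ht.le hfirst sw3 ?_).framed.mono ?_)
  · rw [fr3.reg 44 (by decide), r44, q44]
  rintro s4 n4 ⟨⟨sw4, hb, hmax, hn4⟩, fr4⟩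
  refine Runs.seq ((hscene.runs_cleanup htn ht.le hfirst sw4 ?_ fun k hk => ?_).framed.mono ?_)
  · rw [fr4.reg 51 (by decide), fr3.reg 51 (by decide), r51]
  · have e4 : s4.reg (47 + k) = s3.reg (47 + k) := by
      interval_cases k <;> exact fr4.reg _ (by decide)
    have e3 : s3.reg (47 + k) = s2.reg (47 + k) := by
      interval_cases k <;> exact fr3.reg _ (by decide)
    rw [e4, e3, rfl3 k hk]
  rintro s5 n5 ⟨⟨hm5, hflag, hn5⟩, fr5⟩
  have hm5' : s5.mem = s.mem := by
    rw [hm5, qm, Function.update_eq_iff]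
    exact ⟨funext fun i => (hc.count i).symm, fun _ _ => rfl⟩
  refine Runs.block rfl fun n6 hn6 => ?_
  have hcost : choose.cost ≤ 9 := by decide
  have f3 : s5.reg 3 = 0 := by rw [fr5.reg 3 (by decide), sw4.zero]
  have f4 : s5.reg 4 = 1 := by rw [fr5.reg 4 (by decide), sw4.one]
  have f50 : s5.reg 50 = z := by
    rw [fr5.reg 50 (by decide), fr4.reg 50 (by decide), fr3.reg 50 (by decide),
      fr2.reg 50 (by decide), q50]
  have f44 : s5.reg 44 = s4.reg 44 := fr5.reg 44 (by decide)
  have f1 : s5.reg 1 = s.reg 1 := by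
    rw [fr5.reg 1 (by decide), fr4.reg 1 (by decide), fr3.reg 1 (by decide),
      fr2.reg 1 (by decide), q1]
  have f2 : s5.reg 2 = s.reg 2 := by
    rw [fr5.reg 2 (by decide), fr4.reg 2 (by decide), fr3.reg 2 (by decide),
      fr2.reg 2 (by decide), q2]
  have fk : s5.kmem = s.kmem := by
    rw [fr5.kmem_eq rfl, sw4.kmem, qk]
  obtain ⟨o, ho, hmem, hused, hfree⟩ := run_choose f3 f4
  have fr6 := Prog.framed_run (c := choose) rfl s5
  have hD := hst.card_between_le hd (h.sub hz) ht
  have := le_height hk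
  rw [f50, f44, hm5'] at hmem
  generalize s4.reg 44 = b at *
  rw [same.lpos_eq, same.rpos_eq, qm] at hb hmax hflag
  generalize choose.run s5 = s6 at *
  have same' : SameTables s s6 := by
    refine ⟨?_, ?_, fun a h3 h12 => ?_, ?_⟩
    · rw [fr6.reg 1 (by decide), f1]
    · rw [fr6.reg 2 (by decide), f2]
    · rw [hmem, Function.update_of_ne (by omega), Function.update_of_ne (by omega),
        Function.update_of_ne (by omega)]
    · rw [fr6.kmem_eq rfl, fk]
  have m0 : s6.mem 0 = Function.update (s.mem 0) z b := by rw [hmem]; simp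
  have m1 : s6.mem 1 = Function.update (s.mem 1) z o := by rw [hmem]; simp
  have m2 : s6.mem aST = Function.update (s.mem aST) z 1 := by rw [hmem]; simp
  have mc : s6.mem aCNT = s.mem aCNT := by rw [hmem]; simp
  have ne : ∀ u ∈ S, u ≠ z := fun u hu he => hzS (he ▸ hu)
  have l0 : ∀ u ∈ S, s6.mem 0 u = s.mem 0 u := fun u hu => by
    rw [m0, Function.update_of_ne (ne u hu)]
  have l1 : ∀ u ∈ S, s6.mem 1 u = s.mem 1 u := fun u hu => by
    rw [m1, Function.update_of_ne (ne u hu)]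
  have lz : s6.mem 0 z = b := by rw [m0, Function.update_self]
  have oz : s6.mem 1 z = o := by rw [m1, Function.update_self]
  -- no neighbour has the chosen color
  have hnone : ∀ u ∈ S, Meets (lpos s) (rpos s) u z → s.mem 0 u = b → s.mem 1 u ≠ o := by
    intro u hu hm hl heq
    have hflago : s5.reg (47 + o) ≠ 0 :=
      (hflag o (by omega)).2 ⟨u, hu, hm, hl, by rw [heq, cls_of_le ho]⟩
    have ho2 : ¬ o < 2 := fun hlt => hflago (hfree hlt)
    -- A conflict is possible only at offset 2, which is taken only if 0 and 1 are in use. Then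
    -- three neighbours on level `b` have different offsets, hence are distinct, against
    -- `not_three_neighbours`.
    have hall : ∀ i : Fin 3, ∃ u ∈ S, Meets (lpos s) (rpos s) u z ∧ s.mem 0 u = b ∧
        cls (s.mem 1 u) = i := fun i => by
      refine (hflag i i.2).1 ?_
      rcases lt_or_ge (i : ℕ) o with hi | hi
      · exact hused i hi
      · have : (i : ℕ) = o := by have := i.2; omega
        rwa [this]
    choose f hf1 hf2 hf3 hf4 using hall
    refine not_three_neighbours hgood hb hmax (f := f) (fun i j hij => ?_) hf1 hf3 hf2
    have := hf4 i
    rw [hij, hf4 j] at this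
    exact Fin.ext this.symm
  refine ⟨by omega, h.congr same', ⟨fun u => ?_, ?_, ?_, ?_, ?_⟩, ?_⟩
  · rw [m2, Function.update_apply, Finset.mem_insert]
    split_ifs with hu
    · simp [hu]
    · simp [hu, hc.part]
  · rw [same'.lpos_eq, same'.rpos_eq]
    intro u hu₀ w hw₀ hne hm hl
    rcases Finset.mem_insert.1 hu₀ with rfl | hu <;> rcases Finset.mem_insert.1 hw₀ with rfl | hw
    · exact absurd rfl hne
    · rw [lz, l0 w hw] at hl
      rw [oz, l1 w hw]
      exact (hnone w hw hm.symm hl.symm).symm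
    · rw [lz, l0 u hu] at hl
      rw [oz, l1 u hu]
      exact hnone u hu hm hl
    · rw [l0 u hu, l0 w hw] at hl
      rw [l1 u hu, l1 w hw]
      exact hc.proper u hu w hw hne hm hl
  · intro u hu
    rcases Finset.mem_insert.1 hu with rfl | hu
    · rw [oz]; exact ho
    · rw [l1 u hu]; exact hc.off_le u hu
  · intro u hu hl
    rcases Finset.mem_insert.1 hu with rfl | hu
    · rw [lz] at hl
      subst hl
      rw [oz]
      -- A nonzero offset would mean that offset 0 is in use by a neighbour on level 0, and there is
      -- none.
      by_contra hne
      obtain ⟨w, hw, hm, hl, -⟩ := (hflag 0 (by norm_num)).1 (hused 0 (by omega))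
      exact not_meets_of_level_zero hw
        ((h.lpos_lt_rpos (h.sub (hSV hw)) (h.sub (hSV hw))).2 (I w).fst_le_snd)
        ((h.lpos_lt_rpos (h.sub hz) (h.sub hz)).2 (I u).fst_le_snd) hmax hl hm
    · rw [l1 u hu]
      rw [l0 u hu] at hl
      exact hc.off_zero u hu hl
  · rw [mc]; exact hc.count
  · rw [AllGood, same'.lpos_eq, same'.rpos_eq]
    exact good_insert hzS hgood hb hmax lz l0

end DynInterval

end

/-! ### Adding an endpoint to the tree and to the list. -/

noncomputable section

namespace DynInterval

variable {X V S : Finset ℕ} {I : ℕ → NonemptyInterval ℝ}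

/-! ### Adding a node to the tree and to the list -/

theorem Rep.congr_key {cl cr : ℕ} {m : ℕ → ℕ → ℕ} {rk rk' : ℕ → ℝ} :
    ∀ {t : Tree}, Rep cl cr m rk t → (∀ e ∈ t.inorder, rk' e = rk e) → Rep cl cr m rk' t
  | .leaf, _, _ => trivial
  | .node l x r, h, hm => by
    obtain ⟨h0, h1, h2, h3, h4, h5, h6⟩ := h
    refine ⟨h0, h1, h2, h3, ?_, ?_, ?_⟩
    · rcases h4 with h4 | ⟨a1, a2, a3, a4⟩
      · exact .inl h4
      · refine .inr ⟨a1, a2, a3, fun e he hl => ?_⟩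
        rw [hm e he, hm _ a2]
        exact a4 e he hl
    · exact h5.congr_key fun e he => hm e (by simp [Tree.inorder, he])
    · exact h6.congr_key fun e he => hm e (by simp [Tree.inorder, he])

/-- The nodes in `N` are stored in the tree and in the list. -/
structure Linked (N : Finset ℕ) (s : State) : Prop where
  index : ∃ ℓ, Indexed ℓ s ∧ ∀ e, e ∈ ℓ ↔ e ∈ N
  next : ∀ e g, (e = 0 ∨ e ∈ N) → g ∈ N → (e = 0 ∨ pos s.mem s.kmem e < pos s.mem s.kmem g) →
    s.mem aNXT e ∈ N ∧ (e = 0 ∨ pos s.mem s.kmem e < pos s.mem s.kmem (s.mem aNXT e)) ∧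
    pos s.mem s.kmem (s.mem aNXT e) ≤ pos s.mem s.kmem g

theorem Linked.congr {N : Finset ℕ} {s s' : State} (h : Linked N s) (hr : s'.reg 1 = s.reg 1)
    (hm : ∀ a, 7 ≤ a → a ≤ 12 → s'.mem a = s.mem a) (hty : ∀ e ∈ N, s'.mem aTY e = s.mem aTY e)
    (hk : ∀ e ∈ N, s'.kmem kKEY e = s.kmem kKEY e ∧ s'.kmem kRK e = s.kmem kRK e) :
    Linked N s' := by
  have hp : ∀ e ∈ N, pos s'.mem s'.kmem e = pos s.mem s.kmem e := fun e he => by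
    simp only [pos, hty e he, (hk e he).1]
  have em : ∀ a, 7 ≤ a ∧ a ≤ 12 → s'.mem a = s.mem a := fun a h => hm a h.1 h.2
  obtain ⟨⟨ℓ, ⟨b1, ⟨t, b2, b2', b2'', rfl⟩, b3⟩, b4⟩, a7⟩ := h
  refine ⟨⟨_, ⟨?_, ⟨t, ?_, ?_, b2'', rfl⟩, ?_⟩, b4⟩, ?_⟩
  · rw [LeafEntries, em aHT (by norm_num), em aAG (by norm_num)]
    exact b1
  · refine (b2.congr fun e _ => ?_).congr_key fun e he => (hk e ((b4 e).1 he)).2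
    simp only [em aLC (by norm_num), em aRC (by norm_num), em aHT (by norm_num),
      em aAG (by norm_num), em aLV (by norm_num), and_self]
  · rw [hr]
    exact b2'
  · refine b3.imp_of_mem fun he hf hlt => ?_
    rwa [hp _ ((b4 _).1 he), hp _ ((b4 _).1 hf)]
  · intro e g he hg hlt
    rw [em aNXT (by norm_num)]
    rcases he with rfl | he
    · obtain ⟨c1, c2, c3⟩ := a7 0 g (.inl rfl) hg (.inl rfl)
      exact ⟨c1, .inl rfl, by rwa [hp g hg, hp _ c1]⟩
    · rw [hp e he, hp g hg] at hlt
      obtain ⟨c1, c2, c3⟩ := a7 e g (.inr he) hg hlt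
      exact ⟨c1, by rwa [hp e he, hp _ c1], by rwa [hp g hg, hp _ c1]⟩

/-- Insert the node in register `30` with the entry in register `31`. -/
def addNode : Prog := touch ;; load 60 aNXT 34 ;; store aNXT 30 60 ;; store aNXT 34 30

/-- The tree search delivers the predecessor, after which linking into the list is local. Node 0
serves as the head of the list, so a missing predecessor needs no special treatment. -/
theorem runs_addNode {N : Finset ℕ} {s : State} {q : ℕ} (h : Linked N s) (hN : 0 ∉ N) (hq : q ∉ N)
    (hq0 : q ≠ 0) (h0 : s.reg 3 = 0) (h1 : s.reg 4 = 1) (h30 : s.reg 30 = q) :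
    Runs addNode s fun s' n => (∃ k, 2 ^ k ≤ (N.card + 1) ^ 2 ∧ n ≤ 600 * (k + 1) + 3) ∧
      (∀ a, a ≠ aLV → a ≠ aLC → a ≠ aRC → a ≠ aHT → a ≠ aAG → a ≠ aSTK → a ≠ aDIR → a ≠ aNXT →
        s'.mem a = s.mem a) ∧
      s'.mem aLV = Function.update (s.mem aLV) q (s.reg 31) ∧ Linked (insert q N) s' := by
  obtain ⟨⟨ℓ, hI, hℓ⟩, hnext⟩ := h
  refine Runs.seq ((runs_touch h0 h1 h30 hq0 hI).framed.mono ?_)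
  rintro s1 n1 ⟨⟨⟨k, hk, hn1⟩, hmem, hlv, pre, post, hor, hI1⟩, fr1⟩
  have hnd : ℓ.Nodup := hI.sorted.imp fun hlt heq => by subst heq; exact lt_irrefl _ hlt
  have hlen : ℓ.length = N.card := by
    rw [← List.toFinset_card_of_nodup hnd]
    congr 1
    ext e; simp [hℓ]
  rw [hlen] at hk
  obtain ⟨rfl, hpred⟩ := hor.resolve_right fun heq => hq ((hℓ q).1 (by rw [heq]; simp))
  have r30 : s1.reg 30 = q := by rw [fr1.reg 30 (by decide), h30]
  refine Runs.block rfl fun n2 hn2 => ?_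
  simp only [Prog.cost] at hn2
  obtain ⟨s2, hs2⟩ : ∃ s2, Prog.run (load 60 aNXT 34 ;; store aNXT 30 60 ;; store aNXT 34 30) s1 =
    s2 := ⟨_, rfl⟩
  rw [hs2]
  have hm1 := hmem aNXT (by norm_num) (by norm_num) (by norm_num) (by norm_num) (by norm_num)
    (by norm_num) (by norm_num)
  have fr2 : Framed (load 60 aNXT 34 ;; store aNXT 30 60 ;; store aNXT 34 30) s1 s2 := by
    rw [← hs2]; exact Prog.framed_run rfl s1
  have hk2 : s2.kmem = s1.kmem := fr2.kmem_eq rfl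
  have hm2 : ∀ a, a ≠ aNXT → s2.mem a = s1.mem a := fun a ha =>
    fr2.mem a (by simp [Prog.arrs, ha])
  have hx : s2.mem aNXT = Function.update (Function.update (s.mem aNXT) q (s.mem aNXT (s1.reg 34)))
      (s1.reg 34) q := by
    rw [← hs2]
    simp [Prog.run, Instr.apply, r30, hm1]
  have hp : pos s2.mem s2.kmem = pos s.mem s.kmem := by
    rw [pos_congr (hm2 aTY (by norm_num)) hk2]
    exact pos_congr (hmem aTY (by norm_num) (by norm_num) (by norm_num) (by norm_num)
      (by norm_num) (by norm_num) (by norm_num)) (fr1.kmem_eq rfl)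
  have hI2 : Indexed (pre ++ q :: post) s2 := by
    obtain ⟨b1, ⟨t, b2, b2'⟩, b3⟩ := hI1
    refine ⟨?_, ⟨t, ?_, ?_⟩, ?_⟩
    · rw [LeafEntries, hm2 _ (by norm_num), hm2 _ (by norm_num)]; exact b1
    · rw [hk2]
      refine b2.congr fun e _ => ?_
      rw [hm2 aLC (by norm_num), hm2 aRC (by norm_num), hm2 aHT (by norm_num),
        hm2 aAG (by norm_num),
        hm2 aLV (by norm_num)]
      simp
    · rw [fr2.reg 1 (by decide)]; exact b2'
    · rw [pos_congr (hm2 aTY (by norm_num)) hk2]; exact b3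
  refine ⟨⟨k, hk, by omega⟩, fun a a1 a2 a3 a4 a5 a6 a7 a8 => ?_, ?_, ?_, ?_⟩
  · rw [hm2 a a8, hmem a a1 a2 a3 a4 a5 a6 a7]
  · rw [hm2 _ (by norm_num), hlv]
  · refine ⟨_, hI2, fun e => ?_⟩
    rw [Finset.mem_insert, ← hℓ]
    simp only [List.mem_append, List.mem_cons]
    tauto
  · have hsort := hI2.sorted
    rw [hp] at hsort ⊢
    rw [hx]
    generalize s1.reg 34 = p at hpred
    obtain ⟨-, hqpost, hprequ⟩ := List.pairwise_append.1 hsort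
    have hqpost := (List.pairwise_cons.1 hqpost).1
    have hbefore : ∀ e ∈ pre, pos s.mem s.kmem e < pos s.mem s.kmem q := fun e he =>
      hprequ e he q (by simp)
    -- The register holds the last node before `q`, with the default 0 if there is none.
    have hp0 : p = 0 ∧ pre = [] ∨ p ∈ pre ∧ ∀ e ∈ pre, pos s.mem s.kmem e ≤ pos s.mem s.kmem p := by
      rcases List.eq_nil_or_concat pre with rfl | ⟨L, b, rfl⟩
      · exact .inl ⟨by simpa using hpred, rfl⟩
      · rw [List.concat_eq_append, List.getLastD_concat] at hpred
        subst hpred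
        refine .inr ⟨by simp, fun e he => ?_⟩
        simp only [List.concat_eq_append, List.mem_append, List.mem_singleton] at he
        rcases he with he | rfl
        · simp only [List.concat_eq_append, List.append_assoc] at hsort
          exact ((List.pairwise_append.1 hsort).2.2 e he p (by simp)).le
        · exact le_rfl
    have hpN : p = 0 ∨ p ∈ N := hp0.imp (·.1) fun h => (hℓ p).1 (by simp [h.1])
    have hqp : q ≠ p := by
      rintro rfl
      exact hpN.elim hq0 hq
    have hpq : p = 0 ∨ pos s.mem s.kmem p < pos s.mem s.kmem q :=
      hp0.imp (·.1) fun h => hbefore p h.1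
    have hmemN : ∀ g ∈ N, g ∈ pre ∨ g ∈ post := fun g hg => by
      simpa using (hℓ g).2 hg
    -- the nodes after the predecessor
    have hafter : ∀ g ∈ N, (p = 0 ∨ pos s.mem s.kmem p < pos s.mem s.kmem g) →
        pos s.mem s.kmem q < pos s.mem s.kmem g := by
      intro g hg hlt
      rcases hmemN g hg with hg' | hg'
      · rcases hp0 with ⟨-, rfl⟩ | ⟨hp1, hp2⟩
        · simp at hg'
        · rcases hlt with rfl | hlt
          · exact absurd ((hℓ 0).1 (by simp [hp1])) hN
          · exact absurd hlt (not_lt.2 (hp2 g hg'))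
      · exact hqpost g hg'
    intro e g he hg hlt
    rw [Finset.mem_insert] at he hg
    by_cases hep : e = p
    · subst hep
      rw [Function.update_self]
      refine ⟨by simp, hpq, ?_⟩
      rcases hg with rfl | hg
      · exact le_rfl
      · exact (hafter g hg hlt).le
    rw [Function.update_of_ne hep]
    by_cases heq : e = q
    · subst heq
      rw [Function.update_self]
      have hlt := hlt.resolve_left hq0
      have hg := hg.resolve_left (by rintro rfl; exact lt_irrefl _ hlt)
      obtain ⟨c1, c2, c3⟩ := hnext p g hpN hg (hpq.imp_right fun h => h.trans hlt)
      exact ⟨Finset.mem_insert_of_mem c1, .inr (hafter _ c1 c2), c3⟩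
    rw [Function.update_of_ne heq]
    replace he : e = 0 ∨ e ∈ N := he.imp_right fun h => h.resolve_left heq
    rcases hg with rfl | hg
    -- The target is the new node and `e` is not its predecessor: the old pointer of `e` leads at
    -- most to `p`, which lies before the new node.
    · have hp0' : p ∈ pre ∧ ∀ e ∈ pre, pos s.mem s.kmem e ≤ pos s.mem s.kmem p := by
        refine hp0.resolve_left ?_
        rintro ⟨rfl, rfl⟩
        have he := he.resolve_left hep
        have hlt := hlt.resolve_left hep
        have := hqpost e ((hmemN e he).resolve_left (by simp))
        exact lt_asymm hlt this
      have hpN : p ∈ N := (hℓ p).1 (by simp [hp0'.1])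
      obtain ⟨c1, c2, c3⟩ := hnext e p he hpN (by
        rcases he with he | he
        · exact .inl he
        · right
          have hlt := hlt.resolve_left (by rintro rfl; exact hN he)
          rcases hmemN e he with he' | he'
          · exact lt_of_le_of_ne (hp0'.2 e he') fun h => hep (pos_injective h)
          · exact absurd hlt (lt_asymm (hqpost e he')))
      exact ⟨Finset.mem_insert_of_mem c1, c2, c3.trans (hbefore p hp0'.1).le⟩
    · obtain ⟨c1, c2, c3⟩ := hnext e g he hg hlt
      exact ⟨Finset.mem_insert_of_mem c1, c2, c3⟩

theorem Store.linked {s : State} (h : Store X V I s) : Linked (nodes s) s := ⟨h.index, h.next⟩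

/-! ### Changes that do not affect the coloring -/

theorem Colored.congr {s s' : State} (h : Colored S s)
    (hm : ∀ a, a = 0 ∨ a = 1 ∨ a = aST ∨ a = aCNT → s'.mem a = s.mem a)
    (hL : ∀ u ∈ S, lpos s' u = lpos s u) (hR : ∀ u ∈ S, rpos s' u = rpos s u) : Colored S s' := by
  obtain ⟨a1, a2, a3, a4, a5⟩ := h
  refine ⟨?_, ?_, ?_, ?_, ?_⟩
  · rwa [hm _ (by simp)]
  · intro u hu w hw hne hmt
    rw [Meets, hL u hu, hL w hw, hR u hu, hR w hw] at hmt
    rw [hm 0 (by simp), hm 1 (by simp)]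
    exact a2 u hu w hw hne hmt
  · rwa [hm 1 (by simp)]
  · rwa [hm 0 (by simp), hm 1 (by simp)]
  · rwa [hm _ (by simp)]

theorem AllGood.congr {s s' : State} (h : AllGood S s) (hm : s'.mem 0 = s.mem 0)
    (hL : ∀ u ∈ S, lpos s' u = lpos s u) (hR : ∀ u ∈ S, rpos s' u = rpos s u) : AllGood S s' :=
  fun u hu => (h u hu).congr hu hL hR fun w _ => by rw [hm]

end DynInterval

end

/-! ### Insertions. -/

noncomputable section

namespace DynInterval

variable {X V S : Finset ℕ} {I : ℕ → NonemptyInterval ℝ}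

/-! ### Insertions -/

/-- The entries of two new nodes for the interval `J` with name `t` have been added. -/
structure Fresh (t : ℕ) (J : NonemptyInterval ℝ) (s s' : State) : Prop where
  left : s'.mem aLN = Function.update (s.mem aLN) t (s.reg 2 + 1)
  right : s'.mem aRN = Function.update (s.mem aRN) t (s.reg 2 + 2)
  own : s'.mem aOWN = Function.update (Function.update (s.mem aOWN) (s.reg 2 + 1) t) (s.reg 2 + 2) t
  ty : s'.mem aTY = Function.update (Function.update (s.mem aTY) (s.reg 2 + 1) 0) (s.reg 2 + 2) 1
  key : s'.kmem kKEY = Function.update (Function.update (s.kmem kKEY) (s.reg 2 + 1) J.fst)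
    (s.reg 2 + 2) J.snd
  rk : s'.kmem kRK = Function.update (Function.update (s.kmem kRK) (s.reg 2 + 1) J.snd)
    (s.reg 2 + 2) J.snd

theorem update_two_of_mem {α : Type*} {s : State} {f : ℕ → α} {x y : α} {e : ℕ} (he : e ∈ nodes s) :
    Function.update (Function.update f (s.reg 2 + 1) x) (s.reg 2 + 2) y e = f e := by
  simp only [nodes, Finset.mem_Icc] at he
  rw [Function.update_of_ne (by omega), Function.update_of_ne (by omega)]

theorem Entry.mono {u : ℕ} {J : NonemptyInterval ℝ} {s s' : State} (h : Entry u J s)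
    (hn : nodes s ⊆ nodes s') (hl : s'.mem aLN u = s.mem aLN u) (hr : s'.mem aRN u = s.mem aRN u)
    (hm : ∀ e ∈ nodes s, s'.mem aOWN e = s.mem aOWN e ∧ s'.mem aTY e = s.mem aTY e ∧
      s'.mem aLV e = s.mem aLV e ∧ s'.kmem kKEY e = s.kmem kKEY e ∧ s'.kmem kRK e = s.kmem kRK e) :
    Entry u J s' := by
  obtain ⟨c1, c2, c3, c4, c5, c6, c7, c8, c9, c10, c11⟩ := h
  obtain ⟨a1, a2, a3, a4, a5⟩ := hm _ c1
  obtain ⟨b1, b2, b3, b4, b5⟩ := hm _ c2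
  constructor <;> (try rw [hl]) <;> (try rw [hr])
  · exact hn c1
  · exact hn c2
  · rwa [a1]
  · rwa [b1]
  · rwa [a2]
  · rwa [b2]
  · rwa [a4]
  · rwa [b4]
  · rwa [a5]
  · rwa [b5]
  · rwa [b3]

theorem Fresh.agree {t : ℕ} {J : NonemptyInterval ℝ} {s s' : State} (h : Fresh t J s s') {e : ℕ}
    (he : e ∈ nodes s) : s'.mem aOWN e = s.mem aOWN e ∧ s'.mem aTY e = s.mem aTY e ∧
      s'.kmem kKEY e = s.kmem kKEY e ∧ s'.kmem kRK e = s.kmem kRK e := by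
  rw [h.own, h.ty, h.key, h.rk]
  simp only [update_two_of_mem he, and_self]

theorem Fresh.pos_eq {t : ℕ} {J : NonemptyInterval ℝ} {s s' : State} (h : Fresh t J s s') {e : ℕ}
    (he : e ∈ nodes s) : pos s'.mem s'.kmem e = pos s.mem s.kmem e := by
  obtain ⟨-, h2, h3, -⟩ := h.agree he
  simp only [pos, h2, h3]

theorem Fresh.lpos_eq {t u : ℕ} {J : NonemptyInterval ℝ} {s s' : State} (h : Fresh t J s s')
    (hs : Store X V I s) (hu : u ∈ X) (ht : t ∉ X) : lpos s' u = lpos s u := by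
  have hne : u ≠ t := by rintro rfl; exact ht hu
  rw [lpos, h.left, Function.update_of_ne hne, h.pos_eq (hs.entry u hu).left_mem]
  rfl

theorem Fresh.rpos_eq {t u : ℕ} {J : NonemptyInterval ℝ} {s s' : State} (h : Fresh t J s s')
    (hs : Store X V I s) (hu : u ∈ X) (ht : t ∉ X) : rpos s' u = rpos s u := by
  have hne : u ≠ t := by rintro rfl; exact ht hu
  rw [rpos, h.right, Function.update_of_ne hne, h.pos_eq (hs.entry u hu).right_mem]
  rfl

/-- The new nodes have numbers beyond the node counter, so before the counter is raised the stored
intervals are not affected by the new entries. This allows the search for neighbours before the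
insertion. -/
theorem Store.fresh {t : ℕ} {J : NonemptyInterval ℝ} {s s' : State} (h : Store X V I s)
    (hf : Fresh t J s s') (ht : t ∉ X) (h1 : s'.reg 1 = s.reg 1) (h2 : s'.reg 2 = s.reg 2)
    (hm : ∀ a, 7 ≤ a → a ≤ 12 → s'.mem a = s.mem a) : Store X V I s' := by
  have hn : nodes s' = nodes s := by simp [nodes, h2]
  have hne : ∀ u ∈ X, u ≠ t := by rintro u hu rfl; exact ht hu
  have hl : ∀ u ∈ X, s'.mem aLN u = s.mem aLN u := fun u hu => by
    rw [hf.left, Function.update_of_ne (hne u hu)]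
  have hr : ∀ u ∈ X, s'.mem aRN u = s.mem aRN u := fun u hu => by
    rw [hf.right, Function.update_of_ne (hne u hu)]
  have hlink : Linked (nodes s') s' := by
    rw [hn]
    exact h.linked.congr h1 hm (fun e he => (hf.agree he).2.1) fun e he => (hf.agree he).2.2
  refine ⟨h.sub, h2.trans h.card, fun u hu => ?_, fun e he => ?_, fun u hu => ?_, hlink.index,
    hlink.next⟩
  · refine (h.entry u hu).mono hn.ge (hl u hu) (hr u hu) fun e he => ?_
    obtain ⟨a1, a2, a3⟩ := hf.agree he
    exact ⟨a1, a2, by rw [hm _ (by norm_num) (by norm_num)], a3⟩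
  · rw [hn] at he
    rw [(hf.agree he).1]
    obtain ⟨ho, he'⟩ := h.own e he
    rw [hl _ ho, hr _ ho]
    exact ⟨ho, he'⟩
  · rw [hl u hu, hm _ (by norm_num) (by norm_num)]
    exact h.live u hu

theorem nodes_extend {s s' : State} (h : s'.reg 2 = s.reg 2 + 2) :
    nodes s' = insert (s.reg 2 + 2) (insert (s.reg 2 + 1) (nodes s)) := by
  ext e
  simp only [nodes, Finset.mem_insert, Finset.mem_Icc, h]
  omega

theorem Store.extend {t : ℕ} {J : NonemptyInterval ℝ} {s s' : State} (h : Store X V I s)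
    (hf : Fresh t J s s') (ht : t ∉ X) (h2 : s'.reg 2 = s.reg 2 + 2)
    (hlv : s'.mem aLV = Function.update (Function.update (s.mem aLV) (s.reg 2 + 1) 1) (s.reg 2 + 2)
      0)
    (hlink : Linked (nodes s') s') :
    Store (insert t X) (insert t V) (Function.update I t J) s' := by
  have hne : ∀ u ∈ X, u ≠ t := by rintro u hu rfl; exact ht hu
  have hl : ∀ u ∈ X, s'.mem aLN u = s.mem aLN u := fun u hu => by
    rw [hf.left, Function.update_of_ne (hne u hu)]
  have hr : ∀ u ∈ X, s'.mem aRN u = s.mem aRN u := fun u hu => by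
    rw [hf.right, Function.update_of_ne (hne u hu)]
  have hn := nodes_extend h2
  have hlt : s'.mem aLN t = s.reg 2 + 1 := by rw [hf.left, Function.update_self]
  have hrt : s'.mem aRN t = s.reg 2 + 2 := by rw [hf.right, Function.update_self]
  refine ⟨Finset.insert_subset_insert t h.sub, ?_, fun u hu => ?_, fun e he => ?_, fun u hu => ?_,
    hlink.index, hlink.next⟩
  · rw [h2, h.card, Finset.card_insert_of_notMem ht]
    ring
  · rcases Finset.mem_insert.1 hu with rfl | hu
    · rw [Function.update_self]
      constructor <;> (try rw [hlt]) <;> (try rw [hrt]) <;> (try rw [hn]) <;> (try rw [hf.own]) <;>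
        (try rw [hf.ty]) <;> (try rw [hf.key]) <;> (try rw [hf.rk]) <;> (try rw [hlv]) <;> simp
    · rw [Function.update_of_ne (hne u hu)]
      refine (h.entry u hu).mono ?_ (hl u hu) (hr u hu) fun e he => ?_
      · rw [hn]
        exact (Finset.subset_insert _ _).trans (Finset.subset_insert _ _)
      · obtain ⟨a1, a2, a3⟩ := hf.agree he
        exact ⟨a1, a2, by rw [hlv, update_two_of_mem he], a3⟩
  · rw [hn, Finset.mem_insert, Finset.mem_insert] at he
    rcases he with rfl | rfl | he
    · have : s'.mem aOWN (s.reg 2 + 2) = t := by rw [hf.own]; simp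
      rw [this, hrt]
      simp
    · have : s'.mem aOWN (s.reg 2 + 1) = t := by rw [hf.own]; simp
      rw [this, hlt]
      simp
    · rw [(hf.agree he).1]
      obtain ⟨ho, he'⟩ := h.own e he
      rw [hl _ ho, hr _ ho]
      exact ⟨Finset.mem_insert_of_mem ho, he'⟩
  · rw [hlv]
    rcases Finset.mem_insert.1 hu with rfl | hu
    · rw [hlt]
      simp
    · rw [hl u hu, update_two_of_mem (h.entry u hu).left_mem, h.live u hu, Finset.mem_insert]
      simp [hne u hu]

/-- Registers `5` and `6` hold the new left and right nodes; both receive the right endpoint in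
`kRK`, so that reaching a point can be decided from either node. -/
def setup : Prog :=
  const 3 0 ;; const 4 1 ;; copy 5 2 ;; inc 5 ;; copy 6 5 ;; inc 6 ;; copy 50 0 ;; copy 30 5 ;;
    store aLN 0 5 ;; store aRN 0 6 ;; store aOWN 5 0 ;; store aOWN 6 0 ;; store aTY 5 3 ;;
    store aTY 6 4 ;; kstore kKEY 5 0 ;; kstore kKEY 6 1 ;; kstore kRK 5 1 ;; kstore kRK 6 1

/-- Clear register `7` if the new interval has neighbours. -/
def testIsolated : Prog :=
  const 7 1 ;; .ite (.eq 39 3) nop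
    (kload 20 kKEY 39 ;; kload 21 kRK 5 ;; .ite (.kle 20 21) (const 7 0) nop) ;; copy 31 4

/-- Color an interval without neighbours. -/
def placeIsolated : Prog := store 0 50 3 ;; store 1 50 3 ;; store aST 50 4

/-- The program for insertions. -/
def insertProg : Prog :=
  setup ;; findFirst ;; testIsolated ;; addNode ;; (copy 30 6 ;; copy 31 3) ;; addNode ;;
    (inc 2 ;; inc 2) ;; .ite (.eq 7 3) place placeIsolated

theorem arrs_setup : setup.arrs = [aLN, aRN, aOWN, aOWN, aTY, aTY] := rfl

theorem run_setup {s : State} {t : ℕ} {J : NonemptyInterval ℝ} (h0 : s.reg 0 = t)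
    (hl : s.kreg 0 = J.fst) (hr : s.kreg 1 = J.snd) :
    Fresh t J s (setup.run s) ∧ (setup.run s).reg 3 = 0 ∧ (setup.run s).reg 4 = 1 ∧
      (setup.run s).reg 5 = s.reg 2 + 1 ∧ (setup.run s).reg 6 = s.reg 2 + 2 ∧
      (setup.run s).reg 50 = t ∧ (setup.run s).reg 30 = s.reg 2 + 1 := by
  refine ⟨⟨?_, ?_, ?_, ?_, ?_, ?_⟩, ?_, ?_, ?_, ?_, ?_, ?_⟩ <;>
    simp [setup, Prog.run, Instr.apply, h0, hl, hr]

theorem run_testIsolated {s : State} (h0 : s.reg 3 = 0) (h1 : s.reg 4 = 1) :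
    (testIsolated.run s).reg 31 = 1 ∧
    (((testIsolated.run s).reg 7 = 1 ∧
        (s.reg 39 = 0 ∨ ¬ s.kmem kKEY (s.reg 39) ≤ s.kmem kRK (s.reg 5))) ∨
      ((testIsolated.run s).reg 7 = 0 ∧
        s.reg 39 ≠ 0 ∧ s.kmem kKEY (s.reg 39) ≤ s.kmem kRK (s.reg 5))) := by
  by_cases c1 : s.reg 39 = 0
  · simp [testIsolated, Prog.run, Test.Holds, Instr.apply, h0, h1, c1]
  by_cases c2 : s.kmem kKEY (s.reg 39) ≤ s.kmem kRK (s.reg 5) <;>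
    simp [testIsolated, Prog.run, Test.Holds, Instr.apply, h0, h1, c1, c2]

/-- Without neighbours the highest level is 0, for trivial reasons: any point of the interval is a
witness and no level occurs in it. So the argument of `good_insert` applies without a sweep. -/
theorem Store.runs_placeIsolated {t : ℕ} {s : State} (h : Store X V I s) (hc : Colored S s)
    (hgood : AllGood S s) (ht : t ∈ X) (htS : t ∉ S)
    (hno : ∀ u ∈ S, ¬ Meets (lpos s) (rpos s) u t) (h0 : s.reg 3 = 0) (h1 : s.reg 4 = 1)
    (h50 : s.reg 50 = t) :
    Runs placeIsolated s fun s' n => n ≤ 3 ∧ Store X V I s' ∧ Colored (insert t S) s' ∧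
      AllGood (insert t S) s' := by
  refine Runs.block rfl fun n hn => ?_
  have fr := Prog.framed_run (c := placeIsolated) rfl s
  have e : (placeIsolated.run s).mem 0 = Function.update (s.mem 0) t 0 ∧
      (placeIsolated.run s).mem 1 = Function.update (s.mem 1) t 0 ∧
      (placeIsolated.run s).mem aST = Function.update (s.mem aST) t 1 := by
    simp [placeIsolated, Prog.run, Instr.apply, h0, h1, h50]
  obtain ⟨m0, m1, m2⟩ := e
  generalize placeIsolated.run s = s' at *
  have same : SameTables s s' := ⟨fr.reg 1 (by decide), fr.reg 2 (by decide), fun a h3 h12 =>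
    fr.mem a (by simp only [placeIsolated, Prog.arrs, List.mem_append,
      List.mem_singleton]; omega), fr.kmem_eq rfl⟩
  have ne : ∀ u ∈ S, u ≠ t := fun u hu he => htS (he ▸ hu)
  have l0 : ∀ u ∈ S, s'.mem 0 u = s.mem 0 u := fun u hu => by
    rw [m0, Function.update_of_ne (ne u hu)]
  have l1 : ∀ u ∈ S, s'.mem 1 u = s.mem 1 u := fun u hu => by
    rw [m1, Function.update_of_ne (ne u hu)]
  have htt : lpos s t < rpos s t := (h.lpos_lt_rpos ht ht).2 (I t).fst_le_snd
  refine ⟨hn, h.congr same, ⟨fun u => ?_, ?_, ?_, ?_, ?_⟩, ?_⟩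
  · rw [m2, Function.update_apply, Finset.mem_insert]
    split_ifs with hu
    · simp [hu]
    · simp [hu, hc.part]
  · rw [same.lpos_eq, same.rpos_eq]
    intro u hu₀ w hw₀ hne hm hl
    rcases Finset.mem_insert.1 hu₀ with rfl | hu <;> rcases Finset.mem_insert.1 hw₀ with rfl | hw
    · exact absurd rfl hne
    · exact absurd hm.symm (hno w hw)
    · exact absurd hm (hno u hu)
    · rw [l0 u hu, l0 w hw] at hl
      rw [l1 u hu, l1 w hw]
      exact hc.proper u hu w hw hne hm hl
  · intro u hu
    rcases Finset.mem_insert.1 hu with rfl | hu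
    · rw [m1]; simp
    · rw [l1 u hu]; exact hc.off_le u hu
  · intro u hu hl
    rcases Finset.mem_insert.1 hu with rfl | hu
    · rw [m1]; simp
    · rw [l1 u hu]
      rw [l0 u hu] at hl
      exact hc.off_zero u hu hl
  · rw [fr.mem _ (by decide)]; exact hc.count
  · rw [AllGood, same.lpos_eq, same.rpos_eq]
    refine good_insert htS hgood (b := 0) ⟨lpos s t, ⟨le_rfl, htt⟩,
      fun i hi => absurd hi (by omega)⟩
      ?_ (by rw [m0]; simp) l0
    intro p hp hf
    obtain ⟨u, hu, -, hu'⟩ := hf 0 (by omega)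
    exact hno u hu (hu'.meets hp)

/-- The two bounds keep `d` out of the cost when there is no present neighbour: then the clique
number may be 1, and the stated time contains no term for `d`. -/
theorem runs_insertProg {s : State} {t : ℕ} {J : NonemptyInterval ℝ} (h : Store X V I s)
    (hc : Colored V s) (hgood : AllGood V s) (ht : t ∉ X) (h0 : s.reg 0 = t)
    (hl : s.kreg 0 = J.fst) (hr : s.kreg 1 = J.snd) {d : ℕ}
    (hd : Deg (insert t X) (Function.update I t J) d) :
    Runs insertProg s fun s' n =>
      (n ≤ 2000 * (height (X.card + 1) + 1) ∨
        (∃ u ∈ V, (I u).fst ≤ J.snd ∧ J.fst ≤ (I u).snd) ∧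
          n ≤ 2000 * (height (X.card + 1) + d + 1)) ∧
      Store (insert t X) (insert t V) (Function.update I t J) s' ∧ Colored (insert t V) s' ∧
      AllGood (insert t V) s' := by
  have htV : t ∉ V := fun h' => ht (h.sub h')
  refine Runs.seq (Runs.block rfl fun n1 hn1 => ?_)
  have hcost1 : setup.cost ≤ 18 := by decide
  obtain ⟨hf1, a3, a4, a5, a6, a50, a30⟩ := run_setup h0 hl hr
  have fr1 := Prog.framed_run (c := setup) rfl s
  generalize setup.run s = s1 at *
  have hst1 : Store X V I s1 := h.fresh hf1 ht (fr1.reg 1 (by decide)) (fr1.reg 2 (by decide))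
    fun a h7 h12 => fr1.mem a (by rw [arrs_setup]; simp; omega)
  refine Runs.seq ((hst1.runs_find a3 a4 (x := J.fst) (by rw [a30, hf1.key]; simp)).framed.mono ?_)
  rintro s2 n2 ⟨⟨⟨k, hk, hn2⟩, hres⟩, fr2⟩
  refine Runs.seq (Runs.block rfl fun n3 hn3 => ?_)
  have hcost3 : testIsolated.cost ≤ 7 := by decide
  have b3 : s2.reg 3 = 0 := by rw [fr2.reg 3 (by decide), a3]
  have b4 : s2.reg 4 = 1 := by rw [fr2.reg 4 (by decide), a4]
  obtain ⟨c31, c7⟩ := run_testIsolated b3 b4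
  have fr3 := Prog.framed_run (c := testIsolated) rfl s2
  generalize testIsolated.run s2 = s3 at *
  have m3 : s3.mem = s1.mem := by rw [fr3.mem_eq rfl, fr2.mem_eq rfl]
  have k3 : s3.kmem = s1.kmem := by rw [fr3.kmem_eq rfl, fr2.kmem_eq rfl]
  have k2 : s2.kmem = s1.kmem := fr2.kmem_eq rfl
  have r3 : ∀ x, x ∉ testIsolated.regs → x ∉ findFirst.regs → s3.reg x = s1.reg x :=
    fun x h h' => by rw [fr3.reg x h, fr2.reg x h']
  have hlink3 : Linked (nodes s) s3 := by
    have : nodes s = nodes s1 := by simp [nodes, fr1.reg 2 (by decide)]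
    rw [this]
    refine hst1.linked.congr (r3 1 (by decide) (by decide)) (fun a _ _ => by rw [m3])
      (fun e _ => by rw [m3]) fun e _ => by rw [k3]; simp
  have hc5 : s2.reg 5 = s.reg 2 + 1 := by rw [fr2.reg 5 (by decide), a5]
  -- neighbours
  have hnb : (s3.reg 7 = 1 ∧ ∀ u ∈ V, ¬ ((I u).fst ≤ J.snd ∧ J.fst ≤ (I u).snd)) ∨
      (s3.reg 7 = 0 ∧ ∃ u ∈ V, (I u).fst ≤ J.snd ∧ J.fst ≤ (I u).snd) := by
    have hrk : s2.kmem kRK (s2.reg 5) = J.snd := by rw [hc5, k2, hf1.rk]; simp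
    rw [hrk] at c7
    rcases hres with ⟨h39, hno⟩ | ⟨w, hw, h39, hjw, hfirst⟩
    · exact .inl ⟨(c7.resolve_right fun h' => h'.2.1 h39).1, fun u hu hu' => hno u hu hu'.2⟩
    · have en := hst1.entry w (h.sub hw)
      have hkey : s2.kmem kKEY (s2.reg 39) = (I w).fst := by rw [k2, h39, en.key_left]
      rw [hkey, h39] at c7
      rcases c7 with ⟨h7, hor⟩ | ⟨h7, -, hle⟩
      · have hgt := hor.resolve_left (nodes_ne_zero en.left_mem)
        -- The first hit starts leftmost among the present intervals that reach the new left
        -- endpoint; if it starts too late, so do all others.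
        refine .inl ⟨h7, fun u hu hu' => hgt (le_trans ?_ hu'.1)⟩
        have := hfirst u hu hu'.2
        by_contra! hcon
        refine absurd this (not_le.2 ?_)
        rw [lpos, lpos, pos_lt, en.key_left, (hst1.entry u (h.sub hu)).key_left]
        exact .inl hcon
      · exact .inr ⟨h7, w, hw, hle, hjw⟩
  have hn0 : 0 ∉ nodes s := fun h' => nodes_ne_zero h' rfl
  have hq1 : s.reg 2 + 1 ∉ nodes s := by simp [nodes]
  have hq2 : s.reg 2 + 2 ∉ insert (s.reg 2 + 1) (nodes s) := by simp [nodes]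
  have hcardn : (nodes s).card = 2 * X.card := by rw [nodes, Nat.card_Icc, h.card]; omega
  refine Runs.seq ((runs_addNode hlink3 hn0 hq1 (by omega)
    (by rw [r3 3 (by decide) (by decide), a3]) (by rw [r3 4 (by decide) (by decide), a4])
    (by rw [r3 30 (by decide) (by decide), a30])).framed.mono ?_)
  rintro s4 n4 ⟨⟨⟨k4, hk4, hn4⟩, hm4, hlv4, hlink4⟩, fr4⟩
  refine Runs.seq (Runs.block rfl fun n5 hn5 => ?_)
  simp only [Prog.cost] at hn5
  obtain ⟨s5, hs5⟩ : ∃ s5, Prog.run (copy 30 6 ;; copy 31 3) s4 = s5 := ⟨_, rfl⟩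
  have fr5 : Framed (copy 30 6 ;; copy 31 3) s4 s5 := by rw [← hs5]; exact Prog.framed_run rfl s4
  have r4 : ∀ x, x ∉ addNode.regs → x ∉ testIsolated.regs → x ∉ findFirst.regs →
      s4.reg x = s1.reg x := fun x h h' h'' => by rw [fr4.reg x h, r3 x h' h'']
  have d30 : s5.reg 30 = s.reg 2 + 2 := by
    rw [← hs5]
    simp [Prog.run, Instr.apply, r4 6 (by decide) (by decide) (by decide), a6]
  have d31 : s5.reg 31 = 0 := by
    rw [← hs5]
    simp [Prog.run, Instr.apply, r4 3 (by decide) (by decide) (by decide), a3]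
  rw [hs5]
  have hlink5 : Linked (insert (s.reg 2 + 1) (nodes s)) s5 :=
    hlink4.congr (fr5.reg 1 (by decide)) (fun a _ _ => by rw [fr5.mem_eq rfl])
      (fun e _ => by rw [fr5.mem_eq rfl]) fun e _ => by rw [fr5.kmem_eq rfl]; simp
  refine Runs.seq ((runs_addNode hlink5 (by simp [hn0]) hq2 (by omega)
    (by rw [fr5.reg 3 (by decide), r4 3 (by decide) (by decide) (by decide), a3])
    (by rw [fr5.reg 4 (by decide), r4 4 (by decide) (by decide) (by decide),
      a4]) d30).framed.mono ?_)
  rintro s6 n6 ⟨⟨⟨k6, hk6, hn6⟩, hm6, hlv6, hlink6⟩, fr6⟩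
  refine Runs.seq (Runs.block rfl fun n7 hn7 => ?_)
  simp only [Prog.cost] at hn7
  obtain ⟨s7, hs7⟩ : ∃ s7, Prog.run (inc 2 ;; inc 2) s6 = s7 := ⟨_, rfl⟩
  have fr7 : Framed (inc 2 ;; inc 2) s6 s7 := by rw [← hs7]; exact Prog.framed_run rfl s6
  have r6 : ∀ x, x ∉ addNode.regs → x ∉ (copy 30 6 ;; copy 31 3).regs → s6.reg x = s3.reg x :=
    fun x h h' => by rw [fr6.reg x h, fr5.reg x h', fr4.reg x h]
  have e2 : s7.reg 2 = s.reg 2 + 2 := by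
    rw [← hs7]
    simp [Prog.run, Instr.apply, r6 2 (by decide) (by decide), r3 2 (by decide) (by decide),
      fr1.reg 2 (by decide)]
  rw [hs7]
  have r7 : ∀ x, x ≠ 2 → x ∉ addNode.regs → x ∉ (copy 30 6 ;; copy 31 3).regs →
      s7.reg x = s3.reg x := fun x h2 h h' => by
    rw [fr7.reg x (by simp [Prog.regs, h2]), r6 x h h']
  have k7 : s7.kmem = s1.kmem := by
    rw [fr7.kmem_eq rfl, fr6.kmem_eq rfl, fr5.kmem_eq rfl, fr4.kmem_eq rfl, k3]
  have m7 : ∀ a, a ≠ aLV → a ≠ aLC → a ≠ aRC → a ≠ aHT → a ≠ aAG → a ≠ aSTK → a ≠ aDIR → a ≠ aNXT →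
      s7.mem a = s1.mem a := fun a b1 b2 b3 b4 b5 b6 b7 b8 => by
    rw [fr7.mem_eq rfl, hm6 a b1 b2 b3 b4 b5 b6 b7 b8, fr5.mem_eq rfl,
      hm4 a b1 b2 b3 b4 b5 b6 b7 b8, m3]
  have m7' : ∀ a, a < 7 ∨ a = aCNT → s7.mem a = s1.mem a := fun a ha =>
    m7 a (by omega) (by omega) (by omega) (by omega) (by omega) (by omega) (by omega) (by omega)
  have m1' : ∀ a, a < 3 ∨ a = aCNT → s1.mem a = s.mem a := fun a ha => 
    fr1.mem a (by rw [arrs_setup]; simp; omega)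
  have hf7 : Fresh t J s s7 := by
    obtain ⟨g1, g2, g3, g4, g5, g6⟩ := hf1
    refine ⟨?_, ?_, ?_, ?_, ?_, ?_⟩
    · rw [m7' _ (by norm_num), g1]
    · rw [m7' _ (by norm_num), g2]
    · rw [m7' _ (by norm_num), g3]
    · rw [m7' _ (by norm_num), g4]
    · rw [k7, g5]
    · rw [k7, g6]
  have hst7 : Store (insert t X) (insert t V) (Function.update I t J) s7 := by
    refine h.extend hf7 ht e2 ?_ ?_
    · rw [fr7.mem_eq rfl, hlv6, fr5.mem_eq rfl, hlv4, m3, d31, c31]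
      rw [fr1.mem aLV (by decide)]
    · rw [nodes_extend e2]
      exact hlink6.congr (fr7.reg 1 (by decide)) (fun a _ _ => by rw [fr7.mem_eq rfl])
        (fun e _ => by rw [fr7.mem_eq rfl]) fun e _ => by rw [fr7.kmem_eq rfl]; simp
  have hL : ∀ u ∈ V, lpos s7 u = lpos s u := fun u hu => hf7.lpos_eq h (h.sub hu) ht
  have hR : ∀ u ∈ V, rpos s7 u = rpos s u := fun u hu => hf7.rpos_eq h (h.sub hu) ht
  have hc7 : Colored V s7 := hc.congr (fun a ha => by
    rw [m7' a (by omega), m1' a (by omega)]) hL hR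
  have hg7 : AllGood V s7 := hgood.congr (by rw [m7' 0 (by omega), m1' 0 (by omega)]) hL hR
  have e3 : s7.reg 3 = 0 := by
    rw [r7 3 (by norm_num) (by decide) (by decide), r3 3 (by decide) (by decide), a3]
  have e4 : s7.reg 4 = 1 := by
    rw [r7 4 (by norm_num) (by decide) (by decide), r3 4 (by decide) (by decide), a4]
  have e50 : s7.reg 50 = t := by
    rw [r7 50 (by norm_num) (by decide) (by decide), r3 50 (by decide) (by decide), a50]
  have e7 : s7.reg 7 = s3.reg 7 := r7 7 (by norm_num) (by decide) (by decide)
  have htX : t ∈ insert t X := Finset.mem_insert_self _ _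
  -- costs
  have hh : ∀ j c, 2 ^ j ≤ (c + 1) ^ 2 → c ≤ 2 * X.card + 2 → j ≤ height (X.card + 1) := by
    intro j c hj hc
    exact le_height (hj.trans (Nat.pow_le_pow_left (by omega) 2))
  have hk1' := hh k (2 * X.card) hk (by omega)
  have hk4' := hh k4 _ hk4 (by omega)
  have hk6' := hh k6 _ hk6 (by rw [Finset.card_insert_of_notMem hq1]; omega)
  refine Runs.ite (fun h7 => ?_) fun h7 => ?_
  · simp only [Test.Holds, e7, e3] at h7
    have hnb := (hnb.resolve_left fun h' => by omega).2
    refine (hst7.runs_place hc7 hg7 (Finset.subset_insert _ _) (Finset.mem_insert_self _ _) htV e3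
      e4
      e50 hd).mono ?_
    rintro s8 n8 ⟨hn8, hs8⟩
    rw [Finset.card_insert_of_notMem ht] at hn8
    exact ⟨.inr ⟨hnb, by omega⟩, hs8⟩
  · simp only [Test.Holds, e7, e3] at h7
    have hnb := (hnb.resolve_right fun h' => by omega).2
    refine (hst7.runs_placeIsolated hc7 hg7 htX htV (fun u hu hm => ?_) e3 e4 e50).mono ?_
    · have hut : u ≠ t := by rintro rfl; exact htV hu
      rw [Meets, hst7.lpos_lt_rpos (Finset.mem_insert_of_mem (h.sub hu)) htX,
        hst7.lpos_lt_rpos htX (Finset.mem_insert_of_mem (h.sub hu)), Function.update_self,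
        Function.update_of_ne hut] at hm
      exact hnb u hu hm
    · rintro s8 n8 ⟨hn8, hs8⟩
      exact ⟨.inl (by omega), hs8⟩

end DynInterval

end

/-! ### Listing the neighbours of an interval, and its removal from the search. -/

noncomputable section

namespace DynInterval

variable {X V S : Finset ℕ} {I : ℕ → NonemptyInterval ℝ}

/-! ### Collecting the neighbours of an interval -/

/-- The set `A` is listed without repetitions by the first `c` entries of `f`. -/
structure Listed (A : Finset ℕ) (c : ℕ) (f : ℕ → ℕ) : Prop where
  mem : ∀ u, u ∈ A ↔ ∃ j < c, f j = u
  inj : ∀ i < c, ∀ j < c, f i = f j → i = j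

theorem Listed.insert {A : Finset ℕ} {c u : ℕ} {f : ℕ → ℕ} (h : Listed A c f) (hu : u ∉ A) :
    Listed (insert u A) (c + 1) (Function.update f c u) := by
  have old : ∀ j < c, Function.update f c u j = f j := fun j hj =>
    Function.update_of_ne (by omega) _ _
  have hne : ∀ j < c, f j ≠ u := fun j hj he => hu ((h.mem u).2 ⟨j, hj, he⟩)
  constructor
  · intro w
    rw [Finset.mem_insert, h.mem]
    constructor
    · rintro (rfl | ⟨j, hj, rfl⟩)
      · exact ⟨c, by omega, Function.update_self _ _ _⟩
      · exact ⟨j, by omega, old j hj⟩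
    · rintro ⟨j, hj, rfl⟩
      rcases Nat.lt_succ_iff_lt_or_eq.1 hj with hj | rfl
      · exact .inr ⟨j, hj, (old j hj).symm⟩
      · exact .inl (Function.update_self _ _ _)
  · intro i hi j hj he
    rcases Nat.lt_succ_iff_lt_or_eq.1 hi with hi | rfl <;>
      rcases Nat.lt_succ_iff_lt_or_eq.1 hj with hj | rfl
    · rw [old i hi, old j hj] at he
      exact h.inj i hi j hj he
    · rw [old i hi, Function.update_self] at he
      exact absurd he (hne i hi)
    · rw [old j hj, Function.update_self] at he
      exact absurd he.symm (hne j hj)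
    · rfl

theorem Listed.card {A : Finset ℕ} {c : ℕ} {f : ℕ → ℕ} (h : Listed A c f) : A.card = c := by
  have : A = (Finset.range c).image f := by
    ext u
    rw [h.mem]
    simp
  rw [this, Finset.card_image_of_injOn, Finset.card_range]
  intro i hi j hj
  exact h.inj i (by simpa using hi) j (by simpa using hj)

/-- Append the interval of the node in register `45` to the list, if the node is a left endpoint,
the interval takes part in the coloring and reaches the endpoint in register `42`. -/
def collect : Prog :=
  load 60 aTY 45 ;; .ite (.eq 60 3)
    (load 60 aOWN 45 ;; load 61 aST 60 ;; .ite (.eq 61 3) nop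
      (kload 20 kKEY 42 ;; kload 21 kRK 45 ;; .ite (.kle 20 21) (store aNB 8 60 ;; inc 8) nop)) nop

theorem run_collect {s : State} (h0 : s.reg 3 = 0) {u : ℕ} (hu : s.mem aOWN (s.reg 45) = u) :
    ((s.mem aTY (s.reg 45) = 0 ∧ s.mem aST u ≠ 0 ∧
        s.kmem kKEY (s.reg 42) ≤ s.kmem kRK (s.reg 45)) ∧
      (collect.run s).mem aNB = Function.update (s.mem aNB) (s.reg 8) u ∧
      (collect.run s).reg 8 = s.reg 8 + 1) ∨
    (¬ (s.mem aTY (s.reg 45) = 0 ∧ s.mem aST u ≠ 0 ∧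
        s.kmem kKEY (s.reg 42) ≤ s.kmem kRK (s.reg 45)) ∧
      (collect.run s).mem aNB = s.mem aNB ∧ (collect.run s).reg 8 = s.reg 8) := by
  by_cases c1 : s.mem aTY (s.reg 45) = 0
  swap
  · simp [collect, Prog.run, Test.Holds, Instr.apply, h0, c1]
  by_cases c2 : s.mem aST u = 0
  · simp [collect, Prog.run, Test.Holds, Instr.apply, h0, c1, hu, c2]
  by_cases c3 : s.kmem kKEY (s.reg 42) ≤ s.kmem kRK (s.reg 45) <;>
    simp [collect, Prog.run, Test.Holds, Instr.apply, h0, c1, hu, c2, c3]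

open Classical in
/-- The intervals in `S` that reach the left endpoint of `v` and start before the position `p`. -/
def started (s : State) (S : Finset ℕ) (v : ℕ) (p : ℝ ×ₗ ℤ) : Finset ℕ :=
  S.filter fun u => lpos s v < rpos s u ∧ lpos s u < p

/-- The state while collecting the neighbours of `v`. -/
structure CollectAt (s₀ : State) (S : Finset ℕ) (v e : ℕ) (s : State) : Prop where
  zero : s.reg 3 = 0
  one : s.reg 4 = 1
  left : s.reg 42 = s₀.mem aLN v
  right : s.reg 43 = s₀.mem aRN v
  cur : s.reg 45 = e
  mem : ∀ a, a ≠ aNB → s.mem a = s₀.mem a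
  kmem : s.kmem = s₀.kmem
  list : Listed (started s₀ S v (pos s₀.mem s₀.kmem e)) (s.reg 8) (s.mem aNB)

/-- Only left endpoints are recorded, which makes the list free of repetitions; starting before the
right end of `v` and reaching its left end is meeting `v`. -/
theorem Scene.run_collect {v : ℕ} {s₀ : State} (h : Scene X V I S v s₀) {e : ℕ} (he : e ∈ nodes s₀)
    (hez : pos s₀.mem s₀.kmem e < rpos s₀ v) {s : State} (hs : CollectAt s₀ S v e s) :
    CollectAt s₀ S v (s₀.mem aNXT e) ((collect.run s).set 45 (s₀.mem aNXT e)) := by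
  have fr := Prog.framed_run (c := collect) rfl s
  have hown : s.mem aOWN (s.reg 45) = s₀.mem aOWN e := by rw [hs.mem _ (by norm_num), hs.cur]
  have hcase := DynInterval.run_collect hs.zero hown
  obtain ⟨ho, he'⟩ := h.store.own e he
  have hcrit : s.kmem kKEY (s.reg 42) ≤ s.kmem kRK (s.reg 45) ↔
      lpos s₀ v < rpos s₀ (s₀.mem aOWN e) := by
    rw [hs.kmem, hs.left, hs.cur, h.reaches he]
  rw [hcrit, hs.mem aTY (by norm_num), hs.mem aST (by norm_num), hs.cur, h.part] at hcase
  have right := (h.store.entry v h.mem).right_mem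
  have hnext : ∀ u ∈ S, (lpos s₀ u < pos s₀.mem s₀.kmem (s₀.mem aNXT e) ↔
      lpos s₀ u ≤ pos s₀.mem s₀.kmem e) := fun u hu =>
    h.lt_next he right hez (h.store.entry u (h.sub hu)).left_mem
  generalize hu : s₀.mem aOWN e = u at *
  have en := h.store.entry u ho
  refine ⟨?_, ?_, ?_, ?_, ?_, ?_, ?_, ?_⟩
  · rw [State.set_reg, if_neg (by norm_num), fr.reg 3 (by decide), hs.zero]
  · rw [State.set_reg, if_neg (by norm_num), fr.reg 4 (by decide), hs.one]
  · rw [State.set_reg, if_neg (by norm_num), fr.reg 42 (by decide), hs.left]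
  · rw [State.set_reg, if_neg (by norm_num), fr.reg 43 (by decide), hs.right]
  · simp [State.set_reg]
  · intro a ha
    rw [State.set_mem, fr.mem a (by simp [collect, Prog.arrs, ha]), hs.mem a ha]
  · rw [State.set_kmem, fr.kmem_eq rfl, hs.kmem]
  rw [State.set_mem, State.set_reg, if_neg (by norm_num)]
  rcases hcase with ⟨⟨hty, huS, hreach⟩, e1, e2⟩ | ⟨hno, e1, e2⟩
  · have hel : e = s₀.mem aLN u := he'.resolve_right fun he' => by
      rw [he', en.ty_right] at hty
      exact one_ne_zero hty
    have hpe : pos s₀.mem s₀.kmem e = lpos s₀ u := by rw [hel]; rfl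
    have hset : started s₀ S v (pos s₀.mem s₀.kmem (s₀.mem aNXT e)) =
        insert u (started s₀ S v (pos s₀.mem s₀.kmem e)) := by
      ext w
      simp only [started, Finset.mem_insert, Finset.mem_filter]
      constructor
      · rintro ⟨hw, a1, a2⟩
        rw [hnext w hw] at a2
        rcases a2.lt_or_eq with a2 | a2
        · exact .inr ⟨hw, a1, a2⟩
        · exact .inl (h.store.lpos_injective (h.sub hw) ho (a2.trans hpe))
      · rintro (rfl | ⟨hw, a1, a2⟩)
        · exact ⟨huS, hreach, (hnext w huS).2 hpe.ge⟩
        · exact ⟨hw, a1, (hnext w hw).2 a2.le⟩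
    rw [hset, e1, e2]
    refine hs.list.insert ?_
    simp [started, hpe]
  · have hset : started s₀ S v (pos s₀.mem s₀.kmem (s₀.mem aNXT e)) =
        started s₀ S v (pos s₀.mem s₀.kmem e) := by
      ext w
      simp only [started, Finset.mem_filter]
      refine and_congr_right fun hw => and_congr_right fun hr => ?_
      rw [hnext w hw]
      refine ⟨fun hle => lt_of_le_of_ne hle fun heq => hno ?_, le_of_lt⟩
      have := pos_injective heq
      have hwe := h.store.entry w (h.sub hw)
      have hwu : w = u := by rw [← hu, ← this, hwe.own_left]
      subst hwu
      exact ⟨by rw [← this, hwe.ty_left], hw, hr⟩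
    rw [hset, e1, e2]
    exact hs.list

theorem Scene.runs_collect {v t : ℕ} {s₀ s : State} (h : Scene X V I S v s₀) (hSV : S ⊆ V)
    (ht : StartAt V s₀ v t) (hs : CollectAt s₀ ∅ v (s₀.mem aLN t) s) :
    Runs (walk 43 collect) s fun s' m =>
      CollectAt s₀ S v (s₀.mem aRN v) s' ∧
      m ≤ 15 * (between s₀ (s₀.mem aLN t) (s₀.mem aRN v)).card + 4 := by
  have en := h.store.entry v h.mem
  have hvv : lpos s₀ v < rpos s₀ v := (h.store.lpos_lt_rpos h.mem h.mem).2 (I v).fst_le_snd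
  have hcost : collect.cost ≤ 10 := by decide
  refine (runs_walk h.store.next (by norm_num) en.right_mem (k := 10)
    (fun w e s => w = 0 ∧ CollectAt s₀ S v e s) ?_ ?_ ?_
    (h.store.entry t (h.store.sub ht.mem)).left_mem (ht.le.trans hvv.le) (v := 0) ⟨rfl, ?_⟩).mono ?_
  · rintro w e t ⟨-, h⟩
    exact ⟨h.one, h.cur, h.right⟩
  · rintro w e t k ⟨hw, h⟩
    obtain ⟨a1, a2, a3, a4, a5, a6, a7, a8⟩ := h
    refine ⟨hw, ?_, ?_, ?_, ?_, ?_, a6, a7, ?_⟩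
    iterate 5 rwa [State.set_reg, if_neg (by norm_num)]
    rwa [State.set_reg, if_neg (by norm_num)]
  · rintro w e t he hlt ⟨rfl, ht⟩
    refine Runs.block rfl fun n hn => ?_
    have fr := Prog.framed_run (c := collect) rfl t
    refine ⟨?_, ?_, 0, ⟨rfl, h.run_collect he hlt ht⟩, by omega⟩
    · rw [fr.mem _ (by decide), ht.mem _ (by norm_num)]
    · rw [fr.reg _ (by decide), ht.cur]
  · obtain ⟨a1, a2, a3, a4, a5, a6, a7, a8⟩ := hs
    refine ⟨a1, a2, a3, a4, a5, a6, a7, ?_⟩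
    -- No interval of `S` that reaches `v` starts before `t`, so the empty list is correct at the
    -- start.
    convert a8 using 1
    rw [started, started, Finset.filter_empty, Finset.filter_eq_empty_iff]
    exact fun u hu hc => absurd (ht.first u (hSV hu) hc.1) (not_le.2 hc.2)
  · rintro s' m ⟨⟨w, -, h⟩, hm⟩
    exact ⟨h, by omega⟩

/-! ### Removing an interval from the tree -/

/-- Deleted intervals keep their nodes in the tree and in the list; clearing the entry in `aLV`
merely hides the left endpoint from the search. Hence the tree size is governed by all insertions.
-/
theorem Store.runs_kill {s : State} {v : ℕ} (h : Store X V I s) (hv : v ∈ X) (h0 : s.reg 3 = 0)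
    (h1 : s.reg 4 = 1) (h30 : s.reg 30 = s.mem aLN v) (h31 : s.reg 31 = 0) :
    Runs touch s fun s' n => n ≤ 600 * (height X.card + 1) ∧ Store X (V.erase v) I s' ∧
      (∀ a, a ≠ aLV → a ≠ aLC → a ≠ aRC → a ≠ aHT → a ≠ aAG → a ≠ aSTK → a ≠ aDIR →
        s'.mem a = s.mem a) := by
  obtain ⟨ℓ, hI, hℓ⟩ := h.index
  have en := h.entry v hv
  refine (runs_touch h0 h1 h30 (nodes_ne_zero en.left_mem) hI).framed.mono ?_
  rintro s' n ⟨⟨⟨k, hk, hn⟩, hmem, hlv, pre, post, hor, hI'⟩, fr⟩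
  rw [h.length hI hℓ] at hk
  have := le_height hk
  refine ⟨by nlinarith, ?_, hmem⟩
  have hnd : (pre ++ s.mem aLN v :: post).Nodup :=
    hI'.sorted.imp fun hlt heq => by subst heq; exact lt_irrefl _ hlt
  have hℓ' : ℓ = pre ++ s.mem aLN v :: post := by
    refine hor.resolve_left fun ⟨heq, _⟩ => ?_
    have := (hℓ _).2 en.left_mem
    rw [heq] at this
    rw [List.nodup_middle, List.nodup_cons] at hnd
    exact hnd.1 this
  have em : ∀ a, a < 7 ∨ a = aNXT → s'.mem a = s.mem a := fun a ha =>
    hmem a (by omega) (by omega) (by omega) (by omega) (by omega) (by omega) (by omega)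
  have hk' : s'.kmem = s.kmem := fr.kmem_eq rfl
  have h2 : s'.reg 2 = s.reg 2 := fr.reg 2 (by decide)
  have hnn : nodes s' = nodes s := by simp [nodes, h2]
  rw [h31] at hlv
  have hp : pos s'.mem s'.kmem = pos s.mem s.kmem := pos_congr (em _ (by norm_num)) hk'
  refine ⟨(Finset.erase_subset _ _).trans h.sub, h2.trans h.card, fun u hu => ?_, ?_,
    fun u hu => ?_,
    ⟨_, hI', ?_⟩, ?_⟩
  · obtain ⟨c1, c2, c3, c4, c5, c6, c7, c8, c9, c10, c11⟩ := h.entry u hu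
    constructor <;> simp only [em aLN (by norm_num), em aRN (by norm_num), em aOWN (by norm_num),
      em aTY (by norm_num), hnn, hk'] <;> try assumption
    rw [hlv, Function.update_apply, c11, ite_self]
  · simp only [em aLN (by norm_num), em aRN (by norm_num), em aOWN (by norm_num), hnn]
    exact h.own
  · rw [em aLN (by norm_num), hlv, Function.update_apply, Finset.mem_erase, ← h.live u hu]
    by_cases huv : u = v
    · simp [huv]
    · rw [if_neg]
      · simp [huv]
      · intro heq
        exact huv (h.lpos_injective hu hv (by rw [lpos, lpos, heq]))
  · rw [hnn, ← hℓ']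
    exact hℓ
  · rw [NextOk, hnn, hp, em aNXT (by norm_num)]
    exact h.next

end DynInterval

end

/-! ### Deletions. -/

noncomputable section

namespace DynInterval

variable {X V S : Finset ℕ} {I : ℕ → NonemptyInterval ℝ}

/-! ### Deletions -/

theorem Colored.mono {S' : Finset ℕ} {s s' : State} (h : Colored S s) (hS : S' ⊆ S)
    (e : SameTables s s') (hm : ∀ a, a = 0 ∨ a = 1 ∨ a = aCNT → s'.mem a = s.mem a)
    (hpart : ∀ t, s'.mem aST t ≠ 0 ↔ t ∈ S') : Colored S' s' := by
  obtain ⟨a1, a2, a3, a4, a5⟩ := h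
  refine ⟨hpart, ?_, ?_, ?_, ?_⟩
  · rw [hm 0 (by simp), hm 1 (by simp), e.lpos_eq, e.rpos_eq]
    exact fun u hu w hw => a2 u (hS hu) w (hS hw)
  · rw [hm 1 (by simp)]
    exact fun u hu => a3 u (hS hu)
  · rw [hm 0 (by simp), hm 1 (by simp)]
    exact fun u hu => a4 u (hS hu)
  · rwa [hm _ (by simp)]

/-- Take the next interval of the list out of the coloring if it is not good. -/
def recheck : Prog :=
  (load 50 aNB 9 ;; store aST 50 3) ;; check ;; .ite (.eq 53 3) nop (store aST 50 4) ;; inc 9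

/-- The interval is first taken out, since a sweep over `z` counts the other intervals only, and is
put back if the test succeeds. Its level and offset are kept meanwhile. -/
theorem Store.runs_recheck {s : State} (h : Store X V I s) (hc : Colored S s) (hSV : S ⊆ V) {z : ℕ}
    (hz : z ∈ S) (h0 : s.reg 3 = 0) (h1 : s.reg 4 = 1) (hnb : s.mem aNB (s.reg 9) = z) {d : ℕ}
    (hd : Deg X I d) :
    Runs recheck s fun s' n => n ≤ 40 * height X.card + 340 * d + 430 ∧ SameTables s s' ∧
      s'.mem 0 = s.mem 0 ∧ s'.mem aNB = s.mem aNB ∧ s'.reg 9 = s.reg 9 + 1 ∧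
      ((Good (lpos s) (rpos s) (s.mem 0) S z ∧ Colored S s') ∨
        (¬ Good (lpos s) (rpos s) (s.mem 0) S z ∧ Colored (S.erase z) s')) := by
  refine Runs.seq (Runs.block rfl fun n1 hn1 => ?_)
  simp only [Prog.cost] at hn1
  obtain ⟨s1, hs1⟩ : ∃ s1, Prog.run (load 50 aNB 9 ;; store aST 50 3) s = s1 := ⟨_, rfl⟩
  have fr1 : Framed (load 50 aNB 9 ;; store aST 50 3) s s1 := by
    rw [← hs1]; exact Prog.framed_run rfl s
  have hm1 : s1.mem = Function.update s.mem aST (Function.update (s.mem aST) z 0) := by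
    rw [← hs1]
    simp [Prog.run, Instr.apply, h0, hnb]
  have r50 : s1.reg 50 = z := by
    rw [← hs1]
    simp [Prog.run, Instr.apply, hnb]
  rw [hs1]
  have same1 : SameTables s s1 := ⟨fr1.reg 1 (by decide), fr1.reg 2 (by decide), fun a h3 _ => by
    rw [hm1, Function.update_of_ne (by omega)], fr1.kmem_eq rfl⟩
  have hc1 : Colored (S.erase z) s1 := by
    refine hc.mono (Finset.erase_subset _ _) same1 (fun a ha => ?_) fun t => ?_
    · rw [hm1, Function.update_of_ne (by omega)]
    · rw [hm1, Function.update_self, Function.update_apply, Finset.mem_erase, ← hc.part]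
      split_ifs with ht <;> simp [ht]
  have r3 : s1.reg 3 = 0 := by rw [fr1.reg 3 (by decide), h0]
  have r4 : s1.reg 4 = 1 := by rw [fr1.reg 4 (by decide), h1]
  refine Runs.seq (((h.congr same1).runs_check hc1 ((Finset.erase_subset _ _).trans hSV) (hSV hz)
    (Finset.notMem_erase _ _) r3 r4 r50 hd).framed.mono ?_)
  rintro s2 n2 ⟨⟨hn2, hm2, hgood⟩, fr2⟩
  rw [Finset.insert_erase hz, same1.lpos_eq, same1.rpos_eq] at hgood
  have hl1 : s1.mem 0 = s.mem 0 := by rw [hm1, Function.update_of_ne (by norm_num)]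
  rw [hl1] at hgood
  have t3 : s2.reg 3 = 0 := by rw [fr2.reg 3 (by decide), r3]
  have t4 : s2.reg 4 = 1 := by rw [fr2.reg 4 (by decide), r4]
  have t50 : s2.reg 50 = z := by rw [fr2.reg 50 (by decide), r50]
  have t9 : s2.reg 9 = s.reg 9 := by rw [fr2.reg 9 (by decide), fr1.reg 9 (by decide)]
  refine Runs.block rfl fun n3 hn3 => ?_
  have hcost : (Prog.ite (.eq 53 3) nop (store aST 50 4) ;; inc 9).cost ≤ 4 := by decide
  obtain ⟨s3, hs3⟩ : ∃ s3, Prog.run (.ite (.eq 53 3) nop (store aST 50 4) ;; inc 9) s2 = s3 :=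
    ⟨_, rfl⟩
  have fr3 : Framed (.ite (.eq 53 3) nop (store aST 50 4) ;; inc 9) s2 s3 := by
    rw [← hs3]; exact Prog.framed_run rfl s2
  rw [hs3]
  have hm3 : ∀ a, a ≠ aST → s3.mem a = s.mem a := fun a ha => by
    rw [fr3.mem a (by simp [Prog.arrs, ha]), hm2, hm1, Function.update_of_ne ha]
  have hst : s3.mem aST = Function.update (s.mem aST) z (if s2.reg 53 = 0 then 0 else 1) := by
    rw [← hs3]
    by_cases h53 : s2.reg 53 = 0 <;>
      simp [Prog.run, Test.Holds, Instr.apply, t3, t4, t50, h53, hm2, hm1]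
  have t9' : s3.reg 9 = s.reg 9 + 1 := by
    rw [← hs3]
    by_cases h53 : s2.reg 53 = 0 <;>
      simp [Prog.run, Test.Holds, Instr.apply, t3, h53, t9]
  have same3 : SameTables s s3 := by
    refine ⟨?_, ?_, fun a h3 _ => hm3 a (by omega), ?_⟩
    · rw [fr3.reg 1 (by decide), fr2.reg 1 (by decide), fr1.reg 1 (by decide)]
    · rw [fr3.reg 2 (by decide), fr2.reg 2 (by decide), fr1.reg 2 (by decide)]
    · rw [fr3.kmem_eq rfl, fr2.kmem_eq rfl, fr1.kmem_eq rfl]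
  refine ⟨by omega, same3, hm3 0 (by norm_num), hm3 aNB (by norm_num), t9', ?_⟩
  by_cases h53 : s2.reg 53 = 0
  · refine .inr ⟨fun hg => hgood.2 hg h53, hc.mono (Finset.erase_subset _ _) same3
      (fun a ha => hm3 a (by omega)) fun t => ?_⟩
    rw [hst, if_pos h53, Function.update_apply, Finset.mem_erase, ← hc.part]
    split_ifs with ht <;> simp [ht]
  · refine .inl ⟨hgood.1 h53, hc.mono subset_rfl same3 (fun a ha => hm3 a (by omega)) fun t => ?_⟩
    rw [hst, if_neg h53, Function.update_apply, ← hc.part]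
    split_ifs with ht
    · subst ht
      simpa using (hc.part t).2 hz
    · rfl

/-- What holds after the first `i` intervals of the list of neighbours have been tested, where the
intervals in `S` take part in the coloring. -/
structure Tested (V : Finset ℕ) (s₀ : State) (c i : ℕ) (S : Finset ℕ) (s : State) : Prop where
  zero : s.reg 3 = 0
  one : s.reg 4 = 1
  size : s.reg 8 = c
  idx : s.reg 9 = i
  le : i ≤ c
  same : SameTables s₀ s
  list : s.mem aNB = s₀.mem aNB
  colored : Colored S s
  sub : S ⊆ V
  out : ∀ u ∈ V, u ∉ S → ∃ j < c, s₀.mem aNB j = u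
  good : ∀ u ∈ S, Good (lpos s) (rpos s) (s.mem 0) S u ∨ ∃ j, i ≤ j ∧ j < c ∧ s₀.mem aNB j = u
  todo : ∀ j, i ≤ j → j < c → s₀.mem aNB j ∈ S

/-- One pass suffices: an interval found good stays good when later ones are taken out. -/
theorem Store.runs_recheck_loop {s₀ s : State} (h : Store X V I s₀) {c d : ℕ} (hd : Deg X I d)
    (hinj : ∀ i < c, ∀ j < c, s₀.mem aNB i = s₀.mem aNB j → i = j) (hs : Tested V s₀ c 0 S s) :
    Runs (whileNe 10 9 8 recheck) s fun s' n =>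
      n ≤ (40 * height X.card + 340 * d + 434) * c + 4 ∧ ∃ S', Tested V s₀ c c S' s' := by
  have := runs_whileNe (f := 10) (x := 9) (y := 8) (c := recheck) (by norm_num) (by norm_num)
    (fun v s => ∃ i S, Tested V s₀ c i S s ∧ v = (40 * height X.card + 340 * d + 434) * (c - i))
    (fun v s ⟨i, S, h, _⟩ => h.one)
    (by
      rintro v s k ⟨i, S, ⟨a1, a2, a3, a4, a5, a6, a7, a8, a9, a10, a11, a12⟩, hv⟩
      have e : SameTables s (s.set 10 k) :=
        ⟨by simp [State.set_reg], by simp [State.set_reg], fun _ _ _ => rfl, rfl⟩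
      refine ⟨i, S, ⟨?_, ?_, ?_, ?_, a5, a6.trans e, a7, ?_, a9, a10, ?_, a12⟩, hv⟩
      iterate 4 rwa [State.set_reg, if_neg (by norm_num)]
      · exact a8.congr (fun _ _ => rfl) (fun _ _ => rfl) fun _ _ => rfl
      · exact a11)
    (by
      rintro v s ⟨i, S, ⟨a1, a2, a3, a4, a5, a6, a7, a8, a9, a10, a11, a12⟩, rfl⟩ hne
      rw [a3, a4] at hne
      have hic : i < c := by omega
      have hz := a12 i le_rfl hic
      refine ((h.congr a6).runs_recheck a8 a9 hz a1 a2 (by rw [a7, a4]) hd).framed.mono ?_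
      rintro s' n ⟨⟨hn, same, hm0, hnb, h9, hor⟩, fr⟩
      refine ⟨(40 * height X.card + 340 * d + 434) * (c - (i + 1)), ?_, ?_⟩
      swap
      · have : c - i = (c - (i + 1)) + 1 := by omega
        rw [this, mul_add]
        have : n + 4 ≤ (40 * height X.card + 340 * d + 434) * 1 := by omega
        generalize (40 * height X.card + 340 * d + 434) * (c - (i + 1)) = y
        generalize (40 * height X.card + 340 * d + 434) * 1 = y' at *
        change n + 4 + y ≤ y + y'
        omega
      rw [same.lpos_eq.symm, same.rpos_eq.symm, ← hm0] at hor
      rw [same.lpos_eq.symm, same.rpos_eq.symm, ← hm0] at a11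
      rcases hor with ⟨hg, hc'⟩ | ⟨hg, hc'⟩
      · refine ⟨i + 1, S, ⟨?_, ?_, ?_, ?_, hic, a6.trans same, hnb.trans a7, hc', a9, a10, ?_, ?_⟩,
          rfl⟩
        · rw [fr.reg 3 (by decide), a1]
        · rw [fr.reg 4 (by decide), a2]
        · rw [fr.reg 8 (by decide), a3]
        · rw [h9, a4]
        · intro u hu
          rcases a11 u hu with hgu | ⟨j, hj, hjc, hju⟩
          · exact .inl hgu
          · rcases hj.lt_or_eq with hj | rfl
            · exact .inr ⟨j, hj, hjc, hju⟩
            · rw [hju] at hg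
              exact .inl hg
        · exact fun j hj => a12 j (by omega)
      · refine ⟨i + 1, S.erase (s₀.mem aNB i), ⟨?_, ?_, ?_, ?_, hic, a6.trans same, hnb.trans a7,
          hc',
          (Finset.erase_subset _ _).trans a9, ?_, ?_, ?_⟩, rfl⟩
        · rw [fr.reg 3 (by decide), a1]
        · rw [fr.reg 4 (by decide), a2]
        · rw [fr.reg 8 (by decide), a3]
        · rw [h9, a4]
        · intro u hu hu'
          by_cases hui : u = s₀.mem aNB i
          · exact ⟨i, hic, hui.symm⟩
          · exact a10 u hu fun h => hu' (Finset.mem_erase.2 ⟨hui, h⟩)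
        · intro u hu
          obtain ⟨hui, hu⟩ := Finset.mem_erase.1 hu
          rcases a11 u hu with hgu | ⟨j, hj, hjc, hju⟩
          -- Taking out an interval that is not good does no harm to the good ones.
          · exact .inl (hgu.erase_of_not_good hu hg)
          · rcases hj.lt_or_eq with hj | rfl
            · exact .inr ⟨j, hj, hjc, hju⟩
            · exact absurd hju.symm hui
        · intro j hj hjc
          refine Finset.mem_erase.2 ⟨fun heq => ?_, a12 j (by omega) hjc⟩
          -- The list has no repetitions, so the entries still to be tested are not the one taken
          -- out.
          have := hinj j hjc i hic heq
          omega)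
    (v := (40 * height X.card + 340 * d + 434) * (c - 0)) ⟨0, S, hs, rfl⟩
  refine this.mono ?_
  rintro s' n ⟨hn, ⟨-, i, T, ht, -⟩, heq⟩
  rw [ht.size, ht.idx] at heq
  subst heq
  exact ⟨by simpa using hn, T, ht⟩

/-- Color the next interval of the list if it does not take part in the coloring. -/
def recolor : Prog := (load 50 aNB 9 ;; load 60 aST 50) ;; .ite (.eq 60 3) place nop ;; inc 9

/-- What holds after the intervals of the list before index `i` have been colored. -/
structure Recolored (X V : Finset ℕ) (I : ℕ → NonemptyInterval ℝ) (f : ℕ → ℕ) (c i : ℕ)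
    (S : Finset ℕ) (s : State) : Prop where
  zero : s.reg 3 = 0
  one : s.reg 4 = 1
  size : s.reg 8 = c
  idx : s.reg 9 = i
  le : i ≤ c
  store : Store X V I s
  list : s.mem aNB = f
  colored : Colored S s
  good : AllGood S s
  sub : S ⊆ V
  out : ∀ u ∈ V, u ∉ S → ∃ j, i ≤ j ∧ j < c ∧ f j = u

theorem Recolored.runs_recolor {s : State} {f : ℕ → ℕ} {c i d : ℕ} (h : Recolored X V I f c i S s)
    (hic : i < c) (hf : f i ∈ V) (hd : Deg X I d) :
    Runs recolor s fun s' n => n ≤ 40 * height X.card + 340 * d + 440 ∧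
      ∃ S', Recolored X V I f c (i + 1) S' s' := by
  obtain ⟨a1, a2, a3, a4, a5, a6, a7, a8, a9, a10, a11⟩ := h
  refine Runs.seq (Runs.block rfl fun n1 hn1 => ?_)
  simp only [Prog.cost] at hn1
  obtain ⟨s1, hs1⟩ : ∃ s1, Prog.run (load 50 aNB 9 ;; load 60 aST 50) s = s1 := ⟨_, rfl⟩
  have fr1 : Framed (load 50 aNB 9 ;; load 60 aST 50) s s1 := by
    rw [← hs1]; exact Prog.framed_run rfl s
  have r50 : s1.reg 50 = f i := by
    rw [← hs1]
    simp [Prog.run, Instr.apply, a7, a4]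
  have r60 : s1.reg 60 = s.mem aST (f i) := by
    rw [← hs1]
    simp [Prog.run, Instr.apply, a7, a4]
  rw [hs1]
  have hm1 : s1.mem = s.mem := fr1.mem_eq rfl
  have same1 : SameTables s s1 := ⟨fr1.reg 1 (by decide), fr1.reg 2 (by decide), fun a _ _ => by
    rw [hm1], fr1.kmem_eq rfl⟩
  have r3 : s1.reg 3 = 0 := by rw [fr1.reg 3 (by decide), a1]
  have r4 : s1.reg 4 = 1 := by rw [fr1.reg 4 (by decide), a2]
  have hc1 : Colored S s1 := a8.mono subset_rfl same1 (fun a _ => by rw [hm1]) (by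
    rw [hm1]; exact a8.part)
  have hg1 : AllGood S s1 := a9.congr (by rw [hm1]) (fun u _ => by rw [same1.lpos_eq])
    fun u _ => by rw [same1.rpos_eq]
  have key : Runs (.ite (.eq 60 3) place nop) s1 fun s2 n2 =>
      n2 ≤ 40 * height X.card + 340 * d + 432 ∧ Store X V I s2 ∧ Colored (insert (f i) S) s2 ∧
        AllGood (insert (f i) S) s2 := by
    refine Runs.ite (fun h60 => ?_) fun h60 => ?_
    · simp only [Test.Holds, r60, r3] at h60
      have hiS : f i ∉ S := fun h' => (a8.part _).2 h' h60
      refine ((a6.congr same1).runs_place hc1 hg1 a10 hf hiS r3 r4 r50 hd).mono ?_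
      rintro s2 n2 ⟨hn2, hrest⟩
      exact ⟨by omega, hrest⟩
    · simp only [Test.Holds, r60, r3] at h60
      have hiS : f i ∈ S := (a8.part _).1 h60
      refine Runs.block rfl fun n2 hn2 => ?_
      simp only [Prog.cost] at hn2
      rw [Finset.insert_eq_self.2 hiS]
      exact ⟨by omega, a6.congr same1, hc1, hg1⟩
  refine Runs.seq (key.framed.mono ?_)
  rintro s2 n2 ⟨⟨hn2, hst2, hc2, hg2⟩, fr2⟩
  refine Runs.block rfl fun n3 hn3 => ?_
  simp only [Prog.cost] at hn3
  have heq : Prog.run (inc 9) s2 = s2.set 9 (s2.reg 9 + 1) := rfl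
  have e : SameTables s2 (s2.set 9 (s2.reg 9 + 1)) :=
    ⟨by simp [State.set_reg], by simp [State.set_reg], fun _ _ _ => rfl, rfl⟩
  rw [heq]
  refine ⟨by omega, insert (f i) S, ⟨?_, ?_, ?_, ?_, hic, hst2.congr e, ?_, ?_, ?_, ?_, ?_⟩⟩
  · rw [State.set_reg, if_neg (by norm_num), fr2.reg 3 (by decide), r3]
  · rw [State.set_reg, if_neg (by norm_num), fr2.reg 4 (by decide), r4]
  · rw [State.set_reg, if_neg (by norm_num), fr2.reg 8 (by decide), fr1.reg 8 (by decide), a3]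
  · rw [State.set_reg, if_pos rfl, fr2.reg 9 (by decide), fr1.reg 9 (by decide), a4]
  · rw [State.set_mem, fr2.mem _ (by decide), hm1, a7]
  · exact hc2.congr (fun _ _ => rfl) (fun _ _ => rfl) fun _ _ => rfl
  · exact hg2.congr rfl (fun _ _ => rfl) fun _ _ => rfl
  · exact Finset.insert_subset hf a10
  · intro u hu hu'
    rw [Finset.mem_insert, not_or] at hu'
    obtain ⟨j, hj, hjc, hju⟩ := a11 u hu hu'.2
    refine ⟨j, ?_, hjc, hju⟩
    rcases hj.lt_or_eq with hj | rfl
    · exact hj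
    · exact absurd hju.symm hu'.1

theorem Recolored.runs_loop {s : State} {f : ℕ → ℕ} {c d : ℕ} (h : Recolored X V I f c 0 S s)
    (hf : ∀ i < c, f i ∈ V) (hd : Deg X I d) :
    Runs (whileNe 10 9 8 recolor) s fun s' n =>
      n ≤ (40 * height X.card + 340 * d + 444) * c + 4 ∧ Store X V I s' ∧ Colored V s' ∧
        AllGood V s' := by
  have := runs_whileNe (f := 10) (x := 9) (y := 8) (c := recolor) (by norm_num) (by norm_num)
    (fun v s => ∃ i S, Recolored X V I f c i S s ∧
      v = (40 * height X.card + 340 * d + 444) * (c - i))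
    (fun v s ⟨i, S, h, _⟩ => h.one)
    (by
      rintro v s k ⟨i, S, ⟨a1, a2, a3, a4, a5, a6, a7, a8, a9, a10, a11⟩, hv⟩
      have e : SameTables s (s.set 10 k) :=
        ⟨by simp [State.set_reg], by simp [State.set_reg], fun _ _ _ => rfl, rfl⟩
      refine ⟨i, S, ⟨?_, ?_, ?_, ?_, a5, a6.congr e, a7, ?_, ?_, a10, a11⟩, hv⟩
      iterate 4 rwa [State.set_reg, if_neg (by norm_num)]
      · exact a8.congr (fun _ _ => rfl) (fun _ _ => rfl) fun _ _ => rfl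
      · exact a9.congr rfl (fun _ _ => rfl) fun _ _ => rfl)
    (by
      rintro v s ⟨i, S, h, rfl⟩ hne
      rw [h.size, h.idx] at hne
      have hic : i < c := lt_of_le_of_ne h.le hne
      refine (h.runs_recolor hic (hf i hic) hd).mono ?_
      rintro s' n ⟨hn, S', h'⟩
      refine ⟨_, ⟨i + 1, S', h', rfl⟩, ?_⟩
      have : c - i = (c - (i + 1)) + 1 := by omega
      rw [this, mul_add]
      have : n + 4 ≤ (40 * height X.card + 340 * d + 444) * 1 := by omega
      generalize (40 * height X.card + 340 * d + 444) * (c - (i + 1)) = y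
      generalize (40 * height X.card + 340 * d + 444) * 1 = y' at *
      change n + 4 + y ≤ y + y'
      omega)
    (v := (40 * height X.card + 340 * d + 444) * (c - 0)) ⟨0, S, h, rfl⟩
  refine this.mono ?_
  rintro s' n ⟨hn, ⟨v', i, S', ht, -⟩, heq⟩
  rw [ht.size, ht.idx] at heq
  subst heq
  have hS : S' = V := by
    refine Finset.Subset.antisymm ht.sub fun u hu => ?_
    by_contra hu'
    obtain ⟨j, hj, hj', -⟩ := ht.out u hu hu'
    omega
  subst hS
  exact ⟨by simpa using hn, ht.store, ht.colored, ht.good⟩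

/-- The program for deletions. -/
def deleteProg : Prog :=
  (const 3 0 ;; const 4 1 ;; load 42 aLN 0 ;; load 43 aRN 0 ;; copy 30 42 ;; store aST 0 3) ;;
    findFirst ;; (copy 45 39 ;; const 8 0 ;; copy 31 3) ;; walk 43 collect ;; touch ;; const 9 0 ;;
    whileNe 10 9 8 recheck ;; const 9 0 ;; whileNe 10 9 8 recolor

/-- Neighbours are collected while `v` is still visible, so that the search from its left endpoint
succeeds; `v` itself is excluded because it no longer takes part in the coloring. There are at most
`d` of them, each tested once and colored at most once, at a cost of O(height + d). -/
theorem runs_deleteProg {s : State} {v : ℕ} (h : Store X V I s) (hc : Colored V s)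
    (hgood : AllGood V s) (hv : v ∈ V) (hr0 : s.reg 0 = v) {d : ℕ} (hd : Deg X I d) :
    Runs deleteProg s fun s' n =>
      n ≤ 1000 * (height X.card + 1 + d * (height X.card + d + 1)) ∧
      Store X (V.erase v) I s' ∧ Colored (V.erase v) s' ∧ AllGood (V.erase v) s' := by
  have hvX := h.sub hv
  refine Runs.seq (Runs.block rfl fun n1 hn1 => ?_)
  simp only [Prog.cost] at hn1
  obtain ⟨s1, hs1⟩ : ∃ s1, Prog.run (const 3 0 ;; const 4 1 ;; load 42 aLN 0 ;; load 43 aRN 0 ;;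
    copy 30 42 ;; store aST 0 3) s = s1 := ⟨_, rfl⟩
  have fr1 : Framed (const 3 0 ;; const 4 1 ;; load 42 aLN 0 ;; load 43 aRN 0 ;;
    copy 30 42 ;; store aST 0 3) s s1 := by rw [← hs1]; exact Prog.framed_run rfl s
  have q : s1.mem = Function.update s.mem aST (Function.update (s.mem aST) v 0) ∧ s1.reg 3 = 0 ∧
      s1.reg 4 = 1 ∧ s1.reg 42 = s.mem aLN v ∧ s1.reg 43 = s.mem aRN v ∧ s1.reg 30 = s.mem aLN v :=
        by
    rw [← hs1]
    simp [Prog.run, Instr.apply, hr0]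
  obtain ⟨hm1, q3, q4, q42, q43, q30⟩ := q
  rw [hs1]
  have same1 : SameTables s s1 := ⟨fr1.reg 1 (by decide), fr1.reg 2 (by decide), fun a h3 _ => by
    rw [hm1, Function.update_of_ne (by omega)], fr1.kmem_eq rfl⟩
  have hst1 := h.congr same1
  have hc1 : Colored (V.erase v) s1 := by
    refine hc.mono (Finset.erase_subset _ _) same1 (fun a ha => ?_) fun t => ?_
    · rw [hm1, Function.update_of_ne (by omega)]
    · rw [hm1, Function.update_self, Function.update_apply, Finset.mem_erase, ← hc.part]
      split_ifs with ht <;> simp [ht]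
  have hln : s1.mem aLN = s.mem aLN := same1.mem _ (by norm_num) (by norm_num)
  have hrn : s1.mem aRN = s.mem aRN := same1.mem _ (by norm_num) (by norm_num)
  rw [← hln] at q42 q30
  rw [← hrn] at q43
  refine Runs.seq ((hst1.runs_find q3 q4 (x := (I v).fst)
    (by rw [q30, (hst1.entry v hvX).key_left])).framed.mono ?_)
  rintro s2 n2 ⟨⟨⟨k, hk, hn2⟩, hres⟩, fr2⟩
  have hkey : ∀ u ∈ V, ((I v).fst ≤ (I u).snd ↔ lpos s1 v < rpos s1 u) := fun u hu =>
    (hst1.lpos_lt_rpos hvX (h.sub hu)).symm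
  obtain ⟨t, ht, e39, hreach, hfirst⟩ := hres.resolve_left fun hno => hno.2 v hv (I v).fst_le_snd
  have hstart : StartAt V s1 v t := ⟨ht, hfirst v hv (I v).fst_le_snd, (hkey t ht).1 hreach,
    fun u hu hlt => hfirst u hu ((hkey u hu).2 hlt)⟩
  refine Runs.seq (Runs.block rfl fun n3 hn3 => ?_)
  simp only [Prog.cost] at hn3
  obtain ⟨s3, hs3⟩ : ∃ s3, Prog.run (copy 45 39 ;; const 8 0 ;; copy 31 3) s2 = s3 := ⟨_, rfl⟩
  have fr3 : Framed (copy 45 39 ;; const 8 0 ;; copy 31 3) s2 s3 := by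
    rw [← hs3]; exact Prog.framed_run rfl s2
  have u45 : s3.reg 45 = s1.mem aLN t ∧ s3.reg 8 = 0 ∧ s3.reg 31 = 0 := by
    rw [← hs3]
    simp [Prog.run, Instr.apply, e39, fr2.reg 3 (by decide), q3]
  obtain ⟨u45, u8, u31⟩ := u45
  rw [hs3]
  have r3 : ∀ x, x ∉ findFirst.regs → x ∉ (copy 45 39 ;; const 8 0 ;; copy 31 3).regs →
      s3.reg x = s1.reg x := fun x h h' => by rw [fr3.reg x h', fr2.reg x h]
  have m3 : s3.mem = s1.mem := by rw [fr3.mem_eq rfl, fr2.mem_eq rfl]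
  have k3 : s3.kmem = s1.kmem := by rw [fr3.kmem_eq rfl, fr2.kmem_eq rfl]
  have hscene : Scene X V I (V.erase v) v s1 :=
    ⟨hst1, (Finset.erase_subset _ _).trans h.sub, hc1.part, hvX, Finset.notMem_erase _ _⟩
  refine Runs.seq ((hscene.runs_collect (Finset.erase_subset _ _) hstart
    (s := s3) ⟨?_, ?_, ?_, ?_, u45, fun a _ => by rw [m3], k3, ?_⟩).framed.mono ?_)
  · rw [r3 3 (by decide) (by decide), q3]
  · rw [r3 4 (by decide) (by decide), q4]
  · rw [r3 42 (by decide) (by decide), q42]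
  · rw [r3 43 (by decide) (by decide), q43]
  · rw [u8, started, Finset.filter_empty]
    exact ⟨by simp, by simp⟩
  rintro s4 n4 ⟨⟨⟨p3, p4, p42, p43, p45, pm, pk, plist⟩, hn4⟩, fr4⟩
  have hD := hst1.card_between_le hd hvX hstart
  have same4 : SameTables s1 s4 := by
    refine ⟨?_, ?_, fun a _ h12 => pm a (by omega), pk⟩
    · rw [fr4.reg 1 (by decide), r3 1 (by decide) (by decide)]
    · rw [fr4.reg 2 (by decide), r3 2 (by decide) (by decide)]
  have hst4 := hst1.congr same4
  refine Runs.seq ((hst4.runs_kill hvX p3 p4 ?_ ?_).framed.mono ?_)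
  · rw [fr4.reg 30 (by decide), r3 30 (by decide) (by decide), q30, pm _ (by norm_num)]
  · rw [fr4.reg 31 (by decide), u31]
  rintro s5 n5 ⟨⟨hn5, hst5, hm5⟩, fr5⟩
  -- the list of the neighbours
  set c := s4.reg 8 with hcdef
  have hnb : s5.mem aNB = s4.mem aNB := hm5 _ (by norm_num) (by norm_num) (by norm_num)
    (by norm_num) (by norm_num) (by norm_num) (by norm_num)
  rw [← hnb] at plist
  have hm5' : ∀ a, a < 7 ∨ a = aCNT → s5.mem a = s1.mem a := fun a ha => by
    rw [hm5 a (by omega) (by omega) (by omega) (by omega) (by omega) (by omega) (by omega),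
      pm a (by omega)]
  have hp5 : pos s5.mem s5.kmem = pos s1.mem s1.kmem :=
    pos_congr (hm5' _ (by norm_num)) (by rw [fr5.kmem_eq rfl, pk])
  have hlp5 : lpos s5 = lpos s := by
    rw [← same1.lpos_eq]
    funext u; rw [lpos, hp5, hm5' _ (by norm_num)]; rfl
  have hrp5 : rpos s5 = rpos s := by
    rw [← same1.rpos_eq]
    funext u; rw [rpos, hp5, hm5' _ (by norm_num)]; rfl
  have hlist : ∀ u, (∃ j < c, s5.mem aNB j = u) ↔ u ∈ V.erase v ∧ Meets (lpos s) (rpos s) v u := by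
    intro u
    rw [← plist.mem]
    simp only [started, Finset.mem_filter]
    change _ ∧ _ ∧ lpos s1 u < rpos s1 v ↔ _
    rw [same1.lpos_eq, same1.rpos_eq]
    rfl
  have hcd : c ≤ d := by
    obtain ⟨N, hN, hNm, hNc⟩ := hd v hvX
    rw [← plist.card]
    have hvN : v ∈ N := hNm v hvX (I v).fst_le_snd (I v).fst_le_snd
    -- The bound `d + 1` of `Deg` counts `v` itself, which is not in the list.
    have hsub : started s1 (V.erase v) v (pos s1.mem s1.kmem (s1.mem aRN v)) ⊆ N.erase v := by
      intro u hu
      have hu' := (hlist u).1 ((plist.mem u).1 hu)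
      obtain ⟨huv, huV⟩ := Finset.mem_erase.1 hu'.1
      refine Finset.mem_erase.2 ⟨huv, hNm u (h.sub huV) ?_ ?_⟩
      · exact (h.lpos_lt_rpos (h.sub huV) hvX).1 hu'.2.2
      · exact (h.lpos_lt_rpos hvX (h.sub huV)).1 hu'.2.1
    have := Finset.card_le_card hsub
    rw [Finset.card_erase_of_mem hvN] at this
    omega
  have hl5 : s5.mem 0 = s.mem 0 := by
    rw [hm5' 0 (by norm_num), hm1, Function.update_of_ne (by norm_num)]
  have hc5 : Colored (V.erase v) s5 := hc1.congr (fun a ha => hm5' a (by omega))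
    (fun u _ => by rw [hlp5, same1.lpos_eq]) fun u _ => by rw [hrp5, same1.rpos_eq]
  refine Runs.seq (Runs.block rfl fun n6 hn6 => ?_)
  simp only [Prog.cost] at hn6
  have heq6 : Prog.run (const 9 0) s5 = s5.set 9 0 := rfl
  rw [heq6]
  have same6 : SameTables s5 (s5.set 9 0) :=
    ⟨by simp [State.set_reg], by simp [State.set_reg], fun _ _ _ => rfl, rfl⟩
  refine Runs.seq ((hst5.runs_recheck_loop (S := V.erase v) (s := s5.set 9 0) (c := c) hd plist.inj
    ⟨?_, ?_, ?_, ?_, Nat.zero_le _, same6, rfl, ?_, subset_rfl, ?_, ?_, ?_⟩).mono ?_)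
  · rw [State.set_reg, if_neg (by norm_num), fr5.reg 3 (by decide), p3]
  · rw [State.set_reg, if_neg (by norm_num), fr5.reg 4 (by decide), p4]
  · rw [State.set_reg, if_neg (by norm_num), fr5.reg 8 (by decide)]
  · rw [State.set_reg, if_pos rfl]
  · exact hc5.congr (fun _ _ => rfl) (fun _ _ => rfl) fun _ _ => rfl
  · exact fun u hu hu' => absurd hu hu'
  · rw [same6.lpos_eq, same6.rpos_eq, State.set_mem, hlp5, hrp5, hl5]
    intro u hu
    -- Intervals that miss `v` stay good; the others are on the list and still to be tested.
    by_cases hm : Meets (lpos s) (rpos s) v u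
    · obtain ⟨j, hj, hju⟩ := (hlist u).2 ⟨hu, hm⟩
      exact .inr ⟨j, by omega, hj, hju⟩
    · exact .inl ((hgood u (Finset.mem_of_mem_erase hu)).erase hm)
  · exact fun j _ hj => ((hlist _).1 ⟨j, hj, rfl⟩).1
  rintro s7 n7 ⟨hn7, S, ht⟩
  refine Runs.seq (Runs.block rfl fun n8 hn8 => ?_)
  simp only [Prog.cost] at hn8
  have heq8 : Prog.run (const 9 0) s7 = s7.set 9 0 := rfl
  rw [heq8]
  have same8 : SameTables s7 (s7.set 9 0) :=
    ⟨by simp [State.set_reg], by simp [State.set_reg], fun _ _ _ => rfl, rfl⟩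
  have hrec : Recolored X (V.erase v) I (s5.mem aNB) c 0 S (s7.set 9 0) := by
    refine ⟨?_, ?_, ?_, ?_, Nat.zero_le _, hst5.congr (ht.same.trans same8), ht.list, ?_, ?_,
      ht.sub,
      ?_⟩
    · rw [State.set_reg, if_neg (by norm_num), ht.zero]
    · rw [State.set_reg, if_neg (by norm_num), ht.one]
    · rw [State.set_reg, if_neg (by norm_num), ht.size]
    · rw [State.set_reg, if_pos rfl]
    · exact ht.colored.congr (fun _ _ => rfl) (fun _ _ => rfl) fun _ _ => rfl
    · intro u hu
      rcases ht.good u hu with hg | ⟨j, hj, hj', -⟩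
      · exact hg
      · omega
    · intro u hu hu'
      obtain ⟨j, hj, hju⟩ := ht.out u hu hu'
      exact ⟨j, by omega, hj, hju⟩
  refine (hrec.runs_loop (fun i hi => ((hlist _).1 ⟨i, hi, rfl⟩).1) hd).mono ?_
  rintro s9 n9 ⟨hn9, hres⟩
  refine ⟨?_, hres⟩
  have hk' := le_height hk
  have b7 : (40 * height X.card + 340 * d + 434) * c ≤
      (40 * height X.card + 340 * d + 434) * d := Nat.mul_le_mul_left _ hcd
  have b9 : (40 * height X.card + 340 * d + 444) * c ≤
      (40 * height X.card + 340 * d + 444) * d := Nat.mul_le_mul_left _ hcd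
  have hf : n7 + n9 ≤ (80 * height X.card + 680 * d + 878) * d + 8 := by
    refine (Nat.add_le_add (hn7.trans (Nat.add_le_add_right b7 4))
      (hn9.trans (Nat.add_le_add_right b9 4))).trans (le_of_eq ?_)
    ring
  generalize height X.card = H at *
  -- The term `60 * d` comes from collecting: 15 steps for each of at most `4 * d + 4` nodes.
  have : (80 * H + 680 * d + 878) * d + 60 * d ≤ 1000 * (d * (H + d + 1)) := by nlinarith
  rw [mul_add]
  omega

end DynInterval

end

/-! ### From the data structure to clique number, number of colors and asymptotic bounds. -/

noncomputable section

namespace DynInterval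

/-! ### The interval graph -/

theorem inter_nonempty_iff (a b : NonemptyInterval ℝ) :
    ((a : Set ℝ) ∩ (b : Set ℝ)).Nonempty ↔ a.fst ≤ b.snd ∧ b.fst ≤ a.snd := by
  have ha := a.fst_le_snd
  have hb := b.fst_le_snd
  constructor
  · rintro ⟨x, ⟨h1, h2⟩, h3, h4⟩
    exact ⟨h1.trans h4, h3.trans h2⟩
  · rintro ⟨h1, h2⟩
    exact ⟨max a.fst b.fst, ⟨le_max_left _ _, max_le ha h2⟩, le_max_right _ _, max_le h1 hb⟩

theorem History.deg (H : History) : Deg H.inserted H.interval H.delta := by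
  classical
  intro t ht
  refine ⟨H.inserted.filter fun u => (H.interval u).fst ≤ (H.interval t).snd ∧
    (H.interval t).fst ≤ (H.interval u).snd, Finset.filter_subset _ _, fun u hu h1 h2 =>
    Finset.mem_filter.2 ⟨hu, h1, h2⟩, ?_⟩
  have hdeg : H.insertedGraph.degree ⟨t, ht⟩ ≤ H.delta := by
    rw [History.delta]
    convert H.insertedGraph.degree_le_maxDegree ⟨t, ht⟩
  refine le_trans (Finset.card_le_card (t := insert t
    ((H.insertedGraph.neighborFinset ⟨t, ht⟩).image Subtype.val)) fun u hu => ?_) ?_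
  · obtain ⟨hu, h1, h2⟩ := Finset.mem_filter.1 hu
    rw [Finset.mem_insert]
    by_cases hut : u = t
    · exact .inl hut
    · refine .inr (Finset.mem_image.2 ⟨⟨u, hu⟩, ?_, rfl⟩)
      rw [SimpleGraph.mem_neighborFinset]
      exact ⟨fun h => hut (congrArg Subtype.val h).symm, (inter_nonempty_iff _ _).2 ⟨h2, h1⟩⟩
  · refine (Finset.card_insert_le _ _).trans (Nat.add_le_add_right ?_ 1)
    exact Finset.card_image_le.trans hdeg

/-- The inequality for all ordered pairs is pairwise intersection, so `T` spans a clique. -/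
theorem History.card_le_omega (H : History) {T : Finset ℕ} (hT : T ⊆ H.live)
    (h : ∀ u ∈ T, ∀ w ∈ T, (H.interval u).fst ≤ (H.interval w).snd) : T.card ≤ H.omega := by
  have hclique : H.liveGraph.IsClique ((T.subtype (· ∈ H.live) : Finset H.live) : Set H.live) := by
    intro u hu w hw hne
    have hu := Finset.mem_subtype.1 hu
    have hw := Finset.mem_subtype.1 hw
    exact ⟨hne, (inter_nonempty_iff _ _).2 ⟨h u hu w hw, h w hw u hu⟩⟩
  have := hclique.card_le_cliqueNum
  rwa [Finset.card_subtype, Finset.filter_true_of_mem fun u hu => hT hu] at this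

/-! ### The algorithm -/

def algorithm : Algorithm := ⟨insertProg, deleteProg⟩

/-- What holds between the updates. -/
structure Invariant (H : History) (s : State) : Prop where
  store : Store H.inserted H.live H.interval s
  colored : Colored H.live s
  good : AllGood H.live s
  time : ∀ i ∈ H.inserted, i < H.time

theorem invariant_init : Invariant History.empty State.init := by
  refine ⟨⟨subset_rfl, rfl, ?_, ?_, ?_, ⟨[], ⟨⟨rfl, rfl⟩, ⟨.leaf, trivial, rfl, trivial, rfl⟩,
    List.Pairwise.nil⟩, ?_⟩, ?_⟩, ⟨?_, ?_, ?_, ?_, fun _ => rfl⟩, ?_, ?_⟩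
  · simp [History.empty]
  · simp [nodes, State.init]
  · simp [History.empty]
  · simp [nodes, State.init]
  · simp [NextOk, nodes, State.init]
  · simp [History.empty, State.init]
  · simp [History.empty]
  · simp [History.empty]
  · simp [History.empty]
  · simp [AllGood, History.empty]
  · simp [History.empty]

theorem Invariant.input {H : History} {s : State} (h : Invariant H s) (k : ℕ) (u : Update) :
    Invariant H (s.input k u) := by
  have e : SameTables s (s.input k u) ∧ (s.input k u).mem = s.mem := by
    cases u <;> exact ⟨⟨by simp [State.input], by simp [State.input], fun _ _ _ => rfl, rfl⟩, rfl⟩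
  obtain ⟨e, em⟩ := e
  refine ⟨h.store.congr e, h.colored.congr (fun a _ => by rw [em]) (fun _ _ => by rw [e.lpos_eq])
    (fun _ _ => by rw [e.rpos_eq]), h.good.congr (by rw [em]) (fun _ _ => by rw [e.lpos_eq])
    (fun _ _ => by rw [e.rpos_eq]), h.time⟩

/-- A present neighbour and the new interval form a clique of size 2, which gives the second
alternative its lower bound on the clique number. -/
theorem Invariant.runs_insert {H : History} {s : State} (h : Invariant H s)
    (J : NonemptyInterval ℝ) :
    Runs algorithm.ins (s.input H.time (.insert J)) fun s' n =>
      Invariant (H.step (.insert J)) s' ∧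
      (n ≤ 2000 * (height (H.step (.insert J)).n + 1) ∨
        2 ≤ (H.step (.insert J)).omega ∧
          n ≤ 2000 * (height (H.step (.insert J)).n + (H.step (.insert J)).delta + 1)) := by
  have hI := h.input H.time (.insert J)
  have ht : H.time ∉ H.inserted := fun h' => lt_irrefl _ (h.time _ h')
  have hcard : (H.step (.insert J)).n = H.inserted.card + 1 := Finset.card_insert_of_notMem ht
  refine (runs_insertProg (t := H.time) (J := J) hI.store hI.colored hI.good ht
    (by simp [State.input]) (by simp [State.input]) (by simp [State.input])
    (H.step (.insert J)).deg).mono ?_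
  rintro s' n ⟨hn, h1, h2, h3⟩
  rw [← hcard] at hn
  refine ⟨⟨h1, h2, h3, ?_⟩, ?_⟩
  · intro i hi
    rcases Finset.mem_insert.1 hi with rfl | hi
    · exact Nat.lt_succ_self _
    · exact (h.time i hi).trans (Nat.lt_succ_self _)
  · refine hn.imp_right fun ⟨⟨u, hu, hu1, hu2⟩, hn⟩ => ⟨?_, hn⟩
    have hut : u ≠ H.time := by rintro rfl; exact ht (h.store.sub hu)
    have e1 : (H.step (.insert J)).interval H.time = J := Function.update_self _ _ _
    have e2 : (H.step (.insert J)).interval u = H.interval u := Function.update_of_ne hut _ _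
    have := (H.step (.insert J)).card_le_omega (T := {u, H.time}) (by
      intro w hw
      rw [Finset.mem_insert, Finset.mem_singleton] at hw
      rcases hw with rfl | rfl
      · exact Finset.mem_insert_of_mem hu
      · exact Finset.mem_insert_self _ _) (by
      intro w hw w' hw'
      rw [Finset.mem_insert, Finset.mem_singleton] at hw hw'
      rcases hw with rfl | rfl <;> rcases hw' with rfl | rfl
      · exact NonemptyInterval.fst_le_snd _
      · rw [e1, e2]; exact hu1
      · rw [e1, e2]; exact hu2
      · exact NonemptyInterval.fst_le_snd _)
    rwa [Finset.card_pair hut] at this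

theorem Invariant.runs_delete {H : History} {s : State} (h : Invariant H s) {v : ℕ}
    (hv : v ∈ H.live) :
    Runs algorithm.del (s.input H.time (.delete v)) fun s' n =>
      Invariant (H.step (.delete v)) s' ∧
      n ≤ 1000 * (height H.n + 1 + H.delta * (height H.n + H.delta + 1)) := by
  have hI := h.input H.time (.delete v)
  refine (runs_deleteProg hI.store hI.colored hI.good hv (by simp [State.input]) H.deg).mono ?_
  rintro s' n ⟨hn, h1, h2, h3⟩
  exact ⟨⟨h1, h2, h3, fun i hi => (h.time i hi).trans (Nat.lt_succ_self _)⟩, hn⟩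

/-- By determinism, the given execution is the one constructed for the current update. -/
theorem invariant_of_reaches {H : History} {s : State} (h : algorithm.Reaches H s) :
    Invariant H s := by
  induction h with
  | init => exact invariant_init
  | @step H s s' u T _ hleg hex ih =>
    cases u with
    | insert J =>
      obtain ⟨s'', n, hex', hI, -⟩ := ih.runs_insert J
      rw [(Exec.deterministic hex hex').1]
      exact hI
    | delete v =>
      obtain ⟨s'', n, hex', hI, -⟩ := ih.runs_delete hleg
      rw [(Exec.deterministic hex hex').1]
      exact hI

/-- The witness of a good interval of level k lies in k + 1 present intervals, which pairwise
intersect; so levels are below ω. -/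
theorem Invariant.properlyColored {H : History} {s : State} (h : Invariant H s) :
    ProperlyColored H s := by
  classical
  have hsub := h.store.sub
  have hlev : ∀ u ∈ H.live, s.mem 0 u < H.omega := by
    intro u hu
    obtain ⟨p, T, hT, hp, hcard⟩ := (h.good u hu).exists_card hu
    refine lt_of_lt_of_le (Nat.lt_of_succ_le hcard) (H.card_le_omega hT fun a ha b hb => ?_)
    exact (h.store.lpos_lt_rpos (hsub (hT ha)) (hsub (hT hb))).1 ((hp a ha).1.trans_lt (hp b hb).2)
  constructor
  · rintro ⟨i, hi⟩ ⟨j, hj⟩ ⟨hne, hint⟩ heq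
    obtain ⟨h1, h2⟩ := (inter_nonempty_iff _ _).1 hint
    have hm : Meets (lpos s) (rpos s) i j :=
      ⟨(h.store.lpos_lt_rpos (hsub hi) (hsub hj)).2 h1, (h.store.lpos_lt_rpos (hsub hj) (hsub
        hi)).2 h2⟩
    have heq := Prod.ext_iff.1 heq
    exact h.colored.proper i hi j hj (fun he => hne (Subtype.ext he)) hm heq.1 heq.2
  · have hsub : H.live.image s.color ⊆
        insert (0, 0) (Finset.Ico 1 H.omega ×ˢ Finset.range 3) := by
      intro c hc
      obtain ⟨u, hu, rfl⟩ := Finset.mem_image.1 hc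
      have h1 := hlev u hu
      have h2 := h.colored.off_le u hu
      rw [Finset.mem_insert]
      by_cases h0 : s.mem 0 u = 0
      · left
        rw [State.color, h0, h.colored.off_zero u hu h0]
      · right
        simp only [State.color, Finset.mem_product, Finset.mem_Ico, Finset.mem_range]
        omega
    rcases H.live.eq_empty_or_nonempty with he | ⟨u, hu⟩
    · simp [he]
    · have := hlev u hu
      refine (Finset.card_le_card hsub).trans ((Finset.card_insert_le _ _).trans ?_)
      rw [Finset.card_product, Nat.card_Ico, Finset.card_range]
      omega

/-! ### The number of steps -/

/-- For n ≥ 1, 2 to the height is at most (3n)², so the height times log 2 is at most 2 log 3 + 2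
log n, where log 3 ≤ 2 and log 2 > 2/3. -/
theorem height_le {n : ℕ} (hn : 1 ≤ n) : (height n : ℝ) ≤ 6 * (1 + Real.log n) := by
  have hn' : (1 : ℝ) ≤ n := by exact_mod_cast hn
  have h1 : 2 ^ height n ≤ (3 * n) ^ 2 :=
    (Nat.pow_log_le_self 2 (by positivity)).trans (Nat.pow_le_pow_left (by omega) 2)
  have h2 : (2 : ℝ) ^ height n ≤ (3 * n) ^ 2 := by exact_mod_cast h1
  have h3 := Real.log_le_log (by positivity) h2
  rw [Real.log_pow, Real.log_pow, Real.log_mul (by norm_num) (by positivity)] at h3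
  have h4 : Real.log 3 ≤ 2 := by
    have := Real.log_le_sub_one_of_pos (show (0 : ℝ) < 3 by norm_num)
    linarith
  have h5 := Real.log_two_gt_d9
  have h6 := Real.log_nonneg hn'
  have h7 : (0 : ℝ) ≤ height n := Nat.cast_nonneg _
  push_cast at h3
  nlinarith

/-- If the sweep is made, w ≥ 2 gives log w ≥ 1/2, hence d ≤ 2 d log w. -/
theorem insert_time {T n d w : ℕ} (hn : 1 ≤ n) (h : T ≤ 2000 * (height n + 1) ∨
    2 ≤ w ∧ T ≤ 2000 * (height n + d + 1)) :
    (T : ℝ) ≤ 44000 * (1 + Real.log n + d * Real.log w) := by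
  have h1 := height_le hn
  have h2 : 0 ≤ Real.log n := Real.log_natCast_nonneg n
  have h3 : 0 ≤ (d : ℝ) * Real.log w := mul_nonneg (Nat.cast_nonneg _) (Real.log_natCast_nonneg w)
  rcases h with h | ⟨hw, h⟩
  · have h' : (T : ℝ) ≤ 2000 * (height n + 1) := by exact_mod_cast h
    linarith
  · have h' : (T : ℝ) ≤ 2000 * (height n + d + 1) := by exact_mod_cast h
    have h4 : (1 : ℝ) / 2 ≤ Real.log w := by
      have := Real.log_two_gt_d9
      have := Real.log_le_log (by norm_num) (show (2 : ℝ) ≤ w by exact_mod_cast hw)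
      linarith
    have h5 := mul_le_mul_of_nonneg_left h4 (Nat.cast_nonneg (α := ℝ) d)
    linarith

/-- If d ≥ 1 then n ≥ 2 and log n ≥ 1/2. So the height is at most 18 log n, d at most 2 d log n and
1 at most 2 log n, which explains the factor 22. -/
theorem delete_time {T n d : ℕ} (hn : 1 ≤ n) (hd : d < n)
    (h : T ≤ 1000 * (height n + 1 + d * (height n + d + 1))) :
    (T : ℝ) ≤ 44000 * (1 + Real.log n + (d : ℝ) ^ 2 * Real.log n) := by
  have h1 := height_le hn
  have h2 : 0 ≤ Real.log n := Real.log_natCast_nonneg n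
  have h' : (T : ℝ) ≤ 1000 * (height n + 1 + d * (height n + d + 1)) := by exact_mod_cast h
  have key : (d : ℝ) * (height n + d + 1) ≤ 22 * ((d : ℝ) ^ 2 * Real.log n) := by
    rcases Nat.eq_zero_or_pos d with rfl | hpos
    · simp
    have hd1 : (1 : ℝ) ≤ d := by exact_mod_cast hpos
    have h4 : (1 : ℝ) / 2 ≤ Real.log n := by
      have := Real.log_two_gt_d9
      have := Real.log_le_log (by norm_num) (show (2 : ℝ) ≤ n by exact_mod_cast (by omega : 2 ≤ n))
      linarith
    have h5 : (height n : ℝ) + d + 1 ≤ d * (22 * Real.log n) := by nlinarith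
    calc (d : ℝ) * (height n + d + 1) ≤ d * (d * (22 * Real.log n)) :=
          mul_le_mul_of_nonneg_left h5 (by linarith)
      _ = _ := by ring
  have h3 : 0 ≤ (d : ℝ) ^ 2 * Real.log n := by positivity
  linarith

theorem History.delta_lt {H : History} (h : H.inserted.Nonempty) : H.delta < H.n := by
  classical
  have : Nonempty H.inserted := h.to_subtype
  have hlt := H.insertedGraph.maxDegree_lt_card_verts
  rw [Fintype.card_coe] at hlt
  rw [History.delta, History.n]
  convert hlt

end DynInterval

end

theorem mainTheorem2 :
    ∃ (A : DynInterval.Algorithm) (C : ℝ),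
      ∀ (H : DynInterval.History) (s : DynInterval.State), A.Reaches H s →
        DynInterval.ProperlyColored H s ∧
        (∀ I : NonemptyInterval ℝ, ∃ (s' : DynInterval.State) (T : ℕ),
          A.Handles H s (.insert I) s' T ∧
          (T : ℝ) ≤ C * (1 + Real.log ((H.step (.insert I)).n)
            + (H.step (.insert I)).delta * Real.log ((H.step (.insert I)).omega))) ∧
        (∀ i ∈ H.live, ∃ (s' : DynInterval.State) (T : ℕ),
          A.Handles H s (.delete i) s' T ∧
          (T : ℝ) ≤ C * (1 + Real.log H.n + (H.delta : ℝ) ^ 2 * Real.log H.n)) := by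
  refine ⟨DynInterval.algorithm, 44000, fun H s hs => ?_⟩
  have hI := DynInterval.invariant_of_reaches hs
  refine ⟨hI.properlyColored, fun J => ?_, fun i hi => ?_⟩
  · obtain ⟨s', T, hex, -, hT⟩ := hI.runs_insert J
    refine ⟨s', T, hex, DynInterval.insert_time ?_ hT⟩
    exact Finset.card_pos.2 ⟨H.time, Finset.mem_insert_self _ _⟩
  · obtain ⟨s', T, hex, -, hT⟩ := hI.runs_delete hi
    have hne : H.inserted.Nonempty := ⟨i, hI.store.sub hi⟩
    exact ⟨s', T, hex, DynInterval.delete_time (Finset.card_pos.2 hne)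
      (DynInterval.History.delta_lt hne) hT⟩
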